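/- Let $\alpha\in(\frac13,\frac12)$ and let $D^\alpha$ be the Fourier multiplier $\widehat{D^\alpha f}(\xi)=|\xi|^\alpha\widehat f(\xi)$ on $\mathbb R$. Let $I\subset(0,+\infty)$ be an interval with more than one point, and let $c\in I\mapsto\varphi_c\in H^{\alpha+1}(\mathbb R)$ be a smooth (it suffices: $C^1$ in the norm of $H^{\alpha+1}$) curve of positive solitary waves of the fKdV equation $u_t+uu_x-D^\alpha u_x=0$, that is, of positive functions with $$D^\alpha\varphi_c+c\,\varphi_c-\tfrac12\varphi_c^2=0 .$$ For $c\in I$ let $\mathcal L_c=D^\alpha+c-\varphi_c$ on $L^2(\mathbb R)$ with domain $H^\alpha(\mathbb R)$, and let $n(\mathcal L_c)$ be the number, counting multiplicity, of negative eigenvalues of $\mathcal L_c$. Let $c\in I$ be such that $\mathrm{Ker}(\mathcal L_c)=[\frac{d}{dx}\varphi_c]$, the linear span of $\frac{d}{dx}\varphi_c$. Suppose that one of the following two conditions is true (at an end point of $I$ the derivative in $c$ is one-sided): (i) $n(\mathcal L_c)$ is even and $\frac{d}{dc}\langle\varphi_c,\varphi_c\rangle>0$; (ii) $n(\mathcal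 L_c)$ is odd and $\frac{d}{dc}\langle\varphi_c,\varphi_c\rangle<0$. Then there are $\lambda>0$ and a real-valued $u\neq0$ with $u\in H^s(\mathbb R)$ for all $s\ge0$ such that the purely growing mode $w(x,t)=e^{\lambda t}u(x)$ solves the linearized equation $$(\partial_t-c\,\partial_x)w+\partial_x(\varphi_c w-D^\alpha w)=0 .$$ -/

import Mathlib

open MeasureTheory TemperedDistribution FourierTransform
open scoped SchwartzMap ENNReal ContDiff

namespace FKdV

noncomputable section

/-- The Hilbert space `L²(ℝ; ℂ)`. -/
abbrev L2 : Type := Lp ℂ 2 (volume : Measure ℝ)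

/-- The distributional derivative `∂ₓ f` of `f ∈ L²(ℝ)`, as a tempered distribution. -/
def ddx (f : L2) : 𝓢'(ℝ, ℂ) := derivCLM ℂ (f : 𝓢'(ℝ, ℂ))

/-- `f ∈ H^s(ℝ)`, for `f ∈ L²(ℝ)`. -/
def InH (s : ℝ) (f : L2) : Prop := MemSobolev s 2 (f : 𝓢'(ℝ, ℂ))

/-- The (unbounded) multiplication operator `u ↦ m u` on `L²(ℝ)`, with its maximal domain
`{u ∈ L² : m u ∈ L²}`. -/
def mulOp (m : ℝ → ℂ) : L2 →ₗ.[ℂ] L2 where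
  domain :=
    { carrier := {u | MemLp (fun x => m x * u x) 2 volume}
      add_mem' := by
        intro u v hu hv
        refine (hu.add hv).ae_eq ?_
        filter_upwards [Lp.coeFn_add u v] with x hx
        rw [hx]
        simp only [Pi.add_apply, mul_add]
      zero_mem' := by
        refine MemLp.zero.ae_eq (f := fun _ : ℝ => (0 : ℂ)) ?_
        filter_upwards [Lp.coeFn_zero ℂ 2 (volume : Measure ℝ)] with x hx
        rw [hx, Pi.zero_apply, mul_zero]
      smul_mem' := by
        intro a u hu
        refine (hu.const_mul a).ae_eq ?_
        filter_upwards [Lp.coeFn_smul a u] with x hx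
        rw [hx, Pi.smul_apply, smul_eq_mul, mul_left_comm] }
  toFun :=
    { toFun := fun u => u.2.toLp (fun x => m x * (u : L2) x)
      map_add' := by
        intro u v
        apply Lp.ext
        filter_upwards [MemLp.coeFn_toLp u.2, MemLp.coeFn_toLp v.2, MemLp.coeFn_toLp (u + v).2,
          Lp.coeFn_add (u : L2) (v : L2),
          Lp.coeFn_add (u.2.toLp (fun x => m x * (u : L2) x))
            (v.2.toLp (fun x => m x * (v : L2) x))] with x h1 h2 h3 h4 h5
        rw [h3, h5]
        simp only [Pi.add_apply, h1, h2]
        rw [Submodule.coe_add, h4, Pi.add_apply, mul_add]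
      map_smul' := by
        intro a u
        apply Lp.ext
        filter_upwards [MemLp.coeFn_toLp u.2, MemLp.coeFn_toLp (a • u).2,
          Lp.coeFn_smul a (u : L2),
          Lp.coeFn_smul a (u.2.toLp (fun x => m x * (u : L2) x))] with x h1 h2 h3 h4
        rw [h2]
        simp only [RingHom.id_apply]
        rw [h4]
        simp only [Pi.smul_apply, h1]
        rw [Submodule.coe_smul, h3, Pi.smul_apply, smul_eq_mul, smul_eq_mul, mul_left_comm] }

/-- The unbounded operator `D^α` on `L²(ℝ)`: multiplication by `|k|^α` on the Fourier side, on its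
maximal domain.  Mathlib's Fourier transform has the kernel `exp (-2πi x ξ)`, so the frequency
is `k = 2πξ`. -/
def fracD (α : ℝ) : L2 →ₗ.[ℂ] L2 :=
  let F : L2 ≃ₗ[ℂ] L2 := (Lp.fourierTransformₗᵢ ℝ ℂ).toLinearEquiv
  let M := mulOp (fun ξ => ((|2 * Real.pi * ξ| ^ α : ℝ) : ℂ))
  { domain := M.domain.comap F.toLinearMap
    toFun := F.symm.toLinearMap ∘ₗ M.toFun ∘ₗ
      (F.toLinearMap.restrict (p := M.domain.comap F.toLinearMap) (q := M.domain)
        (fun _ hu => hu)) }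

/-- The operator `L_c = D^α + c - φ` on `L²(ℝ)`.  By `linOp_domain` below, its domain is `H^α(ℝ)`
whenever `φ ∈ H^{α+1}(ℝ)`. -/
def linOp (α c : ℝ) (φ : L2) : L2 →ₗ.[ℂ] L2 :=
  fracD α + ((c : ℂ) • (LinearMap.id : L2 →ₗ[ℂ] L2)).toPMap ⊤ - mulOp φ

/-- `H^s(ℝ)` on the Fourier side. -/
theorem inH_iff_memLp (s : ℝ) (f : L2) :
    InH s f ↔ MemLp (fun ξ : ℝ => (((1 + ‖ξ‖ ^ 2) ^ (s / 2) : ℝ) : ℂ) * (𝓕 f : L2) ξ) 2 volume := by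
  set w : ℝ → ℂ := fun ξ => (((1 + ‖ξ‖ ^ 2) ^ (s / 2) : ℝ) : ℂ) with hw
  have hwg : w.HasTemperateGrowth := by fun_prop
  have hwc : Continuous w := hwg.1.continuous
  have hloc : LocallyIntegrable (fun ξ : ℝ => w ξ * (𝓕 f : L2) ξ) volume := by
    exact ((Lp.memLp (𝓕 f : L2)).locallyIntegrable (by norm_num)).continuous_mul hwc
  have key : ∀ f' : L2, smulLeftCLM ℂ w (𝓕 (f : 𝓢'(ℝ, ℂ))) = (f' : 𝓢'(ℝ, ℂ)) ↔
      (fun ξ : ℝ => w ξ * (𝓕 f : L2) ξ) =ᵐ[volume] f' := by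
    intro f'
    rw [Lp.fourier_toTemperedDistribution_eq]
    have hval : ∀ g : 𝓢(ℝ, ℂ), smulLeftCLM ℂ w ((𝓕 f : L2) : 𝓢'(ℝ, ℂ)) g =
        ∫ ξ, g ξ • (w ξ * (𝓕 f : L2) ξ) := by
      intro g
      rw [smulLeftCLM_apply_apply, Lp.toTemperedDistribution_apply]
      congr 1 with ξ
      rw [SchwartzMap.smulLeftCLM_apply_apply hwg]
      simp only [smul_eq_mul]
      ring
    constructor
    · intro h
      apply ae_eq_of_integral_contDiff_smul_eq hloc
        ((Lp.memLp f').locallyIntegrable (by norm_num))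
      intro g g_smooth g_cpt
      have hg₁ : HasCompactSupport (Complex.ofRealCLM ∘ g) := g_cpt.comp_left rfl
      have hg₂ : ContDiff ℝ ∞ (Complex.ofRealCLM ∘ g) := by fun_prop
      have := congrArg (fun T : 𝓢'(ℝ, ℂ) => T (hg₁.toSchwartzMap hg₂)) h
      simp only [hval, Lp.toTemperedDistribution_apply] at this
      simpa using this
    · intro h
      ext g
      rw [hval, Lp.toTemperedDistribution_apply]
      apply integral_congr_ae
      filter_upwards [h] with x hx
      rw [← hx]
  unfold InH
  rw [memSobolev_iff_exists_smulLeftCLM_fourier]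
  constructor
  · rintro ⟨f', h⟩
    exact (Lp.memLp f').ae_eq ((key f').1 h).symm
  · intro h
    exact ⟨h.toLp _, (key _).2 h.coeFn_toLp.symm⟩

/-- The domain of `D^α` is `H^α(ℝ)`. -/
theorem mem_fracD_domain {α : ℝ} (hα : 0 ≤ α) (u : L2) : u ∈ (fracD α).domain ↔ InH α u := by
  rw [inH_iff_memLp]
  change MemLp (fun ξ : ℝ => ((|2 * Real.pi * ξ| ^ α : ℝ) : ℂ) * (𝓕 u : L2) ξ) 2 volume ↔ _
  have hm := (Lp.memLp (𝓕 u : L2))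
  have hmeas := hm.aestronglyMeasurable
  have hsq : ∀ ξ : ℝ, (1 + ‖ξ‖ ^ 2) ^ (α / 2) = (Real.sqrt (1 + ξ ^ 2)) ^ α := by
    intro ξ
    rw [Real.sqrt_eq_rpow, ← Real.rpow_mul (by positivity), Real.norm_eq_abs, sq_abs]
    congr 1; ring
  have hn : ∀ r : ℝ, 0 ≤ r → ‖((r ^ α : ℝ) : ℂ)‖ = r ^ α := by
    intro r hr
    rw [Complex.norm_real, Real.norm_of_nonneg (Real.rpow_nonneg hr _)]
  simp only [hsq]
  constructor
  · intro h
    have h2 : MemLp (fun ξ : ℝ => (2 : ℝ) ^ α * ‖(𝓕 u : L2) ξ‖ + (2 : ℝ) ^ α *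
        ‖((|2 * Real.pi * ξ| ^ α : ℝ) : ℂ) * (𝓕 u : L2) ξ‖) 2 volume :=
      (hm.norm.const_mul _).add (h.norm.const_mul _)
    refine h2.of_le ?_ ?_
    · refine AEStronglyMeasurable.mul ?_ hmeas
      have : Continuous (fun ξ : ℝ => ((Real.sqrt (1 + ξ ^ 2) ^ α : ℝ) : ℂ)) := by
        exact Complex.continuous_ofReal.comp
          (Continuous.rpow_const (by fun_prop) (fun _ => Or.inr hα))
      exact this.aestronglyMeasurable
    · filter_upwards with ξ
      rw [Real.norm_of_nonneg (by positivity), norm_mul, norm_mul, hn _ (Real.sqrt_nonneg _),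
        hn _ (abs_nonneg _), ← mul_assoc, ← add_mul]
      gcongr
      rcases le_total |2 * Real.pi * ξ| 1 with h1 | h1
      · have : Real.sqrt (1 + ξ ^ 2) ≤ 2 := by
          rw [Real.sqrt_le_left (by norm_num)]
          have : |ξ| ≤ 1 := by
            rw [abs_mul, abs_of_pos (by positivity)] at h1
            nlinarith [Real.pi_gt_three, abs_nonneg ξ]
          nlinarith [sq_abs ξ, abs_nonneg ξ]
        calc _ ≤ (2 : ℝ) ^ α := by gcongr
          _ ≤ _ := by
            have : 0 ≤ (2 : ℝ) ^ α * |2 * Real.pi * ξ| ^ α := by positivity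
            linarith
      · have : Real.sqrt (1 + ξ ^ 2) ≤ 2 * |2 * Real.pi * ξ| := by
          rw [Real.sqrt_le_left (by positivity)]
          have h3 : |ξ| ≤ |2 * Real.pi * ξ| := by
            rw [abs_mul, abs_of_pos (by positivity : 0 < 2 * Real.pi)]
            nlinarith [Real.pi_gt_three, abs_nonneg ξ]
          nlinarith [sq_abs ξ, abs_nonneg ξ]
        calc _ ≤ (2 * |2 * Real.pi * ξ|) ^ α := by gcongr
          _ = (2 : ℝ) ^ α * |2 * Real.pi * ξ| ^ α := Real.mul_rpow (by norm_num) (by positivity)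
          _ ≤ _ := by
            have : 0 ≤ (2 : ℝ) ^ α := by positivity
            linarith
  · intro h
    refine (h.const_mul (((2 * Real.pi) ^ α : ℝ) : ℂ)).of_le ?_ ?_
    · refine AEStronglyMeasurable.mul ?_ hmeas
      have : Measurable (fun ξ : ℝ => ((|2 * Real.pi * ξ| ^ α : ℝ) : ℂ)) := by fun_prop
      exact this.aestronglyMeasurable
    · filter_upwards with ξ
      rw [norm_mul, norm_mul, norm_mul, hn _ (Real.sqrt_nonneg _), hn _ (abs_nonneg _),
        hn _ (by positivity), ← mul_assoc,
        ← Real.mul_rpow (by positivity) (by positivity)]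
      gcongr
      rw [abs_mul, abs_of_pos (by positivity : 0 < 2 * Real.pi)]
      gcongr
      apply Real.abs_le_sqrt
      linarith

/-- Functions in `H^s(ℝ)`, `s > 1/2`, are essentially bounded. -/
theorem ae_bounded_of_inH {s : ℝ} (hs : 1 / 2 < s) {f : L2} (hf : InH s f) :
    ∃ C : ℝ, ∀ᵐ x : ℝ, ‖f x‖ ≤ C := by
  obtain ⟨v, hv⟩ := MemSobolev.fourier_memL1 (by simp; linarith) hf
  have hvi : Integrable v volume := L1.integrable_coeFn v
  have hb : ∀ x : ℝ, ‖𝓕⁻ (v : ℝ → ℂ) x‖ ≤ ∫ ξ, ‖v ξ‖ := by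
    intro x
    rw [Real.fourierInv_eq]
    refine (norm_integral_le_integral_norm _).trans (le_of_eq ?_)
    congr 1 with ξ
    simp
  have hcont : Continuous (𝓕⁻ (v : ℝ → ℂ)) := by
    exact VectorFourier.fourierIntegral_continuous Real.continuous_fourierChar
      (L := -innerₗ ℝ) (by simpa using! continuous_inner.neg) hvi
  refine ⟨∫ ξ, ‖v ξ‖, ?_⟩
  have : (f : ℝ → ℂ) =ᵐ[volume] 𝓕⁻ (v : ℝ → ℂ) := by
    apply ae_eq_of_integral_contDiff_smul_eq
        ((Lp.memLp f).locallyIntegrable (by norm_num)) hcont.locallyIntegrable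
    intro g g_smooth g_cpt
    have hg₁ : HasCompactSupport (Complex.ofRealCLM ∘ g) := g_cpt.comp_left rfl
    have hg₂ : ContDiff ℝ ∞ (Complex.ofRealCLM ∘ g) := by fun_prop
    set G : 𝓢(ℝ, ℂ) := hg₁.toSchwartzMap hg₂
    have h1 := congrArg (fun T : 𝓢'(ℝ, ℂ) => T (𝓕⁻ G)) hv
    simp only [TemperedDistribution.fourier_apply, FourierTransform.fourier_fourierInv_eq,
      Lp.toTemperedDistribution_apply] at h1
    have h3 := VectorFourier.integral_fourierIntegral_smul_eq_flip (L := -innerₗ ℝ)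
      (f := G) (g := v) (μ := volume) (ν := volume) Real.continuous_fourierChar
      (by simpa using! continuous_inner.neg) G.integrable hvi
    have h4 : ((-innerₗ ℝ : ℝ →ₗ[ℝ] ℝ →ₗ[ℝ] ℝ)).flip = -innerₗ ℝ := by
      ext; simp
    rw [h4] at h3
    have h5 : ∫ x, G x • f x = ∫ x, G x • 𝓕⁻ (v : ℝ → ℂ) x := by
      rw [h1, SchwartzMap.fourierInv_coe]
      exact h3
    simpa [G] using h5
  filter_upwards [this] with x hx
  rw [hx]; exact hb x

/-- For `φ ∈ H^{α+1}(ℝ)` the domain of `L_c` is `H^α(ℝ)`. -/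
theorem linOp_domain {α : ℝ} (hα : 0 ≤ α) (c : ℝ) {φ : L2} (hφ : InH (α + 1) φ) (u : L2) :
    u ∈ (linOp α c φ).domain ↔ InH α u := by
  have hM : u ∈ (mulOp φ).domain := by
    obtain ⟨C, hC⟩ := ae_bounded_of_inH (by linarith) hφ
    change MemLp (fun x : ℝ => φ x * u x) 2 volume
    refine (Lp.memLp u).of_le_mul (c := C)
      ((Lp.memLp φ).aestronglyMeasurable.mul (Lp.memLp u).aestronglyMeasurable) ?_
    filter_upwards [hC] with x hx
    rw [norm_mul]
    gcongr
  rw [← mem_fracD_domain hα]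
  constructor
  · intro h
    exact h.1.1
  · intro h
    exact ⟨⟨h, trivial⟩, hM⟩

/-- The eigenspace `Ker(A - μ)` of an unbounded operator `A`. -/
def eigenspace (A : L2 →ₗ.[ℂ] L2) (μ : ℂ) : Submodule ℂ L2 :=
  (LinearMap.ker (A.toFun - μ • A.domain.subtype)).map A.domain.subtype

/-- The number, counting multiplicity, of negative eigenvalues of a self-adjoint `A`: the dimension
of the (automatically direct) sum of the eigenspaces `Ker(A - μ)`, `μ < 0`, possibly infinite. -/
def morseIndex (A : L2 →ₗ.[ℂ] L2) : ℕ∞ :=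
  Cardinal.toENat (Module.rank ℂ (⨆ μ : Set.Iio (0 : ℝ), eigenspace A ((μ : ℝ) : ℂ) : Submodule ℂ L2))

/-- `φ` is a positive solution in `H^{α+1}(ℝ)` of `D^α φ + c φ - φ² / 2 = 0`. -/
structure IsPositiveSolitaryWave (α c : ℝ) (φ : L2) : Prop where
  regular : InH (α + 1) φ
  pos : ∀ᵐ x : ℝ, ∃ r : ℝ, 0 < r ∧ φ x = (r : ℂ)
  eqn : ∃ (h₁ : φ ∈ (fracD α).domain) (h₂ : φ ∈ (mulOp φ).domain),
    fracD α ⟨φ, h₁⟩ + (c : ℂ) • φ - (1 / 2 : ℂ) • mulOp φ ⟨φ, h₂⟩ = 0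

/-- The curve `c ↦ φ c`, `c ∈ I`, lies in `H^s(ℝ)` and is continuously differentiable for the norm
of `H^s(ℝ)`, which is `‖J^s f‖_{L²}` with the Bessel potential `J^s`. -/
def IsC1CurveInH (s : ℝ) (I : Set ℝ) (φ : ℝ → L2) : Prop :=
  ∃ g : ℝ → L2, (∀ c ∈ I, besselPotential ℝ ℂ s (φ c : 𝓢'(ℝ, ℂ)) = (g c : 𝓢'(ℝ, ℂ))) ∧
    ContDiffOn ℝ 1 g I

/-- `w` solves the linearized equation `(∂ₜ - c ∂ₓ) w + ∂ₓ (φ w - D^α w) = 0` for all times: the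
time derivative is taken in `L²(ℝ)`, the space derivatives in the sense of distributions. -/
def SolvesLinearized (α c : ℝ) (φ : L2) (w : ℝ → L2) : Prop :=
  ∀ t : ℝ, ∃ (h₁ : w t ∈ (fracD α).domain) (h₂ : w t ∈ (mulOp φ).domain) (wt : L2),
    HasDerivAt w wt t ∧
      (wt : 𝓢'(ℝ, ℂ)) - (c : ℂ) • ddx (w t) + ddx (mulOp φ ⟨w t, h₂⟩ - fracD α ⟨w t, h₁⟩) = 0

end

end FKdV

/-! With `L = D^α + c - φ`, the function `e^{lt} u` solves the linearized equation when `∂ₓ L u = l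
u`, that is, formally, when `(L - l ∂ₓ⁻¹) u = 0`. Since `c > 0`, the operator `D^α + c - l ∂ₓ⁻¹` has
a bounded inverse `Y l`, the Fourier multiplier with symbol `(|k|^α + c + i l / k)⁻¹`. The problem
becomes `u = Y l (φ u)`, and some `l > 0` is found by continuity.

Let `e_1, …, e_n` be orthonormal with `L e_i = -ν_i e_i`, `ν_i > 0`, spanning the negative
eigenspaces, and let `e_0` be the normalized `φ'`, with `ν_0 = 0`. The finite rank operator `F = ∑
(1 + ν_i) ⟨e_i, ·⟩ e_i` moves all these eigenvalues to `1`. As `φ ∈ L²` and `|k|^α → ∞`, the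
operator `Y 0 ∘ φ` is compact, so `L` has a positive lower bound on the orthogonal complement of the
`e_i` (`exists_gap`), and `L + F` is coercive (`spectralShift_coercive`). The skew term `l ∂ₓ⁻¹`
does not contribute to the real quadratic form. Hence `R l = (L + F - l ∂ₓ⁻¹)⁻¹` exists for every
`l`, with bounds uniform in `l`, and a zero of `det M(l)`, `M(l)_{ij} = δ_ij - (1 + ν_j) ⟨e_i, R l
e_j⟩`, yields a kernel element of `L - l ∂ₓ⁻¹`.

As `l → ∞`, `R l → 0` strongly and `det M(l) → 1`. Near `l = 0` one uses `∂ₓ⁻¹ φ' = φ`: it gives `R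
l e_0 = e_0 + l R l b`, with `b` a positive multiple of `φ`, so that `det M(l) = l² det M'(l)` with
`det M'(0) = -(-1)^n (∏ ν_i) ⟨χ, b⟩` and `L χ = -b`. Differentiating the equation of the waves in
`c` shows that `χ` is the same multiple of `dφ/dc` (`exists_curve_derivative`); therefore `⟨χ, b⟩`
has the sign of `d/dc ⟨φ, φ⟩`. Either of the two conditions makes `(-1)^n ⟨χ, b⟩` positive, hence
`det M < 0` for small `l > 0`, and the intermediate value theorem applies
(`exists_kernel_of_parity`).

The determinant must be real, so this is done on the space of real-valued functions
(`exists_real_kernel_of_parity`). The concrete inputs are `resL_family` and `resL_mul_isCompact`.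
Smoothness of `u` is a bootstrap: `Y l` gains `α` derivatives, and multiplication by the smooth `φ`
loses none. -/

namespace FKdV

/-! ### Resolvents of coercive, not necessarily symmetric, operators on a real Hilbert space. -/

section RealHilbert

open Filter Topology
open scoped InnerProductSpace

variable {X : Type*} [NormedAddCommGroup X] [InnerProductSpace ℝ X]

/-- A priori bound for `w - Y Q w = r` when `Y⁻¹ - Q` is coercive. -/
theorem norm_le_of_coercive {Y Q : X →L[ℝ] X} {δ : ℝ} (hδ : 0 < δ)
    (hY : ∀ h, δ * ‖Y h‖ ^ 2 ≤ ⟪h - Q (Y h), Y h⟫_ℝ) (w : X) :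
    ‖w‖ ≤ (1 + ‖Q‖ / δ) * ‖w - Y (Q w)‖ := by
  set r := w - Y (Q w) with hr
  -- Coercivity is tested at `Y (Q w)`, where `Y⁻¹ - Q` takes the value `Q w - Q (Y (Q w)) = Q r`.
  have h1 := hY (Q w)
  have h2 : Q w - Q (Y (Q w)) = Q r := by rw [hr, map_sub]
  rw [h2] at h1
  have h3 : ⟪Q r, Y (Q w)⟫_ℝ ≤ ‖Q‖ * ‖r‖ * ‖Y (Q w)‖ :=
    (real_inner_le_norm _ _).trans (by gcongr; exact Q.le_opNorm r)
  have h4 : ‖Y (Q w)‖ ≤ ‖Q‖ / δ * ‖r‖ := by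
    rcases (norm_nonneg (Y (Q w))).eq_or_lt with h0 | h0
    · rw [← h0]; positivity
    · have : δ * ‖Y (Q w)‖ ≤ ‖Q‖ * ‖r‖ := by
        refine le_of_mul_le_mul_right ?_ h0
        nlinarith
      rw [div_mul_eq_mul_div, le_div_iff₀ hδ]
      linarith
  calc ‖w‖ = ‖r + Y (Q w)‖ := by rw [hr]; simp
    _ ≤ ‖r‖ + ‖Y (Q w)‖ := norm_add_le _ _
    _ ≤ _ := by linarith

/-- The a priori bound gives injectivity and closed range. The range is dense because a vector `f`
orthogonal to it satisfies `f = Q (Y' f)`, and coercivity for the adjoint `Y'` then forces `Y' f =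
0`, whence `f = 0`. -/
theorem isUnit_of_coercive [CompleteSpace X] {Y Y' Q : X →L[ℝ] X} {δ : ℝ} (hδ : 0 < δ)
    (hadj : ∀ f g, ⟪Y f, g⟫_ℝ = ⟪f, Y' g⟫_ℝ) (hQ : ∀ f g, ⟪Q f, g⟫_ℝ = ⟪f, Q g⟫_ℝ)
    (hY : ∀ h, δ * ‖Y h‖ ^ 2 ≤ ⟪h - Q (Y h), Y h⟫_ℝ)
    (hY' : ∀ h, δ * ‖Y' h‖ ^ 2 ≤ ⟪h - Q (Y' h), Y' h⟫_ℝ) :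
    IsUnit (1 - Y * Q) := by
  set T : X →L[ℝ] X := 1 - Y * Q with hT
  have hTa : ∀ w, T w = w - Y (Q w) := fun w => by simp [hT]
  have hanti : AntilipschitzWith (1 + ‖Q‖ / δ).toNNReal T := by
    refine ContinuousLinearMap.antilipschitz_of_bound _ fun w => ?_
    rw [Real.coe_toNNReal _ (by positivity), hTa]
    exact norm_le_of_coercive hδ hY w
  have hclosed : IsClosed (Set.range T) := hanti.isClosed_range T.uniformContinuous
  have hrange : T.range = ⊤ := by
    have hc : IsClosed (T.range : Set X) := by rw [LinearMap.coe_range]; exact hclosed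
    have : CompleteSpace T.range := hc.completeSpace_coe
    rw [← Submodule.orthogonal_eq_bot_iff, Submodule.eq_bot_iff]
    intro f hf
    have hf' : ∀ w, ⟪T w, f⟫_ℝ = 0 := fun w => hf _ ⟨w, rfl⟩
    have h1 : f - Q (Y' f) = 0 := by
      rw [← inner_self_eq_zero (𝕜 := ℝ)]
      have := hf' (f - Q (Y' f))
      rw [hTa, inner_sub_left, hadj, hQ, ← inner_sub_right] at this
      exact this
    have h2 := hY' f
    rw [h1, inner_zero_left] at h2
    have h3 : Y' f = 0 := by
      have : ‖Y' f‖ ^ 2 = 0 := by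
        have := sq_nonneg ‖Y' f‖
        nlinarith
      simpa using this
    rw [h3, map_zero, sub_zero] at h1
    exact h1
  rw [ContinuousLinearMap.isUnit_iff_bijective]
  exact ⟨hanti.injective, LinearMap.range_eq_top.1 hrange⟩

/-- The resolvent `(Y⁻¹ - Q)⁻¹`. -/
theorem exists_resolvent [CompleteSpace X] {Y Y' Q : X →L[ℝ] X} {δ : ℝ} (hδ : 0 < δ)
    (hadj : ∀ f g, ⟪Y f, g⟫_ℝ = ⟪f, Y' g⟫_ℝ) (hQ : ∀ f g, ⟪Q f, g⟫_ℝ = ⟪f, Q g⟫_ℝ)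
    (hY : ∀ h, δ * ‖Y h‖ ^ 2 ≤ ⟪h - Q (Y h), Y h⟫_ℝ)
    (hY' : ∀ h, δ * ‖Y' h‖ ^ 2 ≤ ⟪h - Q (Y' h), Y' h⟫_ℝ) :
    ∃ R : X →L[ℝ] X, ∀ w g, w = R g ↔ w = Y (Q w + g) := by
  obtain ⟨u, hu⟩ := isUnit_of_coercive hδ hadj hQ hY hY'
  refine ⟨(↑u⁻¹ : X →L[ℝ] X) * Y, fun w g => ?_⟩
  have h1 : ∀ x, (u : X →L[ℝ] X) ((↑u⁻¹ : X →L[ℝ] X) x) = x := fun x => by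
    rw [← mul_apply_eq_comp, Units.mul_inv]; rfl
  have h2 : ∀ x, (↑u⁻¹ : X →L[ℝ] X) ((u : X →L[ℝ] X) x) = x := fun x => by
    rw [← mul_apply_eq_comp, Units.inv_mul]; rfl
  have h3 : ∀ x, (u : X →L[ℝ] X) x = x - Y (Q x) := fun x => by rw [hu]; simp
  rw [mul_apply_eq_comp]
  constructor
  · intro h
    have := congrArg (fun z => (u : X →L[ℝ] X) z) h
    simp only [h1, h3] at this
    rw [map_add, ← this]; abel
  · intro h
    rw [← h2 w, h3]
    congr 1
    nth_rewrite 1 [h]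
    rw [map_add]; abel

theorem resolvent_adjoint {Y Y' Q R R' : X →L[ℝ] X}
    (hadj : ∀ f g, ⟪Y f, g⟫_ℝ = ⟪f, Y' g⟫_ℝ) (hQ : ∀ f g, ⟪Q f, g⟫_ℝ = ⟪f, Q g⟫_ℝ)
    (hR : ∀ g, R g = Y (Q (R g) + g)) (hR' : ∀ g, R' g = Y' (Q (R' g) + g)) (f g : X) :
    ⟪R f, g⟫_ℝ = ⟪f, R' g⟫_ℝ := by
  have h1 : Y' g = R' g - Y' (Q (R' g)) := by
    nth_rewrite 1 [hR' g]; rw [map_add]; abel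
  rw [hR f, hadj, h1, inner_sub_right, inner_add_left, ← hadj, ← hR, hQ]
  ring

/-- For symmetric `A ≥ 0`, `‖A g‖² ≤ ‖A‖ ⟨g, A g⟩`. -/
theorem norm_sq_le_of_nonneg {A : X →L[ℝ] X} (hA : ∀ f g, ⟪A f, g⟫_ℝ = ⟪f, A g⟫_ℝ)
    (hA0 : ∀ f, 0 ≤ ⟪f, A f⟫_ℝ) (g : X) : ‖A g‖ ^ 2 ≤ ‖A‖ * ⟪g, A g⟫_ℝ := by
  have key : ∀ t : ℝ, 0 ≤ ⟪g, A g⟫_ℝ + 2 * t * ‖A g‖ ^ 2 + t ^ 2 * (‖A‖ * ‖A g‖ ^ 2) := by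
    intro t
    have h := hA0 (g + t • A g)
    have h1 : ⟪A g, A (A g)⟫_ℝ ≤ ‖A‖ * ‖A g‖ ^ 2 := by
      calc _ ≤ ‖A g‖ * ‖A (A g)‖ := real_inner_le_norm _ _
        _ ≤ ‖A g‖ * (‖A‖ * ‖A g‖) := by gcongr; exact A.le_opNorm _
        _ = _ := by ring
    have h2 : ⟪g, A (A g)⟫_ℝ = ‖A g‖ ^ 2 := by rw [← hA, real_inner_self_eq_norm_sq]
    rw [map_add, map_smul, inner_add_left, inner_add_right, inner_add_right, inner_smul_left,
      inner_smul_left, inner_smul_right, inner_smul_right, h2, real_inner_self_eq_norm_sq] at h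
    simp only [conj_trivial] at h
    nlinarith [mul_le_mul_of_nonneg_left h1 (sq_nonneg t)]
  rcases (norm_nonneg A).eq_or_lt with h0 | h0
  · have : A g = 0 := by
      have : A = 0 := norm_eq_zero.1 h0.symm
      simp [this]
    rw [this]; simp
  -- This `t` minimizes the quadratic polynomial in `key`.
  · have := key (-1 / ‖A‖)
    have h1 : (-1 / ‖A‖) ^ 2 * (‖A‖ * ‖A g‖ ^ 2) = ‖A g‖ ^ 2 / ‖A‖ := by field_simp
    rw [h1] at this
    have h2 : 2 * (-1 / ‖A‖) * ‖A g‖ ^ 2 = - 2 * (‖A g‖ ^ 2 / ‖A‖) := by ring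
    rw [h2] at this
    have h3 : ‖A g‖ ^ 2 / ‖A‖ ≤ ⟪g, A g⟫_ℝ := by linarith
    rw [div_le_iff₀ h0] at h3
    linarith

/-- Symmetric nonnegative operators have approximate eigenvectors at their norm. -/
theorem exists_approx_eigenvector {A : X →L[ℝ] X} (hA : ∀ f g, ⟪A f, g⟫_ℝ = ⟪f, A g⟫_ℝ)
    (hA0 : ∀ f, 0 ≤ ⟪f, A f⟫_ℝ) (hpos : 0 < ‖A‖) :
    ∃ x : ℕ → X, (∀ k, ‖x k‖ ≤ 1) ∧ Tendsto (fun k => ‖A (x k)‖) atTop (𝓝 ‖A‖) ∧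
      Tendsto (fun k => A (x k) - ‖A‖ • x k) atTop (𝓝 0) := by
  set s := ‖A‖ with hs
  have hex : ∀ k : ℕ, ∃ x : X, ‖x‖ ≤ 1 ∧ s - 1 / ((k : ℝ) + 1) < ‖A x‖ := by
    intro k
    by_contra! hcon
    have : ‖A‖ ≤ max 0 (s - 1 / ((k : ℝ) + 1)) := by
      refine ContinuousLinearMap.opNorm_le_of_unit_norm (le_max_left _ _) fun x hx => ?_
      exact (hcon x hx.le).trans (le_max_right _ _)
    rcases le_max_iff.1 this with h | h
    · linarith
    · have : 0 < 1 / ((k : ℝ) + 1) := by positivity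
      linarith
  choose x hx1 hx2 using hex
  have hle : ∀ k, ‖A (x k)‖ ≤ s := fun k =>
    (A.le_opNorm _).trans (mul_le_of_le_one_right (norm_nonneg _) (hx1 k))
  have hlim : Tendsto (fun k => ‖A (x k)‖) atTop (𝓝 s) := by
    refine tendsto_of_tendsto_of_tendsto_of_le_of_le ?_ tendsto_const_nhds
      (fun k => (hx2 k).le) hle
    simpa using tendsto_const_nhds.sub (tendsto_one_div_add_atTop_nhds_zero_nat (𝕜 := ℝ))
  refine ⟨x, hx1, hlim, ?_⟩
  have hbd : ∀ k, ‖A (x k) - s • x k‖ ^ 2 ≤ 2 * (s ^ 2 - ‖A (x k)‖ ^ 2) := by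
    intro k
    have h1 : ‖A (x k)‖ ^ 2 ≤ s * ⟪x k, A (x k)⟫_ℝ := norm_sq_le_of_nonneg hA hA0 (x k)
    have h2 : ‖x k‖ ^ 2 ≤ 1 := by
      have := hx1 k
      have := norm_nonneg (x k)
      nlinarith
    have h3 : 0 ≤ s ^ 2 := sq_nonneg s
    rw [norm_sub_sq_real, norm_smul, inner_smul_right, real_inner_comm, Real.norm_of_nonneg hpos.le]
    have h4 : (s * ‖x k‖) ^ 2 ≤ s ^ 2 := by rw [mul_pow]; nlinarith
    have h5 : ‖A (x k)‖ ^ 2 ≤ s ^ 2 := by have := hle k; gcongr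
    nlinarith
  rw [tendsto_zero_iff_norm_tendsto_zero]
  have hsq : Tendsto (fun k => ‖A (x k) - s • x k‖ ^ 2) atTop (𝓝 0) := by
    refine squeeze_zero (fun k => sq_nonneg _) hbd ?_
    have := (tendsto_const_nhds (x := s ^ 2)).sub (hlim.pow 2)
    simpa using this.const_mul 2
  have := hsq.sqrt
  simpa [Real.sqrt_sq] using this

end RealHilbert

end FKdV

namespace FKdV

/-! ### The gap of `L = Y⁻¹ - Φ` above its nonpositive eigenvalues. -/

section SpectralGap

open Filter Topology
open scoped InnerProductSpace

variable {X : Type*} [NormedAddCommGroup X] [InnerProductSpace ℝ X]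

theorem resolvent_nonneg {Y Q R : X →L[ℝ] X} {δ : ℝ}
    (hY : ∀ h, δ * ‖Y h‖ ^ 2 ≤ ⟪h - Q (Y h), Y h⟫_ℝ)
    (hR : ∀ g, R g = Y (Q (R g) + g)) (g : X) : δ * ‖R g‖ ^ 2 ≤ ⟪g, R g⟫_ℝ := by
  have := hY (Q (R g) + g)
  rw [← hR] at this
  simpa using this

variable {ι : Type*} [Fintype ι]

/-- A coercivity estimate for `L = Y⁻¹ - Φ` off the span of finitely many eigenvectors, if these
exhaust the spectrum of `L` in `(-∞, 0]`. -/
theorem exists_gap [CompleteSpace X] {Y Φ : X →L[ℝ] X}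
    (hYs : ∀ f g, ⟪Y f, g⟫_ℝ = ⟪f, Y g⟫_ℝ) (hY0 : ∀ f, 0 ≤ ⟪f, Y f⟫_ℝ)
    (hΦ : ∀ f g, ⟪Φ f, g⟫_ℝ = ⟪f, Φ g⟫_ℝ) (hcpt : IsCompactOperator (Y * Φ))
    {e : ι → X} (he : Orthonormal ℝ e) {ν : ι → ℝ}
    (heig : ∀ i, e i = Y (Φ (e i) - ν i • e i))
    (hcompl : ∀ m ≤ (0 : ℝ), ∀ v, v = Y (Φ v + m • v) → (∀ i, ⟪e i, v⟫_ℝ = 0) → v = 0) :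
    ∃ δ > 0, ∀ h, (∀ i, ⟪e i, Y h⟫_ℝ = 0) → δ * ‖Y h‖ ^ 2 ≤ ⟪h - Φ (Y h), Y h⟫_ℝ := by
  classical
  -- With this shift `L + M ≥ 1`; the operator `S` below is `(L + M)⁻¹`.
  set M : ℝ := ‖Φ‖ + 1 with hM
  have hMpos : 0 < M := by positivity
  set Q : X →L[ℝ] X := Φ - M • 1 with hQdef
  have hQa : ∀ w, Q w = Φ w - M • w := fun w => by simp [hQdef]
  have hQ : ∀ f g, ⟪Q f, g⟫_ℝ = ⟪f, Q g⟫_ℝ := fun f g => by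
    rw [hQa, hQa, inner_sub_left, inner_sub_right, hΦ, inner_smul_left, inner_smul_right]; simp
  have hYQ : ∀ h, 1 * ‖Y h‖ ^ 2 ≤ ⟪h - Q (Y h), Y h⟫_ℝ := by
    intro h
    have h1 : ⟪Φ (Y h), Y h⟫_ℝ ≤ ‖Φ‖ * ‖Y h‖ ^ 2 := by
      calc _ ≤ ‖Φ (Y h)‖ * ‖Y h‖ := real_inner_le_norm _ _
        _ ≤ (‖Φ‖ * ‖Y h‖) * ‖Y h‖ := by gcongr; exact Φ.le_opNorm _
        _ = _ := by ring
    rw [hQa, inner_sub_left, inner_sub_left, inner_smul_left, real_inner_self_eq_norm_sq]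
    have := hY0 h
    simp only [conj_trivial]
    rw [hM]; linarith
  obtain ⟨S, hSiff⟩ := exists_resolvent one_pos hYs hQ hYQ hYQ
  have hS : ∀ g, S g = Y (Q (S g) + g) := fun g => (hSiff _ _).1 rfl
  have hSs : ∀ f g, ⟪S f, g⟫_ℝ = ⟪f, S g⟫_ℝ := resolvent_adjoint hYs hQ hS hS
  have hS0 : ∀ g, 0 ≤ ⟪g, S g⟫_ℝ := fun g =>
    le_trans (by positivity) (resolvent_nonneg hYQ hS g)
  have hSe' : ∀ i, e i = (M - ν i) • S (e i) := by
    intro i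
    rw [← map_smul, hSiff, hQa]
    nth_rewrite 1 [heig i]
    congr 1; module
  have hne : ∀ i, M - ν i ≠ 0 := fun i h0 => by
    have := hSe' i
    rw [h0, zero_smul] at this
    exact he.ne_zero i this
  have hSe : ∀ i, S (e i) = (M - ν i)⁻¹ • e i := fun i => by
    nth_rewrite 2 [hSe' i]
    rw [smul_smul, inv_mul_cancel₀ (hne i), one_smul]
  -- the projection onto the complement of the eigenvectors
  set P : X →L[ℝ] X := 1 - ∑ i, (innerSL ℝ (e i)).smulRight (e i) with hP
  have hPa : ∀ x, P x = x - ∑ i, ⟪e i, x⟫_ℝ • e i := fun x => by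
    simp [hP]
  have heP : ∀ i x, ⟪e i, P x⟫_ℝ = 0 := fun i x => by
    rw [hPa, inner_sub_right, he.inner_right_fintype, sub_self]
  have hPfix : ∀ x, (∀ i, ⟪e i, x⟫_ℝ = 0) → P x = x := fun x hx => by
    rw [hPa]; simp [hx]
  have hPs : ∀ x y, ⟪P x, y⟫_ℝ = ⟪x, P y⟫_ℝ := fun x y => by
    rw [hPa, hPa, inner_sub_left, inner_sub_right, sum_inner, inner_sum]
    congr 1
    refine Finset.sum_congr rfl fun i _ => ?_
    rw [inner_smul_left, inner_smul_right, real_inner_comm x (e i)]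
    simp [mul_comm]
  have heS : ∀ x, (∀ i, ⟪e i, x⟫_ℝ = 0) → ∀ i, ⟪e i, S x⟫_ℝ = 0 := fun x hx i => by
    rw [← hSs, hSe, inner_smul_left, hx, mul_zero]
  -- `A` is the part of `(L + M)⁻¹` on the complement of the eigenvectors. Its norm is the top of
  -- its spectrum, so `L ≥ 1 / ‖A‖ - M` there, and the claim is `‖A‖ * M < 1`.
  set A : X →L[ℝ] X := P * S * P with hA
  have hAa : ∀ x, A x = S (P x) := fun x => by
    have : A x = P (S (P x)) := rfl
    rw [this, hPfix _ (heS _ fun i => heP i x)]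
  have hAs : ∀ f g, ⟪A f, g⟫_ℝ = ⟪f, A g⟫_ℝ := fun f g => by
    change ⟪P (S (P f)), g⟫_ℝ = ⟪f, P (S (P g))⟫_ℝ
    rw [hPs, hSs, hPs]
  have hA0 : ∀ f, 0 ≤ ⟪f, A f⟫_ℝ := fun f => by
    change 0 ≤ ⟪f, P (S (P f))⟫_ℝ
    rw [← hPs]; exact hS0 _
  rcases lt_or_ge (‖A‖ * M) 1 with hs | hs
  · set s := ‖A‖
    have hs0 : 0 ≤ s := norm_nonneg _
    -- The denominator `s + 1` in place of `s` shrinks the gap `1 / s - M` slightly and covers the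
    -- case `s = 0`.
    refine ⟨(1 - s * M) / (s + 1), by apply div_pos <;> linarith, fun h hh => ?_⟩
    set δ := (1 - s * M) / (s + 1) with hδ
    set w := Y h with hw
    set g := h - Q w with hg
    have hwS : w = S g := by
      rw [hSiff, hg]
      simp [hw]
    have hgperp : ∀ i, ⟪e i, g⟫_ℝ = 0 := by
      intro i
      have : ⟪e i, S g⟫_ℝ = 0 := by rw [← hwS]; exact hh i
      rw [← hSs, hSe, inner_smul_left] at this
      simpa [hne i] using this
    have hwA : A g = w := by rw [hAa, hPfix _ hgperp, hwS]
    have h1 := norm_sq_le_of_nonneg hAs hA0 g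
    rw [hwA] at h1
    have h2 : h - Φ w = g - M • w := by rw [hg, hQa]; abel
    rw [h2, inner_sub_left, inner_smul_left, real_inner_self_eq_norm_sq]
    simp only [conj_trivial]
    have h3 : (M + δ) * s ≤ 1 := by
      have : δ * s ≤ 1 - s * M := by
        rw [hδ, div_mul_eq_mul_div, div_le_iff₀ (by linarith)]
        nlinarith
      nlinarith
    have h4 : 0 ≤ ⟪g, w⟫_ℝ := by rw [← hwA]; exact hA0 g
    have h5 : 0 ≤ M + δ := by
      have : 0 ≤ δ := div_nonneg (by linarith) (by linarith)
      linarith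
    nlinarith [mul_le_mul_of_nonneg_left h1 h5, mul_le_mul_of_nonneg_right h3 h4]
  · exfalso
    set s := ‖A‖ with hsdef
    have hspos : 0 < s := by
      by_contra h0
      have : s = 0 := le_antisymm (not_lt.1 h0) (norm_nonneg _)
      rw [this] at hs; linarith
    obtain ⟨x, hx1, hxlim, hxap⟩ := exists_approx_eigenvector hAs hA0 hspos
    -- If `‖A‖ * M ≥ 1`, approximate eigenvectors of `A` at `s` are approximate eigenvectors of `L`
    -- at this `m ≤ 0`. Compactness turns them into a true eigenvector, which `hcompl` excludes.
    set m : ℝ := 1 / s - M with hm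
    have hm0 : m ≤ 0 := by
      rw [hm, sub_nonpos, div_le_iff₀ hspos]; linarith
    set v : ℕ → X := fun k => A (x k) with hv
    have hvnorm : ∀ k, ‖v k‖ ≤ s := fun k =>
      (A.le_opNorm _).trans (mul_le_of_le_one_right (norm_nonneg _) (hx1 k))
    set d : ℕ → X := fun k => P (x k - (1 / s) • v k) with hd
    have hd0 : Tendsto d atTop (𝓝 0) := by
      have h1 : Tendsto (fun k => (-(1 / s)) • (A (x k) - s • x k)) atTop (𝓝 0) := by
        simpa using hxap.const_smul (-(1 / s))
      have h2 := (P.continuous.tendsto 0).comp h1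
      rw [map_zero] at h2
      refine h2.congr fun k => ?_
      simp only [Function.comp, hd, hv]
      congr 1
      rw [smul_sub, smul_smul]
      have : -(1 / s) * s = -1 := by field_simp
      rw [this]; module
    have hvperp : ∀ k i, ⟪e i, v k⟫_ℝ = 0 := fun k i => by
      simp only [hv, hAa]
      exact heS _ (fun i => heP i _) i
    have hveq : ∀ k, v k - m • Y (v k) = Y (Φ (v k)) + Y (d k) := by
      intro k
      have h1 : v k = S (P (x k)) := hAa _
      have h2 : P (x k) = d k + (1 / s) • v k := by
        simp only [hd]
        rw [map_sub, map_smul, hPfix _ (hvperp k)]; abel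
      have h3 := hS (P (x k))
      rw [← h1, h2, hQa] at h3
      have h4 : Φ (v k) - M • v k + (d k + (1 / s) • v k) = Φ (v k) + d k + m • v k := by
        rw [hm]; module
      rw [h4, map_add, map_add, map_smul] at h3
      nth_rewrite 1 [h3]; abel
    -- As `m ≤ 0 ≤ Y`, the operator `1 - m Y` does not shrink norms; convergence of `(1 - m Y) v`
    -- along a subsequence therefore makes `v` itself Cauchy.
    have hexp : ∀ y, ‖y‖ ≤ ‖y - m • Y y‖ := by
      intro y
      have h1 : ‖y‖ ^ 2 ≤ ⟪y, y - m • Y y⟫_ℝ := by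
        rw [inner_sub_right, inner_smul_right, real_inner_self_eq_norm_sq]
        have := mul_nonneg_of_nonpos_of_nonpos hm0 (neg_nonpos.2 (hY0 y))
        linarith
      have h2 := real_inner_le_norm y (y - m • Y y)
      rcases (norm_nonneg y).eq_or_lt with h0 | h0
      · rw [← h0]; positivity
      · refine le_of_mul_le_mul_left ?_ h0
        nlinarith
    obtain ⟨z, -, θ, hθ, hz⟩ := (hcpt.isCompact_closure_image_closedBall s).tendsto_subseq
      (x := fun k => Y (Φ (v k))) (fun k => subset_closure ⟨v k, by simpa using hvnorm k, rfl⟩)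
    have hr : Tendsto (fun k => v (θ k) - m • Y (v (θ k))) atTop (𝓝 z) := by
      have h1 := (Y.continuous.tendsto 0).comp (hd0.comp hθ.tendsto_atTop)
      rw [map_zero] at h1
      have := hz.add h1
      rw [add_zero] at this
      exact this.congr fun k => (hveq (θ k)).symm
    have hcau : CauchySeq (fun k => v (θ k)) := by
      have h1 := hr.cauchySeq
      rw [Metric.cauchySeq_iff] at h1 ⊢
      intro ε hε
      obtain ⟨N, hN⟩ := h1 ε hε
      refine ⟨N, fun i hi j hj => lt_of_le_of_lt ?_ (hN i hi j hj)⟩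
      rw [dist_eq_norm, dist_eq_norm]
      refine (hexp _).trans (le_of_eq ?_)
      congr 1
      rw [map_sub, smul_sub]; abel
    obtain ⟨y, hy⟩ := cauchySeq_tendsto_of_complete hcau
    have hy1 : ‖y‖ = s :=
      tendsto_nhds_unique hy.norm (hxlim.comp hθ.tendsto_atTop)
    have hy2 : y - m • Y y = Y (Φ y) := by
      have h1 : Tendsto (fun k => v (θ k) - m • Y (v (θ k))) atTop (𝓝 (y - m • Y y)) :=
        hy.sub (((Y.continuous.tendsto y).comp hy).const_smul m)
      have h2 : Tendsto (fun k => Y (Φ (v (θ k)))) atTop (𝓝 (Y (Φ y))) :=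
        ((Y.continuous.comp Φ.continuous).tendsto y).comp hy
      rw [tendsto_nhds_unique h1 hr, tendsto_nhds_unique h2 hz]
    have hy3 : ∀ i, ⟪e i, y⟫_ℝ = 0 := fun i => by
      have h1 : Tendsto (fun k => ⟪e i, v (θ k)⟫_ℝ) atTop (𝓝 ⟪e i, y⟫_ℝ) :=
        tendsto_const_nhds.inner hy
      simp only [hvperp] at h1
      exact (tendsto_nhds_unique h1 tendsto_const_nhds)
    have := hcompl m hm0 y (by rw [map_add, map_smul, ← hy2]; abel) hy3
    rw [this, norm_zero] at hy1
    linarith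

end SpectralGap

end FKdV

namespace FKdV

/-! ### The finite rank correction and the bordered determinant. -/

section Determinant

open Filter Topology
open scoped InnerProductSpace

variable {X : Type*} [NormedAddCommGroup X] [InnerProductSpace ℝ X]

/-- The properties of the inverses `Y l` of the operators `D^α + c - l ∂ₓ⁻¹` that are used. -/
structure IsResolventFamily (Y : ℝ → X →L[ℝ] X) : Prop where
  adj : ∀ l f g, ⟪Y l f, g⟫_ℝ = ⟪f, Y (-l) g⟫_ℝ
  factor : ∀ l h, ∃ h', Y l h = Y 0 h' ∧ ⟪h, Y l h⟫_ℝ = ⟪h', Y 0 h'⟫_ℝ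
  nonneg : ∀ h, 0 ≤ ⟪h, Y 0 h⟫_ℝ
  cont : ∀ g, Continuous fun l => Y l g
  lim : ∀ g, Tendsto (fun l => Y l g) atTop (𝓝 0)

variable {ι : Type*} [Fintype ι]

/-- The finite rank operator `∑ (1 + νᵢ) ⟨eᵢ, ·⟩ eᵢ`. -/
noncomputable def spectralShift (e : ι → X) (ν : ι → ℝ) : X →L[ℝ] X :=
  ∑ i, (1 + ν i) • (innerSL ℝ (e i)).smulRight (e i)

theorem spectralShift_apply (e : ι → X) (ν : ι → ℝ) (x : X) :
    spectralShift e ν x = ∑ i, ((1 + ν i) * ⟪e i, x⟫_ℝ) • e i := by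
  simp [spectralShift, smul_smul]

theorem spectralShift_symm (e : ι → X) (ν : ι → ℝ) (x y : X) :
    ⟪spectralShift e ν x, y⟫_ℝ = ⟪x, spectralShift e ν y⟫_ℝ := by
  rw [spectralShift_apply, spectralShift_apply, sum_inner, inner_sum]
  refine Finset.sum_congr rfl fun i _ => ?_
  rw [inner_smul_left, inner_smul_right, real_inner_comm x (e i)]
  simp only [conj_trivial]; ring

theorem spectralShift_basis {e : ι → X} (he : Orthonormal ℝ e) (ν : ι → ℝ) (i : ι) :
    spectralShift e ν (e i) = (1 + ν i) • e i := by
  classical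
  rw [spectralShift_apply, Finset.sum_eq_single i]
  · rw [real_inner_self_eq_norm_sq, he.1 i]; simp
  · intro j _ hj
    rw [he.2 hj]; simp
  · simp

/-- The form of `L + F` splits orthogonally along `w = w₁ + p`, with `p` in the span of the `e i`:
on the complement it is the form of `L`, bounded below by `δ`, and on the span `L + F` is the
identity, because `-ν i + (1 + ν i) = 1`. -/
theorem spectralShift_coercive {Y Φ : X →L[ℝ] X}
    (hYs : ∀ f g, ⟪Y f, g⟫_ℝ = ⟪f, Y g⟫_ℝ) (hΦ : ∀ f g, ⟪Φ f, g⟫_ℝ = ⟪f, Φ g⟫_ℝ)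
    {e : ι → X} (he : Orthonormal ℝ e) {ν : ι → ℝ}
    (heig : ∀ i, e i = Y (Φ (e i) - ν i • e i)) {δ : ℝ}
    (hgap : ∀ h, (∀ i, ⟪e i, Y h⟫_ℝ = 0) → δ * ‖Y h‖ ^ 2 ≤ ⟪h - Φ (Y h), Y h⟫_ℝ) (h : X) :
    min δ 1 * ‖Y h‖ ^ 2 ≤ ⟪h - (Φ - spectralShift e ν) (Y h), Y h⟫_ℝ := by
  classical
  set w := Y h with hw
  set a : ι → ℝ := fun i => ⟪e i, w⟫_ℝ with ha
  set p := ∑ i, a i • e i with hp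
  -- A preimage of `w - p` under `Y`, found from `e i = Y (Φ (e i) - ν i • e i)`.
  set h₁ := h - ∑ i, a i • (Φ (e i) - ν i • e i) with hh₁
  have hYh₁ : Y h₁ = w - p := by
    rw [hh₁, map_sub, map_sum, hp]
    congr 1
    refine Finset.sum_congr rfl fun i _ => ?_
    rw [map_smul, ← heig]
  have hperp : ∀ i, ⟪e i, Y h₁⟫_ℝ = 0 := fun i => by
    rw [hYh₁, inner_sub_right, hp, he.inner_right_fintype, sub_self]
  have hg := hgap h₁ hperp
  set w₁ := Y h₁ with hw₁
  set l := h₁ - Φ w₁ with hl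
  have hpw : ⟪p, w₁⟫_ℝ = 0 := by
    rw [hp, sum_inner]
    exact Finset.sum_eq_zero fun i _ => by rw [inner_smul_left, hperp, mul_zero]
  have hle : ∀ i, ⟪l, e i⟫_ℝ = 0 := fun i => by
    have h1 : ⟪h₁, e i⟫_ℝ = ⟪w₁, Φ (e i) - ν i • e i⟫_ℝ := by
      rw [heig i, ← hYs, ← heig i]
    rw [hl, inner_sub_left, hΦ, h1, inner_sub_right, inner_smul_right, real_inner_comm (e i) w₁, hperp]
    simp
  have hlp : ⟪l, p⟫_ℝ = 0 := by
    rw [hp, inner_sum]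
    exact Finset.sum_eq_zero fun i _ => by rw [inner_smul_right, hle, mul_zero]
  have hwd : w = w₁ + p := by rw [hYh₁]; abel
  have hsum : h - (Φ - spectralShift e ν) w = l + p := by
    have h1 : Φ w = Φ w₁ + ∑ i, a i • Φ (e i) := by
      rw [hwd, map_add, hp, map_sum]
      simp only [map_smul]
    have h2 : h = h₁ + ∑ i, a i • (Φ (e i) - ν i • e i) := by rw [hh₁]; abel
    rw [sub_apply, spectralShift_apply, h1, h2, hl, hp]
    have h3 : ∑ i, ((1 + ν i) * ⟪e i, w⟫_ℝ) • e i
        = ∑ i, a i • e i + ∑ i, a i • ν i • e i := by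
      rw [← Finset.sum_add_distrib]
      refine Finset.sum_congr rfl fun i _ => ?_
      simp only [ha]; module
    rw [h3]
    simp only [smul_sub, Finset.sum_sub_distrib]
    abel
  have hn : ‖w‖ ^ 2 = ‖w₁‖ ^ 2 + ‖p‖ ^ 2 := by
    rw [hwd, norm_add_sq_real, real_inner_comm, hpw]; ring
  rw [hsum, hn]
  conv_rhs => rw [hwd]
  rw [inner_add_left, inner_add_right, inner_add_right, hlp, hpw, real_inner_self_eq_norm_sq]
  have h1 : min δ 1 * ‖w₁‖ ^ 2 ≤ δ * ‖w₁‖ ^ 2 := by gcongr; exact min_le_left _ _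
  have h2 : min δ 1 * ‖p‖ ^ 2 ≤ 1 * ‖p‖ ^ 2 := by gcongr; exact min_le_right _ _
  linarith

/-- The bordered determinant of the leading coefficients. -/
theorem det_bordered {n : ℕ} (d : Fin n → ℝ) (hd : ∀ i, d i ≠ 0) (a : ℝ) (r s : Fin n → ℝ) :
    (Matrix.of fun i j : Unit ⊕ Fin n => Sum.elim
      (fun _ => Sum.elim (fun _ => a) (fun j => r j) j)
      (fun i => Sum.elim (fun _ => s i) (fun j => if i = j then d i else 0) j) i).det
      = (∏ i, d i) * (a - ∑ i, r i * s i / d i) := by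
  classical
  have h1 : (Matrix.of fun i j : Unit ⊕ Fin n => Sum.elim
      (fun _ => Sum.elim (fun _ => a) (fun j => r j) j)
      (fun i => Sum.elim (fun _ => s i) (fun j => if i = j then d i else 0) j) i)
      = Matrix.fromBlocks (Matrix.of fun _ _ => a) (Matrix.of fun _ j => r j)
        (Matrix.of fun i _ => s i) (Matrix.diagonal d) := by
    ext i j
    rcases i with i | i <;> rcases j with j | j <;> simp [Matrix.diagonal_apply]
  have hinv : Invertible (Matrix.diagonal d) := by
    refine Matrix.invertibleOfIsUnitDet _ ?_
    rw [Matrix.det_diagonal]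
    exact (Finset.prod_ne_zero_iff.2 fun i _ => hd i).isUnit
  have hinv2 : ⅟(Matrix.diagonal d) = Matrix.diagonal fun i => (d i)⁻¹ := by
    refine invOf_eq_right_inv ?_
    rw [Matrix.diagonal_mul_diagonal]
    simp [hd]
  -- Schur complement of the diagonal block.
  rw [h1, Matrix.det_fromBlocks₂₂, Matrix.det_diagonal, hinv2]
  congr 1
  rw [Matrix.det_unique]
  simp only [Matrix.sub_apply, Matrix.of_apply, Matrix.mul_apply, Matrix.diagonal_apply]
  congr 1
  refine Finset.sum_congr rfl fun i _ => ?_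
  simp [div_eq_mul_inv]
  ring

end Determinant

end FKdV

namespace FKdV

/-! ### A kernel of `L - l ∂ₓ⁻¹` from the sign change of a determinant. -/

section FixedPoint

open Filter Topology
open scoped InnerProductSpace

variable {X : Type*} [NormedAddCommGroup X] [InnerProductSpace ℝ X]

/-- Strong continuity passes from `Y` to `R` because the a priori constant `C` does not depend on
`l`: the difference `w = R l g - R l₀ g` satisfies `w - Y l (Q w) = (Y l - Y l₀) (Q (R l₀ g) + g)`.
-/
theorem resolvent_continuous {Y R : ℝ → X →L[ℝ] X} {Q : X →L[ℝ] X} {C : ℝ}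
    (hY : ∀ g, Continuous fun l => Y l g)
    (hC : ∀ l w, ‖w‖ ≤ C * ‖w - Y l (Q w)‖) (hR : ∀ l g, R l g = Y l (Q (R l g) + g)) (g : X) :
    Continuous fun l => R l g := by
  rw [continuous_iff_continuousAt]
  intro l₀
  have hlim : Tendsto (fun l => C * ‖Y l (Q (R l₀ g) + g) - Y l₀ (Q (R l₀ g) + g)‖) (𝓝 l₀)
      (𝓝 0) := by
    have := ((hY (Q (R l₀ g) + g)).tendsto l₀).sub_const (Y l₀ (Q (R l₀ g) + g))
    rw [sub_self] at this
    simpa using this.norm.const_mul C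
  refine tendsto_iff_norm_sub_tendsto_zero.2 (squeeze_zero (fun _ => norm_nonneg _) ?_ hlim)
  intro l
  refine (hC l _).trans (le_of_eq ?_)
  congr 2
  nth_rewrite 1 [hR l g]
  rw [← hR l₀ g]
  simp only [map_add, map_sub]
  abel

theorem resolvent_tendsto_zero {Y R : ℝ → X →L[ℝ] X} {Q : X →L[ℝ] X} {C : ℝ}
    (hY : ∀ g, Tendsto (fun l => Y l g) atTop (𝓝 0))
    (hC : ∀ l w, ‖w‖ ≤ C * ‖w - Y l (Q w)‖) (hR : ∀ l g, R l g = Y l (Q (R l g) + g)) (g : X) :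
    Tendsto (fun l => R l g) atTop (𝓝 0) := by
  have hlim : Tendsto (fun l => C * ‖Y l g‖) atTop (𝓝 0) := by
    simpa using (hY g).norm.const_mul C
  refine squeeze_zero_norm (fun l => (hC l _).trans (le_of_eq ?_)) hlim
  congr 2
  nth_rewrite 1 [hR l g]
  rw [map_add]; abel

/-- If the index and the sign of `⟨χ, b⟩ = -⟨L χ, χ⟩` have the right parity, then
`L - l ∂ₓ⁻¹` has a kernel for some `l > 0`. -/
theorem exists_kernel_of_parity [CompleteSpace X] {Y : ℝ → X →L[ℝ] X} (hY : IsResolventFamily Y)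
    {Φ : X →L[ℝ] X} (hΦ : ∀ f g, ⟪Φ f, g⟫_ℝ = ⟪f, Φ g⟫_ℝ) {n : ℕ}
    {e : Unit ⊕ Fin n → X} (he : Orthonormal ℝ e) {ν : Unit ⊕ Fin n → ℝ}
    (hν0 : ν (Sum.inl ()) = 0) (hν : ∀ i, 0 < ν (Sum.inr i))
    (heig : ∀ i, e i = Y 0 (Φ (e i) - ν i • e i))
    {b : X} (hb : ∀ l, e (Sum.inl ()) = Y l (Φ (e (Sum.inl ())) - l • b))
    {χ : X} (hχ : χ = Y 0 (Φ χ - b)) {δ : ℝ} (hδ : 0 < δ)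
    (hgap : ∀ h, (∀ i, ⟪e i, Y 0 h⟫_ℝ = 0) → δ * ‖Y 0 h‖ ^ 2 ≤ ⟪h - Φ (Y 0 h), Y 0 h⟫_ℝ)
    (hsign : 0 < (-1) ^ n * ⟪χ, b⟫_ℝ) :
    ∃ l > 0, ∃ f, f ≠ 0 ∧ f = Y l (Φ f) := by
  classical
  set e0 := e (Sum.inl ()) with he0
  set F := spectralShift e ν with hF
  set Q := Φ - F with hQdef
  have hYs : ∀ f g, ⟪Y 0 f, g⟫_ℝ = ⟪f, Y 0 g⟫_ℝ := fun f g => by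
    have := hY.adj 0 f g
    rwa [neg_zero] at this
  have hQ : ∀ f g, ⟪Q f, g⟫_ℝ = ⟪f, Q g⟫_ℝ := fun f g => by
    simp only [hQdef, sub_apply, inner_sub_left, inner_sub_right, hΦ]
    rw [hF, spectralShift_symm]
  have hδ' : 0 < min δ 1 := lt_min hδ one_pos
  -- `factor` reduces coercivity for every `l` to the symmetric case `l = 0`, with the same
  -- constant.
  have hcoer : ∀ l h, min δ 1 * ‖Y l h‖ ^ 2 ≤ ⟪h - Q (Y l h), Y l h⟫_ℝ := by
    intro l h
    obtain ⟨h', h1, h2⟩ := hY.factor l h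
    rw [inner_sub_left, h2, h1, ← inner_sub_left]
    exact spectralShift_coercive hYs hΦ he heig hgap h'
  have hex := fun l => exists_resolvent hδ' (hY.adj l) hQ (hcoer l) (hcoer (-l))
  choose R hRiff using hex
  have hR : ∀ l g, R l g = Y l (Q (R l g) + g) := fun l g => (hRiff l _ _).1 rfl
  have hRadj : ∀ l f g, ⟪R l f, g⟫_ℝ = ⟪f, R (-l) g⟫_ℝ := fun l =>
    resolvent_adjoint (hY.adj l) hQ (hR l) (hR (-l))
  have hC : ∀ l w, ‖w‖ ≤ (1 + ‖Q‖ / min δ 1) * ‖w - Y l (Q w)‖ := fun l =>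
    norm_le_of_coercive hδ' (hcoer l)
  have hRcont := resolvent_continuous hY.cont hC hR
  have hRlim := resolvent_tendsto_zero hY.lim hC hR
  have hFe : ∀ i, F (e i) = (1 + ν i) • e i := spectralShift_basis he ν
  -- The operator inverted by `R l` sends `e0` to `e0 - l • b`: `F` fixes `e0`, `L` annihilates it,
  -- and `∂ₓ⁻¹` sends it to `b`.
  have hRe0 : ∀ l, R l e0 = e0 + l • R l b := by
    intro l
    have : e0 = R l (e0 - l • b) := by
      rw [hRiff]
      nth_rewrite 1 [hb l]
      congr 1
      simp only [hQdef, sub_apply, hFe, he0, hν0]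
      module
    rw [map_sub, map_smul] at this
    nth_rewrite 2 [this]
    abel
  have hR0e : ∀ i, R 0 (e i) = e i := by
    intro i
    symm
    rw [hRiff]
    nth_rewrite 1 [heig i]
    congr 1
    simp only [hQdef, sub_apply, hFe]
    module
  -- The equation `f = R l (F f)` expressed in the unknowns `⟪e i, f⟫`.
  set M : ℝ → Matrix (Unit ⊕ Fin n) (Unit ⊕ Fin n) ℝ := fun l => Matrix.of fun i j =>
    (if i = j then 1 else 0) - (1 + ν j) * ⟪e i, R l (e j)⟫_ℝ with hM
  have hMcont : Continuous fun l => (M l).det := by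
    refine Continuous.matrix_det (continuous_pi fun i => continuous_pi fun j => ?_)
    exact continuous_const.sub (continuous_const.mul (continuous_const.inner (hRcont _)))
  have hMlim : Tendsto (fun l => (M l).det) atTop (𝓝 1) := by
    have h1 : Tendsto M atTop (𝓝 1) := by
      refine tendsto_pi_nhds.2 fun i => tendsto_pi_nhds.2 fun j => ?_
      have h2 : Tendsto (fun l => ⟪e i, R l (e j)⟫_ℝ) atTop (𝓝 0) := by
        simpa using (tendsto_const_nhds (x := e i)).inner (𝕜 := ℝ) (hRlim (e j))
      have h3 := (tendsto_const_nhds (x := (if i = j then (1 : ℝ) else 0))).sub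
        (h2.const_mul (1 + ν j))
      simpa [hM, Matrix.one_apply] using h3
    have h2 := ((Continuous.matrix_det (n := Unit ⊕ Fin n) (R := ℝ) continuous_id).tendsto 1).comp h1
    simpa [Function.comp_def] using h2
  -- `M l` with one factor `l` removed from the row of `e0` and one from its column; the corner
  -- entry is of order `l ^ 2` because `⟪e0, b⟫ = 0`.
  set M' : ℝ → Matrix (Unit ⊕ Fin n) (Unit ⊕ Fin n) ℝ := fun l => Matrix.of fun i j => Sum.elim
    (fun _ => Sum.elim (fun _ => ⟪R (-l) b, b⟫_ℝ)
      (fun j => (1 + ν (Sum.inr j)) * ⟪R (-l) b, e (Sum.inr j)⟫_ℝ) j)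
    (fun i => Sum.elim (fun _ => -⟪e (Sum.inr i), R l b⟫_ℝ)
      (fun j => (if i = j then 1 else 0) -
        (1 + ν (Sum.inr j)) * ⟪e (Sum.inr i), R l (e (Sum.inr j))⟫_ℝ) j) i with hM'
  have hRncont : ∀ g, Continuous fun l => R (-l) g := fun g => (hRcont g).comp continuous_neg
  have hM'cont : Continuous fun l => (M' l).det := by
    refine Continuous.matrix_det (continuous_pi fun i => continuous_pi fun j => ?_)
    rcases i with i | i <;> rcases j with j | j
    · exact (hRncont b).inner continuous_const
    · exact continuous_const.mul ((hRncont b).inner continuous_const)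
    · exact (continuous_const.inner (hRcont b)).neg
    · exact continuous_const.sub (continuous_const.mul (continuous_const.inner (hRcont _)))
  have hMM' : ∀ l, (M l).det = l ^ 2 * (M' l).det := by
    intro l
    set cc : Unit ⊕ Fin n → ℝ := Sum.elim (fun _ => l) (fun _ => 1) with hcc
    have h1 : M l = Matrix.diagonal cc * M' l * Matrix.diagonal cc := by
      ext i j
      rw [Matrix.mul_diagonal, Matrix.diagonal_mul]
      rcases i with i | i <;> rcases j with j | j
      · have h2 : ⟪e0, R l b⟫_ℝ = - (l * ⟪R (-l) b, b⟫_ℝ) + ⟪e0, b⟫_ℝ := by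
          rw [real_inner_comm, hRadj, hRe0, inner_add_right, inner_smul_right,
            real_inner_comm b (R (-l) b), real_inner_comm b e0]
          ring
        -- `b = -L χ` lies in the range of the symmetric `L`, and `e0` in its kernel.
        have h3 : ⟪e0, b⟫_ℝ = 0 := by
          have h4 : ⟪e0, χ⟫_ℝ = ⟪e0, χ⟫_ℝ - ⟪e0, b⟫_ℝ := by
            have h5 : e0 = Y 0 (Φ e0) := by
              have := hb 0
              rwa [zero_smul, sub_zero] at this
            have h6 : Y 0 b = Y 0 (Φ χ) - χ := by
              nth_rewrite 2 [hχ]; rw [map_sub]; abel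
            have h7 : ⟪e0, b⟫_ℝ = 0 := by
              nth_rewrite 1 [h5]
              rw [hYs, h6, inner_sub_right, ← hYs, ← h5, hΦ, sub_self]
            rw [h7, sub_zero]
          linarith
        have h4 : ⟪e0, e0⟫_ℝ = 1 := by
          rw [real_inner_self_eq_norm_sq, he.1]; norm_num
        simp only [hM, hM', hcc, Matrix.of_apply, Sum.elim_inl, if_true]
        rw [show e (Sum.inl i) = e0 from rfl, show ν (Sum.inl i) = 0 from hν0, hRe0,
          inner_add_right, inner_smul_right, h2, h3, h4]
        ring
      · simp only [hM, hM', hcc, Matrix.of_apply, Sum.elim_inl, Sum.elim_inr, reduceCtorEq, if_false]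
        have h2 : ⟪e (Sum.inl i), R l (e (Sum.inr j))⟫_ℝ = - l * ⟪R (-l) b, e (Sum.inr j)⟫_ℝ := by
          rw [show e (Sum.inl i) = e0 from rfl, real_inner_comm, hRadj, hRe0, inner_add_right,
            inner_smul_right, real_inner_comm _ (R (-l) b)]
          have : ⟪e (Sum.inr j), e0⟫_ℝ = 0 := he.2 (by simp)
          rw [this]; ring
        rw [h2]; ring
      · simp only [hM, hM', hcc, Matrix.of_apply, Sum.elim_inl, Sum.elim_inr, reduceCtorEq, if_false]
        rw [show e (Sum.inl j) = e0 from rfl, show ν (Sum.inl j) = 0 from hν0, hRe0,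
          inner_add_right, inner_smul_right]
        have : ⟪e (Sum.inr i), e0⟫_ℝ = 0 := he.2 (by simp)
        rw [this]; ring
      · simp [hM, hM', hcc]
    rw [h1, Matrix.det_mul, Matrix.det_mul, Matrix.det_diagonal]
    simp [hcc]
    ring
  have hM'0 : (M' 0).det < 0 := by
    have h1 : M' 0 = Matrix.of fun i j : Unit ⊕ Fin n => Sum.elim
        (fun _ => Sum.elim (fun _ => ⟪R 0 b, b⟫_ℝ)
          (fun j => (1 + ν (Sum.inr j)) * ⟪e (Sum.inr j), b⟫_ℝ) j)
        (fun i => Sum.elim (fun _ => -⟪e (Sum.inr i), b⟫_ℝ)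
          (fun j => if i = j then - ν (Sum.inr i) else 0) j) i := by
      have h2 : ∀ i, ⟪e i, R 0 b⟫_ℝ = ⟪e i, b⟫_ℝ := fun i => by
        rw [real_inner_comm, hRadj, neg_zero, hR0e, real_inner_comm]
      ext i j
      rcases i with i | i <;> rcases j with j | j
      · simp [hM']
      · simp only [hM', Matrix.of_apply, Sum.elim_inl, Sum.elim_inr, neg_zero]
        rw [real_inner_comm, h2]
      · simp only [hM', Matrix.of_apply, Sum.elim_inl, Sum.elim_inr, h2]
      · simp only [hM', Matrix.of_apply, Sum.elim_inr, hR0e]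
        by_cases hij : i = j
        · subst hij
          rw [real_inner_self_eq_norm_sq, he.1]; simp
        · rw [he.2 (by simpa using hij)]; simp [hij]
    rw [h1, det_bordered (fun i => -ν (Sum.inr i)) (fun i => by simpa using (hν i).ne')]
    -- The Schur complement is identified through `(L + F) χ = F χ - b`: as `R 0` fixes `F χ`, this
    -- reads `χ = F χ - R 0 b`.
    have h3 : ⟪R 0 b, b⟫_ℝ - ∑ i, (1 + ν (Sum.inr i)) * ⟪e (Sum.inr i), b⟫_ℝ *
        -⟪e (Sum.inr i), b⟫_ℝ / -ν (Sum.inr i) = -⟪χ, b⟫_ℝ := by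
      have h4 : χ = R 0 (F χ - b) := by
        rw [hRiff]
        nth_rewrite 1 [hχ]
        congr 1
        simp only [hQdef, sub_apply]; abel
      have h5 : R 0 (F χ) = F χ := by
        rw [hF, spectralShift_apply, map_sum]
        simp only [map_smul, hR0e]
      -- Formally `⟪e i, b⟫ = -⟪e i, L χ⟫ = -⟪L (e i), χ⟫`; the computation goes through `Y 0` to
      -- avoid the unbounded `L`.
      have h6 : ∀ i, ⟪e i, b⟫_ℝ = ν i * ⟪e i, χ⟫_ℝ := by
        intro i
        have h7 : Y 0 b = Y 0 (Φ χ) - χ := by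
          nth_rewrite 2 [hχ]; rw [map_sub]; abel
        have h8 : ν i • Y 0 (e i) = Y 0 (Φ (e i)) - e i := by
          nth_rewrite 3 [heig i]; rw [map_sub, map_smul]; abel
        have h9 : ⟪e i, b⟫_ℝ + ν i * ⟪e i, Y 0 b⟫_ℝ
            = ν i * ⟪e i, Y 0 (Φ χ)⟫_ℝ := by
          have h10 : ν i * ⟪e i, Y 0 b⟫_ℝ = ⟪Y 0 (Φ (e i)), b⟫_ℝ - ⟪e i, b⟫_ℝ := by
            rw [← hYs, ← inner_sub_left, ← h8, inner_smul_left]; simp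
          have h11 : ν i * ⟪e i, Y 0 (Φ χ)⟫_ℝ = ⟪Y 0 (Φ (e i)), Φ χ⟫_ℝ - ⟪e i, Φ χ⟫_ℝ := by
            rw [← hYs, ← inner_sub_left, ← h8, inner_smul_left]; simp
          have h12 : ⟪Y 0 (Φ (e i)), Φ χ⟫_ℝ - ⟪Y 0 (Φ (e i)), b⟫_ℝ = ⟪e i, Φ χ⟫_ℝ := by
            rw [← inner_sub_right, hYs, ← hχ, hΦ]
          linarith
        rw [h7, inner_sub_right] at h9
        linarith
      have h7 : ⟪χ, b⟫_ℝ = ⟪F χ, b⟫_ℝ - ⟪R 0 b, b⟫_ℝ := by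
        nth_rewrite 1 [h4]
        rw [map_sub, h5, inner_sub_left]
      have h8 : ⟪F χ, b⟫_ℝ = ∑ i, (1 + ν (Sum.inr i)) * ⟪e (Sum.inr i), b⟫_ℝ *
          -⟪e (Sum.inr i), b⟫_ℝ / -ν (Sum.inr i) := by
        rw [hF, spectralShift_apply, sum_inner, Fintype.sum_sum_type]
        simp only [inner_smul_left, conj_trivial, Finset.univ_unique, Finset.sum_singleton]
        rw [h6 (Sum.inl default), show ν (Sum.inl default) = 0 from hν0]
        simp only [zero_mul, mul_zero, zero_add]
        refine Finset.sum_congr rfl fun i _ => ?_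
        have := (hν i).ne'
        rw [h6 (Sum.inr i)]
        field_simp
      rw [h7, h8]; ring
    rw [h3, Finset.prod_neg, mul_neg, neg_lt_zero, Finset.card_univ, Fintype.card_fin]
    have h4 : 0 < ∏ i, ν (Sum.inr i) := Finset.prod_pos fun i _ => hν i
    have := mul_pos h4 hsign
    linarith
  obtain ⟨l₁, hl₁, hneg⟩ : ∃ l₁ > 0, (M l₁).det < 0 := by
    have h1 : ∀ᶠ l in 𝓝[>] (0 : ℝ), (M' l).det < 0 :=
      ((hM'cont.tendsto 0).eventually_lt_const hM'0).filter_mono nhdsWithin_le_nhds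
    obtain ⟨l, hl, hl'⟩ := (h1.and self_mem_nhdsWithin).exists
    refine ⟨l, hl', ?_⟩
    rw [hMM']
    have : 0 < l ^ 2 := pow_pos hl' 2
    exact mul_neg_of_pos_of_neg this hl
  obtain ⟨l₂, hl₂, hpos⟩ : ∃ l₂ > l₁, 0 < (M l₂).det := by
    obtain ⟨l, hl, hl'⟩ := ((hMlim.eventually_const_lt one_pos).and (eventually_gt_atTop l₁)).exists
    exact ⟨l, hl', hl⟩
  obtain ⟨l, hl, hzero⟩ := intermediate_value_Icc hl₂.le hMcont.continuousOn ⟨hneg.le, hpos.le⟩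
  refine ⟨l, hl₁.trans_le hl.1, ?_⟩
  obtain ⟨y, hy0, hy⟩ := Matrix.exists_mulVec_eq_zero_iff.2 hzero
  -- A null vector `y` of `M l` provides the coefficients `⟪e i, f⟫ = y i` of a solution of `f = R l
  -- (F f)`.
  set f : X := ∑ j, ((1 + ν j) * y j) • R l (e j) with hf
  have hfe : ∀ i, ⟪e i, f⟫_ℝ = y i := by
    intro i
    have := congrFun hy i
    simp only [Matrix.mulVec, dotProduct, hM, Matrix.of_apply, Pi.zero_apply, sub_mul,
      Finset.sum_sub_distrib, ite_mul, one_mul, zero_mul, Finset.sum_ite_eq, Finset.mem_univ,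
      if_true] at this
    rw [hf, inner_sum]
    refine Eq.trans ?_ (sub_eq_zero.1 this).symm
    refine Finset.sum_congr rfl fun j _ => ?_
    rw [inner_smul_right]; ring
  refine ⟨f, ?_, ?_⟩
  · rintro h0
    refine hy0 (funext fun i => ?_)
    rw [← hfe i, h0, inner_zero_right]; rfl
  · have h1 : f = R l (F f) := by
      rw [hF, spectralShift_apply]
      simp only [hfe, map_sum, map_smul]
      exact hf
    rw [hRiff] at h1
    nth_rewrite 1 [h1]
    congr 1
    simp [hQdef]

end FixedPoint

end FKdV

namespace FKdV

/-! ### Orthonormal eigenvectors spanning the negative eigenspaces. -/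

section EigenBasis

open Filter Topology
open scoped InnerProductSpace

variable {X : Type*} [NormedAddCommGroup X] [InnerProductSpace ℝ X]

/-- The eigenspaces of `Y⁻¹ - Φ` are those of a bounded symmetric operator. -/
theorem exists_shifted_resolvent [CompleteSpace X] {Y Φ : X →L[ℝ] X}
    (hYs : ∀ f g, ⟪Y f, g⟫_ℝ = ⟪f, Y g⟫_ℝ) (hY0 : ∀ f, 0 ≤ ⟪f, Y f⟫_ℝ)
    (hΦ : ∀ f g, ⟪Φ f, g⟫_ℝ = ⟪f, Φ g⟫_ℝ) :
    ∃ (M : ℝ) (S : X →L[ℝ] X), (∀ f g, ⟪S f, g⟫_ℝ = ⟪f, S g⟫_ℝ) ∧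
      ∀ (m : ℝ) v, v = Y (Φ v + m • v) ↔ v = (m + M) • S v := by
  set M : ℝ := ‖Φ‖ + 1 with hM
  set Q : X →L[ℝ] X := Φ - M • 1 with hQdef
  have hQa : ∀ w, Q w = Φ w - M • w := fun w => by simp [hQdef]
  have hQ : ∀ f g, ⟪Q f, g⟫_ℝ = ⟪f, Q g⟫_ℝ := fun f g => by
    rw [hQa, hQa, inner_sub_left, inner_sub_right, hΦ, inner_smul_left, inner_smul_right]; simp
  have hYQ : ∀ h, 1 * ‖Y h‖ ^ 2 ≤ ⟪h - Q (Y h), Y h⟫_ℝ := by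
    intro h
    have h1 : ⟪Φ (Y h), Y h⟫_ℝ ≤ ‖Φ‖ * ‖Y h‖ ^ 2 := by
      calc _ ≤ ‖Φ (Y h)‖ * ‖Y h‖ := real_inner_le_norm _ _
        _ ≤ (‖Φ‖ * ‖Y h‖) * ‖Y h‖ := by gcongr; exact Φ.le_opNorm _
        _ = _ := by ring
    rw [hQa, inner_sub_left, inner_sub_left, inner_smul_left, real_inner_self_eq_norm_sq]
    have := hY0 h
    simp only [conj_trivial]
    rw [hM]; linarith
  obtain ⟨S, hS⟩ := exists_resolvent one_pos hYs hQ hYQ hYQ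
  refine ⟨M, S, resolvent_adjoint hYs hQ (fun g => (hS _ _).1 rfl) (fun g => (hS _ _).1 rfl),
    fun m v => ?_⟩
  rw [← map_smul, hS]
  have : Q v + (m + M) • v = Φ v + m • v := by rw [hQa]; module
  rw [this]

/-- The eigenspace `{v | v = Y (Φ v + m v)}` of `Y⁻¹ - Φ`. -/
def fixSpace {𝕜 E : Type*} [NontriviallyNormedField 𝕜] [NormedAddCommGroup E] [NormedSpace 𝕜 E]
    (Y Φ : E →L[𝕜] E) (m : 𝕜) : Submodule 𝕜 E where
  carrier := {v | v = Y (Φ v + m • v)}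
  add_mem' := by
    intro a b ha hb
    simp only [Set.mem_ofPred_eq] at *
    nth_rewrite 1 [ha, hb]
    rw [← map_add, map_add Φ]
    congr 1; module
  zero_mem' := by simp
  smul_mem' := by
    intro c a ha
    simp only [Set.mem_ofPred_eq] at *
    nth_rewrite 1 [ha]
    rw [← map_smul, map_smul Φ]
    congr 1; module

theorem mem_fixSpace {𝕜 E : Type*} [NontriviallyNormedField 𝕜] [NormedAddCommGroup E]
    [NormedSpace 𝕜 E] {Y Φ : E →L[𝕜] E} {m : 𝕜} {v : E} :
    v ∈ fixSpace Y Φ m ↔ v = Y (Φ v + m • v) := Iff.rfl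

theorem inner_fixSpace_eq_zero {Y Φ : X →L[ℝ] X}
    (hYs : ∀ f g, ⟪Y f, g⟫_ℝ = ⟪f, Y g⟫_ℝ) (hΦ : ∀ f g, ⟪Φ f, g⟫_ℝ = ⟪f, Φ g⟫_ℝ) {m m' : ℝ}
    (hm : m ≠ m') {v w : X} (hv : v ∈ fixSpace Y Φ m) (hw : w ∈ fixSpace Y Φ m') :
    ⟪v, w⟫_ℝ = 0 := by
  have h1 : ⟪v, Φ w + m' • w⟫_ℝ = ⟪Φ v + m • v, w⟫_ℝ := by
    nth_rewrite 1 [mem_fixSpace.1 hv]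
    rw [hYs, ← mem_fixSpace.1 hw]
  rw [inner_add_right, inner_add_left, hΦ, inner_smul_left, inner_smul_right] at h1
  simp only [conj_trivial] at h1
  have h2 : (m - m') * ⟪v, w⟫_ℝ = 0 := by linarith
  exact (mul_eq_zero.1 h2).resolve_left (sub_ne_zero.2 hm)

/-- An orthonormal basis of eigenvectors for the sum of the negative eigenspaces. -/
theorem exists_orthonormal_eigenvectors [CompleteSpace X] {Y Φ : X →L[ℝ] X}
    (hYs : ∀ f g, ⟪Y f, g⟫_ℝ = ⟪f, Y g⟫_ℝ) (hY0 : ∀ f, 0 ≤ ⟪f, Y f⟫_ℝ)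
    (hΦ : ∀ f g, ⟪Φ f, g⟫_ℝ = ⟪f, Φ g⟫_ℝ)
    (hfin : FiniteDimensional ℝ (⨆ m : Set.Iio (0 : ℝ), fixSpace Y Φ (m : ℝ) : Submodule ℝ X)) :
    ∃ (N : ℕ) (e : Fin N → X) (ν : Fin N → ℝ), Orthonormal ℝ e ∧ (∀ i, 0 < ν i) ∧
      (∀ i, e i ∈ fixSpace Y Φ (-ν i)) ∧
      (⨆ m : Set.Iio (0 : ℝ), fixSpace Y Φ (m : ℝ)) ≤ Submodule.span ℝ (Set.range e) := by
  set E : Submodule ℝ X := ⨆ m : Set.Iio (0 : ℝ), fixSpace Y Φ (m : ℝ) with hE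
  obtain ⟨M, S, hSs, hS⟩ := exists_shifted_resolvent hYs hY0 hΦ
  -- The bounded symmetric `S = (L + M)⁻¹` preserves `E`, so the finite dimensional spectral theorem
  -- applies to its restriction.
  have hinv : ∀ v ∈ E, (S : X →ₗ[ℝ] X) v ∈ E := by
    have : E ≤ E.comap (S : X →ₗ[ℝ] X) := by
      refine iSup_le fun m v hv => ?_
      have h1 := (hS _ _).1 (mem_fixSpace.1 hv)
      rw [Submodule.mem_comap]
      by_cases hm : (m : ℝ) + M = 0
      · rw [hm, zero_smul] at h1
        rw [h1, map_zero]; exact E.zero_mem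
      · have h2 : S v = ((m : ℝ) + M)⁻¹ • v := by
          nth_rewrite 2 [h1]
          rw [smul_smul, inv_mul_cancel₀ hm, one_smul]
        change S v ∈ E
        rw [h2]
        exact E.smul_mem _ ((le_iSup (fun m : Set.Iio (0 : ℝ) => fixSpace Y Φ (m : ℝ)) m) hv)
    exact this
  have hsym : (S : X →ₗ[ℝ] X).IsSymmetric := hSs
  have hsym' := hsym.restrict_invariant hinv
  set B := hsym'.eigenvectorBasis (n := Module.finrank ℝ E) rfl with hB
  set e : Fin (Module.finrank ℝ E) → X := fun i => (B i : X) with he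
  have hon : Orthonormal ℝ e := B.orthonormal.comp_linearIsometry E.subtypeₗᵢ
  have hspan : E ≤ Submodule.span ℝ (Set.range e) := by
    intro v hv
    have h1 := B.sum_repr ⟨v, hv⟩
    have h2 := congrArg (E.subtype) h1
    rw [map_sum] at h2
    change _ = v at h2
    rw [← h2]
    refine Submodule.sum_mem _ fun i _ => ?_
    rw [map_smul]
    exact Submodule.smul_mem _ _ (Submodule.subset_span ⟨i, rfl⟩)
  have hSe : ∀ i, S (e i) = (hsym'.eigenvalues rfl i : ℝ) • e i := fun i => by
    have := congrArg E.subtype (hsym'.apply_eigenvectorBasis rfl i)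
    exact this
  -- Otherwise `e i` would be orthogonal to every negative eigenspace of `L`, hence to `E`, which
  -- contains it.
  have hex : ∀ i, ∃ m < (0 : ℝ), (m + M) * (hsym'.eigenvalues rfl i : ℝ) = 1 := by
    intro i
    by_contra! hcon
    have h1 : E ≤ (Submodule.span ℝ {e i})ᗮ := by
      refine iSup_le fun m v hv => ?_
      rw [Submodule.mem_orthogonal_singleton_iff_inner_right]
      have h2 := (hS _ _).1 (mem_fixSpace.1 hv)
      have h3 : ⟪e i, v⟫_ℝ = ((m : ℝ) + M) * (hsym'.eigenvalues rfl i : ℝ) * ⟪e i, v⟫_ℝ := by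
        nth_rewrite 1 [h2]
        rw [inner_smul_right, ← hSs, hSe, inner_smul_left]
        simp only [conj_trivial]; ring
      have h4 := hcon m m.2
      have h5 : (1 - ((m : ℝ) + M) * (hsym'.eigenvalues rfl i : ℝ)) * ⟪e i, v⟫_ℝ = 0 := by
        linarith
      exact (mul_eq_zero.1 h5).resolve_left (sub_ne_zero.2 h4.symm)
    have h2 := h1 (B i).2
    rw [Submodule.mem_orthogonal_singleton_iff_inner_right] at h2
    change ⟪e i, e i⟫_ℝ = 0 at h2
    rw [inner_self_eq_zero] at h2
    exact hon.ne_zero i h2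
  choose m hm0 hm using hex
  refine ⟨_, e, fun i => - m i, hon, fun i => neg_pos.2 (hm0 i), fun i => ?_, hspan⟩
  rw [neg_neg, mem_fixSpace, hS, hSe, smul_smul, hm, one_smul]

end EigenBasis

end FKdV

namespace FKdV

/-! ### Descent from a complex Hilbert space to the real subspace fixed by a conjugation. -/

section RealForm

open Filter Topology
open scoped InnerProductSpace ComplexConjugate

variable {H : Type*} [NormedAddCommGroup H] [InnerProductSpace ℂ H]

/-- A conjugation of a complex Hilbert space. -/
structure IsConjugation (J : H →ₗ⋆[ℂ] H) : Prop where
  invol : ∀ f, J (J f) = f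
  inner_map : ∀ f g, ⟪J f, J g⟫_ℂ = ⟪g, f⟫_ℂ

/-- The real subspace fixed by a conjugation. -/
def realForm (J : H →ₗ⋆[ℂ] H) : Submodule ℝ H where
  carrier := {f | J f = f}
  add_mem' := by
    intro a b ha hb
    simp only [Set.mem_ofPred_eq] at *
    rw [map_add, ha, hb]
  zero_mem' := map_zero J
  smul_mem' := by
    intro c a ha
    simp only [Set.mem_ofPred_eq] at *
    rw [← Complex.coe_smul, map_smulₛₗ, ha]; simp

variable {J : H →ₗ⋆[ℂ] H}

noncomputable instance : InnerProductSpace ℝ (realForm J) :=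
  letI : InnerProductSpace ℝ H := InnerProductSpace.rclikeToReal ℂ H
  Submodule.innerProductSpace (realForm J)

theorem inner_realForm (f g : realForm J) : ⟪f, g⟫_ℝ = (⟪(f : H), (g : H)⟫_ℂ).re := rfl

theorem mem_realForm {f : H} : f ∈ realForm J ↔ J f = f := Iff.rfl

theorem IsConjugation.norm_map (hJ : IsConjugation J) (f : H) : ‖J f‖ = ‖f‖ := by
  have h := hJ.inner_map f f
  rw [inner_self_eq_norm_sq_to_K, inner_self_eq_norm_sq_to_K] at h
  have h2 : ‖J f‖ ^ 2 = ‖f‖ ^ 2 := by exact_mod_cast h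
  exact (sq_eq_sq₀ (norm_nonneg _) (norm_nonneg _)).1 h2

theorem IsConjugation.continuous (hJ : IsConjugation J) : Continuous J := by
  have : Isometry J := AddMonoidHomClass.isometry_of_norm J hJ.norm_map
  exact this.continuous

theorem IsConjugation.completeSpace [CompleteSpace H] (hJ : IsConjugation J) :
    CompleteSpace (realForm J) := by
  have : IsClosed (realForm J : Set H) := isClosed_eq hJ.continuous continuous_id
  exact this.completeSpace_coe

theorem IsConjugation.inner_eq (hJ : IsConjugation J) (f g : realForm J) :
    ⟪(f : H), (g : H)⟫_ℂ = ((⟪f, g⟫_ℝ : ℝ) : ℂ) := by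
  have h2 := hJ.inner_map f g
  rw [mem_realForm.1 f.2, mem_realForm.1 g.2] at h2
  rw [inner_realForm]
  symm
  rw [← Complex.conj_eq_iff_re, inner_conj_symm]
  exact h2.symm

/-- The restriction to the real form of an operator that commutes with the conjugation. -/
noncomputable def realPart (J : H →ₗ⋆[ℂ] H) (T : H →L[ℂ] H) (hT : ∀ f, J (T f) = T (J f)) :
    realForm J →L[ℝ] realForm J :=
  ((T.restrictScalars ℝ).comp (realForm J).subtypeL).codRestrict (realForm J) fun f => by
    rw [mem_realForm]
    change J (T f) = T f
    rw [hT, mem_realForm.1 f.2]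

theorem realPart_coe {T : H →L[ℂ] H} (hT : ∀ f, J (T f) = T (J f)) (f : realForm J) :
    ((realPart J T hT f : realForm J) : H) = T f := rfl

theorem realPart_isCompact [CompleteSpace H] (hJ : IsConjugation J) {T : H →L[ℂ] H}
    (hT : ∀ f, J (T f) = T (J f))
    (hc : IsCompactOperator T) : IsCompactOperator (realPart J T hT) := by
  have h1 : IsCompactOperator (T.restrictScalars ℝ) := hc
  have h2 : IsCompactOperator ((T.restrictScalars ℝ).comp (realForm J).subtypeL) :=
    h1.comp_clm (realForm J).subtypeL
  exact IsCompactOperator.codRestrict h2 _ (isClosed_eq hJ.continuous continuous_id)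

/-- The properties of the inverses `Y l` of the operators `D^α + c - l ∂ₓ⁻¹` that are used,
over the complex numbers. -/
structure IsComplexResolventFamily (J : H →ₗ⋆[ℂ] H) (Y : ℝ → H →L[ℂ] H) : Prop where
  adj : ∀ l f g, ⟪Y l f, g⟫_ℂ = ⟪f, Y (-l) g⟫_ℂ
  map_conj : ∀ l f, J (Y l f) = Y l (J f)
  factor : ∀ l h, J h = h →
    ∃ h', J h' = h' ∧ Y l h = Y 0 h' ∧ (⟪h, Y l h⟫_ℂ).re = (⟪h', Y 0 h'⟫_ℂ).re
  nonneg : ∀ h, 0 ≤ (⟪h, Y 0 h⟫_ℂ).re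
  cont : ∀ g, Continuous fun l => Y l g
  lim : ∀ g, Tendsto (fun l => Y l g) atTop (𝓝 0)

theorem IsComplexResolventFamily.isResolventFamily {Y : ℝ → H →L[ℂ] H}
    (hY : IsComplexResolventFamily J Y) :
    IsResolventFamily fun l => realPart J (Y l) (hY.map_conj l) := by
  have hin := inner_realForm (J := J)
  refine ⟨fun l f g => ?_, fun l h => ?_, fun h => ?_, fun g => ?_, fun g => ?_⟩
  · rw [hin, hin, realPart_coe, realPart_coe, hY.adj]
  · obtain ⟨h', h1, h2, h3⟩ := hY.factor l h h.2
    refine ⟨⟨h', h1⟩, Subtype.ext h2, ?_⟩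
    rw [hin, hin]; exact h3
  · rw [hin]; exact hY.nonneg h
  · exact Continuous.subtype_mk (hY.cont g) _
  · exact tendsto_subtype_rng.2 (hY.lim g)

theorem mem_fixSpace_realPart {Y Φ : H →L[ℂ] H} (hY : ∀ f, J (Y f) = Y (J f))
    (hΦ : ∀ f, J (Φ f) = Φ (J f)) {m : ℝ} {v : realForm J} :
    v ∈ fixSpace (realPart J Y hY) (realPart J Φ hΦ) m ↔ (v : H) ∈ fixSpace Y Φ (m : ℂ) := by
  rw [mem_fixSpace, mem_fixSpace, Subtype.ext_iff, realPart_coe]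
  simp [realPart_coe]

/-- For a real eigenvalue, the real and imaginary parts of an eigenvector are again eigenvectors,
because `Y` and `Φ` commute with `J`. -/
theorem mem_span_of_real {Y Φ : H →L[ℂ] H} (hJ : IsConjugation J) (hY : ∀ f, J (Y f) = Y (J f))
    (hΦ : ∀ f, J (Φ f) = Φ (J f)) {m : ℝ} {v : H} (hv : v ∈ fixSpace Y Φ (m : ℂ)) {W : Submodule ℂ H}
    (hW : ∀ w : realForm J, w ∈ fixSpace (realPart J Y hY) (realPart J Φ hΦ) m → (w : H) ∈ W) :
    v ∈ W := by
  have hJv : J v ∈ fixSpace Y Φ (m : ℂ) := by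
    rw [mem_fixSpace] at hv ⊢
    nth_rewrite 1 [hv]
    rw [hY, map_add, hΦ, map_smulₛₗ]; simp
  have ha : J (v + J v) = v + J v := by rw [map_add, hJ.invol, add_comm]
  have hb : J (Complex.I • (v - J v)) = Complex.I • (v - J v) := by
    rw [map_smulₛₗ, map_sub, hJ.invol]; simp [smul_sub]; abel
  have h1 := hW ⟨v + J v, ha⟩ ((mem_fixSpace_realPart hY hΦ).2 (Submodule.add_mem _ hv hJv))
  have h2 := hW ⟨_, hb⟩ ((mem_fixSpace_realPart hY hΦ).2
    (Submodule.smul_mem _ _ (Submodule.sub_mem _ hv hJv)))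
  have h3 : v = (2 : ℂ)⁻¹ • (v + J v) + (-(2 : ℂ)⁻¹ * Complex.I) • (Complex.I • (v - J v)) := by
    rw [smul_smul, mul_assoc, Complex.I_mul_I]; module
  rw [h3]
  exact W.add_mem (W.smul_mem _ h1) (W.smul_mem _ h2)

/-- The sign argument needs real scalars. The negative eigenspaces are complexifications of their
real parts, so passing to the real form leaves the index unchanged. -/
theorem exists_real_kernel_of_parity [CompleteSpace H] (hJ : IsConjugation J)
    {Y : ℝ → H →L[ℂ] H} (hY : IsComplexResolventFamily J Y) {Φ : H →L[ℂ] H}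
    (hΦJ : ∀ f, J (Φ f) = Φ (J f)) (hΦ : ∀ f g, ⟪Φ f, g⟫_ℂ = ⟪f, Φ g⟫_ℂ)
    (hcpt : IsCompactOperator (Y 0 * Φ)) {n : ℕ}
    (hn : Module.rank ℂ (⨆ m : Set.Iio (0 : ℝ), fixSpace (Y 0) Φ ((m : ℝ) : ℂ) : Submodule ℂ H) = n)
    {ψ : H} (hψ : ψ ≠ 0) (hψJ : J ψ = ψ) (hker : fixSpace (Y 0) Φ 0 = Submodule.span ℂ {ψ})
    {b χ : H} (hbJ : J b = b) (hχJ : J χ = χ) (hb : ∀ l : ℝ, ψ = Y l (Φ ψ - (l : ℂ) • b))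
    (hχ : χ = Y 0 (Φ χ - b)) (hsign : 0 < (-1) ^ n * (⟪χ, b⟫_ℂ).re) :
    ∃ l > 0, ∃ f, f ≠ 0 ∧ J f = f ∧ f = Y l (Φ f) := by
  have := hJ.completeSpace
  set Yr : ℝ → realForm J →L[ℝ] realForm J := fun l => realPart J (Y l) (hY.map_conj l) with hYr
  set Φr := realPart J Φ hΦJ with hΦr
  have hRY : IsResolventFamily Yr := hY.isResolventFamily
  have hin := inner_realForm (J := J)
  have hΦs : ∀ f g, ⟪Φr f, g⟫_ℝ = ⟪f, Φr g⟫_ℝ := fun f g => by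
    rw [hin, hin]
    change (⟪Φ f, (g : H)⟫_ℂ).re = (⟪(f : H), Φ g⟫_ℂ).re
    rw [hΦ]
  have hYs : ∀ f g, ⟪Yr 0 f, g⟫_ℝ = ⟪f, Yr 0 g⟫_ℝ := fun f g => by
    have := hRY.adj 0 f g
    rwa [neg_zero] at this
  set EC : Submodule ℂ H := ⨆ m : Set.Iio (0 : ℝ), fixSpace (Y 0) Φ ((m : ℝ) : ℂ) with hEC
  set ER : Submodule ℝ (realForm J) := ⨆ m : Set.Iio (0 : ℝ), fixSpace (Yr 0) Φr (m : ℝ) with hER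
  have hfinC : FiniteDimensional ℂ EC := by
    have h1 : Module.rank ℂ EC < Cardinal.aleph0 := by rw [hn]; exact Cardinal.natCast_lt_aleph0
    exact Module.rank_lt_aleph0_iff.1 h1
  have hfixEC : ∀ (m : ℝ), m < 0 → ∀ v : realForm J, v ∈ fixSpace (Yr 0) Φr m → (v : H) ∈ EC := by
    intro m hm v hv
    exact le_iSup (fun m : Set.Iio (0 : ℝ) => fixSpace (Y 0) Φ ((m : ℝ) : ℂ)) ⟨m, hm⟩
      ((mem_fixSpace_realPart _ _).1 hv)
  have hfinR : FiniteDimensional ℝ ER := by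
    have h1 : FiniteDimensional ℝ (EC.restrictScalars ℝ) := FiniteDimensional.complexToReal EC
    have h2 : ER ≤ (EC.restrictScalars ℝ).comap (realForm J).subtype :=
      iSup_le fun m v hv => hfixEC m m.2 v hv
    have h3 : ER.map (realForm J).subtype ≤ EC.restrictScalars ℝ := Submodule.map_le_iff_le_comap.2 h2
    have h4 : FiniteDimensional ℝ (ER.map (realForm J).subtype) :=
      Submodule.finiteDimensional_of_le h3
    exact Module.Finite.of_injective
      ((ER.equivMapOfInjective _ (realForm J).injective_subtype).toLinearMap)
      (LinearEquiv.injective _)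
  obtain ⟨N, e, ν, heo, hν, hemem, hspan⟩ :=
    exists_orthonormal_eigenvectors hYs hRY.nonneg hΦs hfinR
  have heoC : Orthonormal ℂ (fun i => (e i : H)) := by
    rw [orthonormal_iff_ite] at heo ⊢
    intro i j
    rw [hJ.inner_eq, heo]
    split_ifs <;> simp
  have hspanC : Submodule.span ℂ (Set.range fun i => (e i : H)) = EC := by
    apply le_antisymm
    · rw [Submodule.span_le]
      rintro _ ⟨i, rfl⟩
      exact hfixEC _ (neg_lt_zero.2 (hν i)) _ (hemem i)
    · refine iSup_le fun m v hv => mem_span_of_real hJ (hY.map_conj 0) hΦJ hv fun w hw => ?_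
      have h1 : w ∈ Submodule.span ℝ (Set.range e) :=
        hspan (le_iSup (fun m : Set.Iio (0 : ℝ) => fixSpace (Yr 0) Φr (m : ℝ)) m hw)
      have h2 : Submodule.span ℝ (Set.range e) ≤
          ((Submodule.span ℂ (Set.range fun i => (e i : H))).restrictScalars ℝ).comap
            (realForm J).subtype := by
        rw [Submodule.span_le]
        rintro _ ⟨i, rfl⟩
        exact Submodule.subset_span ⟨i, rfl⟩
      exact h2 h1
  -- The real orthonormal family is also a complex basis of the sum of the negative eigenspaces.
  obtain rfl : N = n := by
    have h2 := finrank_span_eq_card heoC.linearIndependent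
    rw [hspanC, Fintype.card_fin] at h2
    rw [← h2]
    exact Module.finrank_eq_of_rank_eq hn
  set p : realForm J := ⟨ψ, hψJ⟩ with hp
  have hp0 : ‖p‖ ≠ 0 := by
    rw [norm_ne_zero_iff]
    exact fun h => hψ (congrArg Subtype.val h)
  -- Normalization of `ψ`. The vectors `b` and `χ` are scaled by the same `k`: the linear relations
  -- persist, and `⟪χ, b⟫` is multiplied by `k ^ 2 > 0`.
  set k : ℝ := ‖p‖⁻¹ with hk
  have hk0 : k ≠ 0 := inv_ne_zero hp0
  have hpb : ∀ l, p = Yr l (Φr p - l • (⟨b, hbJ⟩ : realForm J)) := fun l => by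
    refine Subtype.ext ?_
    have := hb l
    rwa [Complex.coe_smul] at this
  have hp_mem : k • p ∈ fixSpace (Yr 0) Φr 0 := by
    refine Submodule.smul_mem _ _ ?_
    rw [mem_fixSpace]
    have := hpb 0
    simpa using this
  set e' : Unit ⊕ Fin N → realForm J := Sum.elim (fun _ => k • p) e with he'
  set ν' : Unit ⊕ Fin N → ℝ := Sum.elim (fun _ => 0) ν with hν'
  have he'mem : ∀ i, e' i ∈ fixSpace (Yr 0) Φr (-ν' i) := by
    rintro (i | i)
    · simpa [he', hν'] using hp_mem
    · exact hemem i
  have hpe : ∀ i, ⟪k • p, e i⟫_ℝ = 0 := fun i =>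
    inner_fixSpace_eq_zero hYs hΦs (by have := hν i; intro h; linarith) hp_mem (hemem i)
  have he'o : Orthonormal ℝ e' := by
    constructor
    · rintro (i | i)
      · change ‖k • p‖ = 1
        rw [norm_smul, hk, norm_inv, norm_norm, inv_mul_cancel₀ hp0]
      · exact heo.1 i
    · rintro (i | i) (j | j) hij
      · exact absurd rfl hij
      · exact hpe j
      · rw [real_inner_comm]; exact hpe i
      · exact heo.2 (by simpa using hij)
  have he'eig : ∀ i, e' i = Yr 0 (Φr (e' i) - ν' i • e' i) := fun i => by
    have := mem_fixSpace.1 (he'mem i)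
    rwa [neg_smul, ← sub_eq_add_neg] at this
  have hcpt' : IsCompactOperator (Yr 0 * Φr) :=
    realPart_isCompact hJ (T := Y 0 * Φ) (fun f => by
      change J (Y 0 (Φ f)) = Y 0 (Φ (J f))
      rw [hY.map_conj, hΦJ]) hcpt
  obtain ⟨δ, hδ, hgap⟩ := exists_gap hYs hRY.nonneg hΦs hcpt' he'o he'eig (by
    intro m hm v hv hvo
    rw [← mem_fixSpace] at hv
    rcases hm.lt_or_eq with hm | rfl
    · have h1 : v ∈ Submodule.span ℝ (Set.range e) :=
        hspan (le_iSup (fun m : Set.Iio (0 : ℝ) => fixSpace (Yr 0) Φr (m : ℝ)) ⟨m, hm⟩ hv)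
      have h2 : Submodule.span ℝ (Set.range e) ≤ (Submodule.span ℝ {v})ᗮ := by
        rw [Submodule.span_le]
        rintro _ ⟨i, rfl⟩
        rw [SetLike.mem_coe, Submodule.mem_orthogonal_singleton_iff_inner_left]
        exact hvo (Sum.inr i)
      have h3 := h2 h1
      rw [Submodule.mem_orthogonal_singleton_iff_inner_left] at h3
      exact inner_self_eq_zero.1 h3
    · have h1 : (v : H) ∈ fixSpace (Y 0) Φ 0 := by
        have := (mem_fixSpace_realPart (hY.map_conj 0) hΦJ).1 hv
        simpa using this
      rw [hker, Submodule.mem_span_singleton] at h1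
      obtain ⟨a, ha⟩ := h1
      have h2 : ⟪p, v⟫_ℝ = 0 := by
        have h3 : ⟪k • p, v⟫_ℝ = 0 := hvo (Sum.inl ())
        rw [inner_smul_left] at h3
        exact (mul_eq_zero.1 h3).resolve_left hk0
      have h3 : ⟪(p : H), (v : H)⟫_ℂ = 0 := by rw [hJ.inner_eq, h2]; simp
      rw [← ha, inner_smul_right] at h3
      have h4 : a = 0 := (mul_eq_zero.1 h3).resolve_right (inner_self_ne_zero.2 hψ)
      refine Subtype.ext ?_
      rw [← ha, h4, zero_smul]; rfl)
  obtain ⟨l, hl, f, hf0, hf⟩ := exists_kernel_of_parity hRY hΦs he'o (ν := ν') rfl hν he'eig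
    (b := k • ⟨b, hbJ⟩) (fun l => by
      have := congrArg (fun x => k • x) (hpb l)
      simp only [← map_smul] at this
      rw [smul_sub, smul_comm k l] at this
      rw [← map_smul] at this
      exact this) (χ := k • ⟨χ, hχJ⟩) (by
      have h1 : (⟨χ, hχJ⟩ : realForm J) = Yr 0 (Φr ⟨χ, hχJ⟩ - ⟨b, hbJ⟩) := Subtype.ext hχ
      have := congrArg (fun x => k • x) h1
      simp only [← map_smul] at this
      rw [smul_sub, ← map_smul] at this
      exact this) hδ hgap (by
      rw [inner_smul_left, inner_smul_right, hin]
      simp only [conj_trivial]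
      have : 0 < k ^ 2 := by positivity
      nlinarith [mul_pos this hsign])
  refine ⟨l, hl, f, fun h => hf0 (Subtype.ext h), f.2, congrArg Subtype.val hf⟩

end RealForm

end FKdV

namespace FKdV

/-! ### Bounded multiplication operators, Fourier multipliers and complex conjugation on `L²`. -/

section Multipliers

open Filter Topology
open scoped InnerProductSpace

/-- Multiplication by a bounded function. -/
noncomputable def bmul (m : ℝ → ℂ) (hm : MemLp m ⊤ volume) : L2 →L[ℂ] L2 :=
  (ContinuousLinearMap.mul ℂ ℂ).holderL volume ⊤ 2 2 (hm.toLp m)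

theorem bmul_coe {m : ℝ → ℂ} (hm : MemLp m ⊤ volume) (f : L2) :
    bmul m hm f =ᵐ[volume] fun x => m x * f x := by
  have h1 : bmul m hm f =ᵐ[volume] fun x => (hm.toLp m) x * f x :=
    ContinuousLinearMap.coeFn_holder (ContinuousLinearMap.mul ℂ ℂ) (r := 2) (hm.toLp m) f
  filter_upwards [h1, hm.coeFn_toLp] with x h1 h2
  rw [h1, h2]

theorem norm_sq_eq_integral (f : L2) : ‖f‖ ^ 2 = ∫ x, ‖f x‖ ^ 2 := by
  have h1 : (⟪f, f⟫_ℂ).re = ∫ x, ‖f x‖ ^ 2 := by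
    rw [MeasureTheory.L2.inner_def]
    have h2 : ∀ x, ⟪f x, f x⟫_ℂ = ((‖f x‖ ^ 2 : ℝ) : ℂ) := fun x => by
      rw [inner_self_eq_norm_sq_to_K]; simp
    simp only [h2]
    rw [integral_complex_ofReal, Complex.ofReal_re]
  rw [← h1, inner_self_eq_norm_sq_to_K]
  norm_cast

theorem inner_bmul {m m' : ℝ → ℂ} (hm : MemLp m ⊤ volume) (hm' : MemLp m' ⊤ volume)
    (h : ∀ᵐ x, m' x = starRingEnd ℂ (m x)) (f g : L2) :
    ⟪bmul m hm f, g⟫_ℂ = ⟪f, bmul m' hm' g⟫_ℂ := by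
  rw [MeasureTheory.L2.inner_def, MeasureTheory.L2.inner_def]
  refine integral_congr_ae ?_
  filter_upwards [bmul_coe hm f, bmul_coe hm' g, h] with x h1 h2 h3
  rw [h1, h2, h3]
  simp only [RCLike.inner_apply, map_mul]
  ring

theorem integrable_norm_sq (f : L2) : Integrable fun x => ‖f x‖ ^ 2 :=
  (Lp.memLp f).integrable_norm_pow (by norm_num)

theorem bmul_tendsto {ι : Type*} {l : Filter ι} [l.IsCountablyGenerated] {m : ι → ℝ → ℂ}
    {m₀ : ℝ → ℂ}
    (hm : ∀ i, MemLp (m i) ⊤ volume) (hm₀ : MemLp m₀ ⊤ volume) {C : ℝ}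
    (hC : ∀ i x, ‖m i x‖ ≤ C) (hC₀ : ∀ x, ‖m₀ x‖ ≤ C)
    (hlim : ∀ᵐ x, Tendsto (fun i => m i x) l (𝓝 (m₀ x))) (f : L2) :
    Tendsto (fun i => bmul (m i) (hm i) f) l (𝓝 (bmul m₀ hm₀ f)) := by
  have h1 : ∀ i, ‖bmul (m i) (hm i) f - bmul m₀ hm₀ f‖ ^ 2 =
      ∫ x, ‖m i x - m₀ x‖ ^ 2 * ‖f x‖ ^ 2 := by
    intro i
    rw [norm_sq_eq_integral]
    refine integral_congr_ae ?_
    filter_upwards [Lp.coeFn_sub (bmul (m i) (hm i) f) (bmul m₀ hm₀ f), bmul_coe (hm i) f,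
      bmul_coe hm₀ f] with x h1 h2 h3
    rw [h1, Pi.sub_apply, h2, h3, ← sub_mul, norm_mul, mul_pow]
  have h2 : Tendsto (fun i => ∫ x, ‖m i x - m₀ x‖ ^ 2 * ‖f x‖ ^ 2) l (𝓝 (∫ _ : ℝ, (0 : ℝ))) := by
    refine tendsto_integral_filter_of_dominated_convergence
      (fun x => (C + C) ^ 2 * ‖f x‖ ^ 2) ?_ ?_ ((integrable_norm_sq f).const_mul _) ?_
    · refine Eventually.of_forall fun i => ?_
      exact (((hm i).1.sub hm₀.1).norm.pow 2).mul ((Lp.memLp f).1.norm.pow 2)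
    · refine Eventually.of_forall fun i => Eventually.of_forall fun x => ?_
      rw [Real.norm_of_nonneg (by positivity)]
      have : ‖m i x - m₀ x‖ ≤ C + C := (norm_sub_le _ _).trans (add_le_add (hC i x) (hC₀ x))
      gcongr
    · filter_upwards [hlim] with x hx
      have := (((hx.sub_const (m₀ x)).norm).pow 2).mul_const (‖f x‖ ^ 2)
      simpa using this
  rw [integral_zero] at h2
  simp only [← h1] at h2
  have h3 := h2.sqrt
  simp only [Real.sqrt_sq (norm_nonneg _), Real.sqrt_zero] at h3
  exact tendsto_iff_norm_sub_tendsto_zero.2 h3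

theorem norm_bmul_le {m : ℝ → ℂ} (hm : MemLp m ⊤ volume) {C : ℝ} (hC0 : 0 ≤ C)
    (hC : ∀ᵐ x, ‖m x‖ ≤ C) : ‖bmul m hm‖ ≤ C := by
  refine ContinuousLinearMap.opNorm_le_bound _ hC0 fun f => ?_
  refine Lp.norm_le_mul_norm_of_ae_le_mul ?_
  filter_upwards [bmul_coe hm f, hC] with x h1 h2
  rw [h1, norm_mul]; gcongr

/-- The Fourier transform as a continuous linear map. -/
noncomputable def fourierL : L2 →L[ℂ] L2 :=
  (Lp.fourierTransformₗᵢ ℝ ℂ).toContinuousLinearEquiv.toContinuousLinearMap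

/-- The inverse Fourier transform as a continuous linear map. -/
noncomputable def fourierInvL : L2 →L[ℂ] L2 :=
  (Lp.fourierTransformₗᵢ ℝ ℂ).symm.toContinuousLinearEquiv.toContinuousLinearMap

theorem fourier_injective {f g : L2} (h : 𝓕 f = 𝓕 g) : f = g := by
  exact (Lp.fourierTransformₗᵢ ℝ ℂ).injective h

/-- The Fourier multiplier with symbol `m`. -/
noncomputable def fmul (m : ℝ → ℂ) (hm : MemLp m ⊤ volume) : L2 →L[ℂ] L2 :=
  fourierInvL ∘L bmul m hm ∘L fourierL

theorem fourier_fmul {m : ℝ → ℂ} (hm : MemLp m ⊤ volume) (f : L2) :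
    𝓕 (fmul m hm f) = bmul m hm (𝓕 f) := by
  change 𝓕 (𝓕⁻ (bmul m hm (𝓕 f))) = _
  rw [fourier_fourierInv_eq]

theorem fourier_fmul_coe {m : ℝ → ℂ} (hm : MemLp m ⊤ volume) (f : L2) :
    (𝓕 (fmul m hm f) : L2) =ᵐ[volume] fun ξ => m ξ * (𝓕 f : L2) ξ := by
  rw [fourier_fmul]; exact bmul_coe hm _

theorem inner_fmul {m m' : ℝ → ℂ} (hm : MemLp m ⊤ volume) (hm' : MemLp m' ⊤ volume)
    (h : ∀ᵐ x, m' x = starRingEnd ℂ (m x)) (f g : L2) :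
    ⟪fmul m hm f, g⟫_ℂ = ⟪f, fmul m' hm' g⟫_ℂ := by
  rw [← Lp.inner_fourier_eq, ← Lp.inner_fourier_eq f, fourier_fmul, fourier_fmul,
    inner_bmul hm hm' h]

theorem fmul_tendsto {ι : Type*} {l : Filter ι} [l.IsCountablyGenerated] {m : ι → ℝ → ℂ}
    {m₀ : ℝ → ℂ}
    (hm : ∀ i, MemLp (m i) ⊤ volume) (hm₀ : MemLp m₀ ⊤ volume) {C : ℝ}
    (hC : ∀ i x, ‖m i x‖ ≤ C) (hC₀ : ∀ x, ‖m₀ x‖ ≤ C)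
    (hlim : ∀ᵐ x, Tendsto (fun i => m i x) l (𝓝 (m₀ x))) (f : L2) :
    Tendsto (fun i => fmul (m i) (hm i) f) l (𝓝 (fmul m₀ hm₀ f)) :=
  (fourierInvL.continuous.tendsto _).comp (bmul_tendsto hm hm₀ hC hC₀ hlim (fourierL f))

theorem re_inner_fmul {m : ℝ → ℂ} (hm : MemLp m ⊤ volume) (f : L2) :
    (⟪f, fmul m hm f⟫_ℂ).re = ∫ ξ, (m ξ).re * ‖(𝓕 f : L2) ξ‖ ^ 2 := by
  rw [← Lp.inner_fourier_eq, MeasureTheory.L2.inner_def]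
  rw [← RCLike.re_eq_complex_re, ← integral_re (MeasureTheory.L2.integrable_inner _ _)]
  refine integral_congr_ae ?_
  filter_upwards [fourier_fmul_coe hm f] with ξ h1
  rw [h1, RCLike.inner_apply, mul_assoc, Complex.mul_conj, RCLike.re_eq_complex_re,
    Complex.re_mul_ofReal, Complex.normSq_eq_norm_sq]

/-- Complex conjugation on `L²(ℝ; ℂ)`. -/
noncomputable def conjL2 : L2 →ₗ⋆[ℂ] L2 where
  toFun f := star f
  map_add' f g := by
    apply Lp.ext
    filter_upwards [Lp.coeFn_star (f + g), Lp.coeFn_star f, Lp.coeFn_star g, Lp.coeFn_add f g,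
      Lp.coeFn_add (star f) (star g)] with x h1 h2 h3 h4 h5
    rw [h1, h5, Pi.star_apply, h4, Pi.add_apply, Pi.add_apply, h2, h3]; simp
  map_smul' c f := by
    apply Lp.ext
    filter_upwards [Lp.coeFn_star (c • f), Lp.coeFn_star f, Lp.coeFn_smul c f,
      Lp.coeFn_smul (starRingEnd ℂ c) (star f)] with x h1 h2 h3 h4
    rw [h1, h4, Pi.star_apply, h3, Pi.smul_apply, Pi.smul_apply, h2]; simp

theorem conjL2_coe (f : L2) : conjL2 f =ᵐ[volume] fun x => starRingEnd ℂ (f x) :=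
  Lp.coeFn_star f

theorem conjL2_isConjugation : IsConjugation conjL2 where
  invol f := star_star f
  inner_map f g := by
    rw [MeasureTheory.L2.inner_def, MeasureTheory.L2.inner_def]
    refine integral_congr_ae ?_
    filter_upwards [conjL2_coe f, conjL2_coe g] with x h1 h2
    rw [h1, h2]
    simp [mul_comm]

theorem conjL2_bmul {m m' : ℝ → ℂ} (hm : MemLp m ⊤ volume) (hm' : MemLp m' ⊤ volume)
    (h : ∀ᵐ x, m' x = starRingEnd ℂ (m x)) (f : L2) :
    conjL2 (bmul m hm f) = bmul m' hm' (conjL2 f) := by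
  apply Lp.ext
  filter_upwards [conjL2_coe (bmul m hm f), bmul_coe hm f, bmul_coe hm' (conjL2 f),
    conjL2_coe f, h] with x h1 h2 h3 h4 h5
  rw [h1, h2, h3, h4, h5, map_mul]

/-- The reflection `f ↦ f(-·)`. -/
noncomputable def reflL2 (f : L2) : L2 :=
  Lp.compMeasurePreserving (fun x : ℝ => -x) (Measure.measurePreserving_neg volume) f

theorem reflL2_coe (f : L2) : reflL2 f =ᵐ[volume] fun x => f (-x) :=
  Lp.coeFn_compMeasurePreserving f (Measure.measurePreserving_neg volume)

theorem reflL2_continuous : Continuous reflL2 :=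
  (Lp.isometry_compMeasurePreserving (Measure.measurePreserving_neg volume)).continuous

/-- Conjugation on the Fourier side. -/
theorem fourier_conjL2 (f : L2) : 𝓕 (conjL2 f) = reflL2 (conjL2 (𝓕 f)) := by
  have hc : Continuous conjL2 := conjL2_isConjugation.continuous
  have hcl : IsClosed {f : L2 | 𝓕 (conjL2 f) = reflL2 (conjL2 (𝓕 f))} :=
    isClosed_eq (fourierL.continuous.comp hc)
      (reflL2_continuous.comp (hc.comp fourierL.continuous))
  have hd := SchwartzMap.denseRange_toLpCLM (F := ℂ) (E := ℝ) (μ := volume)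
    (p := 2) (by norm_num)
  refine hd.induction_on f hcl fun g => ?_
  set g' : 𝓢(ℝ, ℂ) := SchwartzMap.postcompCLM (Complex.conjCLE : ℂ →L[ℝ] ℂ) g with hg'
  have h1 : conjL2 (g.toLp 2) = g'.toLp 2 := by
    apply Lp.ext
    filter_upwards [conjL2_coe (g.toLp 2), g.coeFn_toLp 2, g'.coeFn_toLp 2] with x h1 h2 h3
    rw [h1, h2, h3, hg', SchwartzMap.postcompCLM_apply]
    rfl
  change 𝓕 (conjL2 (g.toLp 2)) = reflL2 (conjL2 (𝓕 (g.toLp 2)))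
  rw [h1, SchwartzMap.toLp_fourier_eq, SchwartzMap.toLp_fourier_eq]
  apply Lp.ext
  have h5 := (Measure.measurePreserving_neg (volume : Measure ℝ)).quasiMeasurePreserving.ae
    (conjL2_coe ((𝓕 g).toLp 2))
  have h6 := (Measure.measurePreserving_neg (volume : Measure ℝ)).quasiMeasurePreserving.ae
    ((𝓕 g).coeFn_toLp 2 volume)
  filter_upwards [(𝓕 g').coeFn_toLp 2, reflL2_coe (conjL2 ((𝓕 g).toLp 2)), h5, h6]
    with ξ h2 h3 h5 h6
  rw [h2, h3, h5, h6, SchwartzMap.fourier_coe, SchwartzMap.fourier_coe,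
    Real.fourier_real_eq_integral_exp_smul, Real.fourier_real_eq_integral_exp_smul, ← integral_conj]
  congr 1 with x
  rw [hg', SchwartzMap.postcompCLM_apply, smul_eq_mul, smul_eq_mul, map_mul, ← Complex.exp_conj,
    map_mul, Complex.conj_ofReal, Complex.conj_I]
  have h7 : ((-2 * Real.pi * x * -ξ : ℝ) : ℂ) * -Complex.I
      = ((-2 * Real.pi * x * ξ : ℝ) : ℂ) * Complex.I := by push_cast; ring
  rw [h7]; rfl

theorem fourier_conjL2_coe (f : L2) :
    (𝓕 (conjL2 f) : L2) =ᵐ[volume] fun ξ => starRingEnd ℂ ((𝓕 f : L2) (-ξ)) := by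
  rw [fourier_conjL2]
  have h5 := (Measure.measurePreserving_neg (volume : Measure ℝ)).quasiMeasurePreserving.ae
    (conjL2_coe (𝓕 f))
  filter_upwards [reflL2_coe (conjL2 (𝓕 f)), h5] with ξ h1 h2
  rw [h1, h2]

/-- Conjugation becomes `f̂(ξ) ↦ conj (f̂(-ξ))` on the Fourier side, so Hermitian symbols give
operators that preserve real-valued functions. -/
theorem conjL2_fmul {m : ℝ → ℂ} (hm : MemLp m ⊤ volume)
    (h : ∀ ξ, m (-ξ) = starRingEnd ℂ (m ξ)) (f : L2) :
    conjL2 (fmul m hm f) = fmul m hm (conjL2 f) := by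
  apply fourier_injective
  apply Lp.ext
  have h5 := (Measure.measurePreserving_neg (volume : Measure ℝ)).quasiMeasurePreserving.ae
    (fourier_fmul_coe hm f)
  filter_upwards [fourier_conjL2_coe (fmul m hm f), h5, fourier_fmul_coe hm (conjL2 f),
    fourier_conjL2_coe f] with ξ h1 h2 h3 h4
  rw [h1, h2, h3, h4, map_mul, h, Complex.conj_conj]

end Multipliers

end FKdV

namespace FKdV

/-! ### The Fourier integral on `L¹ ∩ L²`, and Hilbert–Schmidt type operators. -/

section Compactness

open Filter Topology
open scoped InnerProductSpace

theorem continuous_fourier_of_integrable {f : ℝ → ℂ} (hf : Integrable f) : Continuous (𝓕 f) :=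
  VectorFourier.fourierIntegral_continuous Real.continuous_fourierChar
      (L := innerₗ ℝ) (by simpa using! continuous_inner) hf

theorem continuous_fourierInv_of_integrable {f : ℝ → ℂ} (hf : Integrable f) :
    Continuous (𝓕⁻ f) :=
  VectorFourier.fourierIntegral_continuous Real.continuous_fourierChar
      (L := -innerₗ ℝ) (by simpa using! continuous_inner.neg) hf

/-- On `L¹ ∩ L²` the Fourier transform is given by the integral. -/
theorem fourier_ae_eq_of_integrable {f : L2} (hf : Integrable f) :
    (𝓕 f : L2) =ᵐ[volume] 𝓕 (f : ℝ → ℂ) := by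
  apply ae_eq_of_integral_contDiff_smul_eq
      ((Lp.memLp (𝓕 f : L2)).locallyIntegrable (by norm_num))
      (continuous_fourier_of_integrable hf).locallyIntegrable
  intro g g_smooth g_cpt
  have hg₁ : HasCompactSupport (Complex.ofRealCLM ∘ g) := g_cpt.comp_left rfl
  have hg₂ : ContDiff ℝ ∞ (Complex.ofRealCLM ∘ g) := by fun_prop
  set G : 𝓢(ℝ, ℂ) := hg₁.toSchwartzMap hg₂
  have h1 := congrArg (fun T : 𝓢'(ℝ, ℂ) => T G) (Lp.fourier_toTemperedDistribution_eq f)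
  simp only [TemperedDistribution.fourier_apply, Lp.toTemperedDistribution_apply] at h1
  have h3 := VectorFourier.integral_fourierIntegral_smul_eq_flip (L := innerₗ ℝ)
    (f := G) (g := f) (μ := volume) (ν := volume) Real.continuous_fourierChar
    (by simpa using! continuous_inner) G.integrable hf
  rw [flip_innerₗ] at h3
  have h5 : ∫ x, G x • (𝓕 f : L2) x = ∫ x, G x • 𝓕 (f : ℝ → ℂ) x := by
    rw [← h1, SchwartzMap.fourier_coe]
    exact h3
  simpa [G] using h5

/-- On `L¹ ∩ L²` the inverse Fourier transform is given by the integral. -/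
theorem fourierInv_ae_eq_of_integrable {f : L2} (hf : Integrable f) :
    (𝓕⁻ f : L2) =ᵐ[volume] 𝓕⁻ (f : ℝ → ℂ) := by
  apply ae_eq_of_integral_contDiff_smul_eq
      ((Lp.memLp (𝓕⁻ f : L2)).locallyIntegrable (by norm_num))
      (continuous_fourierInv_of_integrable hf).locallyIntegrable
  intro g g_smooth g_cpt
  have hg₁ : HasCompactSupport (Complex.ofRealCLM ∘ g) := g_cpt.comp_left rfl
  have hg₂ : ContDiff ℝ ∞ (Complex.ofRealCLM ∘ g) := by fun_prop
  set G : 𝓢(ℝ, ℂ) := hg₁.toSchwartzMap hg₂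
  have h1 := congrArg (fun T : 𝓢'(ℝ, ℂ) => T G) (Lp.fourierInv_toTemperedDistribution_eq f)
  simp only [TemperedDistribution.fourierInv_apply, Lp.toTemperedDistribution_apply] at h1
  have h3 := VectorFourier.integral_fourierIntegral_smul_eq_flip (L := -innerₗ ℝ)
    (f := G) (g := f) (μ := volume) (ν := volume) Real.continuous_fourierChar
    (by simpa using! continuous_inner.neg) G.integrable hf
  have h4 : ((-innerₗ ℝ : ℝ →ₗ[ℝ] ℝ →ₗ[ℝ] ℝ)).flip = -innerₗ ℝ := by
    ext; simp
  rw [h4] at h3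
  have h5 : ∫ x, G x • (𝓕⁻ f : L2) x = ∫ x, G x • 𝓕⁻ (f : ℝ → ℂ) x := by
    rw [← h1, SchwartzMap.fourierInv_coe]
    exact h3
  simpa [G] using h5

/-- The operator `u ↦ (ξ ↦ k(ξ) u)` for a square integrable family `k` of functionals. -/
noncomputable def hsOp (k : Lp (L2 →L[ℂ] ℂ) 2 (volume : Measure ℝ)) : L2 →L[ℂ] L2 :=
  (ContinuousLinearMap.compLpL₂ 2 volume (ContinuousLinearMap.apply ℂ ℂ (E := L2))).flip k

theorem hsOp_coe (k : Lp (L2 →L[ℂ] ℂ) 2 (volume : Measure ℝ)) (u : L2) :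
    hsOp k u =ᵐ[volume] fun ξ => k ξ u :=
  ContinuousLinearMap.coeFn_compLp (ContinuousLinearMap.apply ℂ ℂ (E := L2) u) k

/-- Indicator kernels give operators of rank at most one. Their sums are dense among the kernels,
`hsOp` is continuous in `k`, and compact operators form a closed set. -/
theorem hsOp_isCompact (k : Lp (L2 →L[ℂ] ℂ) 2 (volume : Measure ℝ)) :
    IsCompactOperator (hsOp k) := by
  refine Lp.induction (by norm_num) (motive := fun k => IsCompactOperator (hsOp k)) ?_ ?_ ?_ k
  · intro c s hs hμs
    rw [Lp.simpleFunc.coe_indicatorConst]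
    have h1 : hsOp (indicatorConstLp 2 hs hμs.ne c) =
        c.smulRight (indicatorConstLp 2 hs hμs.ne (1 : ℂ)) := by
      ext1 u
      apply Lp.ext
      filter_upwards [hsOp_coe (indicatorConstLp 2 hs hμs.ne c) u,
        indicatorConstLp_coeFn (hs := hs) (hμs := hμs.ne) (c := c) (p := 2),
        indicatorConstLp_coeFn (hs := hs) (hμs := hμs.ne) (c := (1 : ℂ)) (p := 2),
        Lp.coeFn_smul (c u) (indicatorConstLp 2 hs hμs.ne (1 : ℂ))] with x h1 h2 h3 h4
      rw [h1, h2, ContinuousLinearMap.smulRight_apply, h4, Pi.smul_apply, h3]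
      by_cases hx : x ∈ s <;> simp [hx]
    rw [h1]
    have h2 : IsCompactOperator c := isCompactOperator_of_locallyCompactSpace_dom c
    exact h2.clm_comp ((ContinuousLinearMap.id ℂ ℂ).smulRight (indicatorConstLp 2 hs hμs.ne (1 : ℂ)))
  · intro f g hf hg _ h1 h2
    have : hsOp (hf.toLp f + hg.toLp g) = hsOp (hf.toLp f) + hsOp (hg.toLp g) := by
      simp [hsOp]
    rw [this]
    exact h1.add h2
  · have hc : Continuous hsOp := ContinuousLinearMap.continuous _
    exact isClosed_setOfPred_isCompactOperator.preimage hc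

end Compactness

end FKdV

namespace FKdV

/-! ### The multipliers `(D^α + c - l ∂ₓ⁻¹)⁻¹`. -/

section Resolvents

open Filter Topology
open scoped InnerProductSpace

/-- The symbol of `D^α + c`. -/
noncomputable def psym (α c ξ : ℝ) : ℝ := |2 * Real.pi * ξ| ^ α + c

/-- The symbol of `(D^α + c - l ∂ₓ⁻¹)⁻¹`. -/
noncomputable def rsym (α c l ξ : ℝ) : ℂ :=
  ((psym α c ξ : ℂ) + ((l / (2 * Real.pi * ξ) : ℝ) : ℂ) * Complex.I)⁻¹

variable {α c : ℝ}

theorem le_psym (ξ : ℝ) : c ≤ psym α c ξ := by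
  have : 0 ≤ |2 * Real.pi * ξ| ^ α := by positivity
  rw [psym]; linarith

theorem psym_pos (hc : 0 < c) (ξ : ℝ) : 0 < psym α c ξ := hc.trans_le (le_psym ξ)

theorem psym_neg (ξ : ℝ) : psym α c (-ξ) = psym α c ξ := by
  rw [psym, psym, mul_neg, abs_neg]

theorem measurable_psym : Measurable (psym α c) := by unfold psym; fun_prop

theorem measurable_rsym (l : ℝ) : Measurable (rsym α c l) := by
  have := measurable_psym (α := α) (c := c)
  unfold rsym; fun_prop

theorem rsym_denom_norm (l ξ : ℝ) :
    |psym α c ξ| ≤ ‖(psym α c ξ : ℂ) + ((l / (2 * Real.pi * ξ) : ℝ) : ℂ) * Complex.I‖ ∧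
    |l / (2 * Real.pi * ξ)| ≤
      ‖(psym α c ξ : ℂ) + ((l / (2 * Real.pi * ξ) : ℝ) : ℂ) * Complex.I‖ := by
  set z := (psym α c ξ : ℂ) + ((l / (2 * Real.pi * ξ) : ℝ) : ℂ) * Complex.I with hz
  have h1 : z.re = psym α c ξ := by
    rw [hz, Complex.add_re, Complex.re_ofReal_mul]; simp
  have h2 : z.im = l / (2 * Real.pi * ξ) := by
    rw [hz, Complex.add_im, Complex.im_ofReal_mul]; simp
  rw [← h2, ← h1]
  exact ⟨Complex.abs_re_le_norm z, Complex.abs_im_le_norm z⟩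

theorem rsym_denom_ne_zero (hc : 0 < c) (l ξ : ℝ) :
    (psym α c ξ : ℂ) + ((l / (2 * Real.pi * ξ) : ℝ) : ℂ) * Complex.I ≠ 0 := by
  have h := (rsym_denom_norm (α := α) (c := c) l ξ).1
  rw [abs_of_pos (psym_pos hc ξ)] at h
  exact norm_pos_iff.1 ((psym_pos hc ξ).trans_le h)

theorem norm_psym_mul_rsym_le (hc : 0 < c) (l ξ : ℝ) : ‖(psym α c ξ : ℂ) * rsym α c l ξ‖ ≤ 1 := by
  have h := (rsym_denom_norm (α := α) (c := c) l ξ).1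
  rw [abs_of_pos (psym_pos hc ξ)] at h
  rw [rsym, norm_mul, norm_inv, Complex.norm_real, Real.norm_of_nonneg (psym_pos hc ξ).le,
    ← div_eq_mul_inv]
  exact div_le_one_of_le₀ h (norm_nonneg _)

theorem norm_rsym_le (hc : 0 < c) (l ξ : ℝ) : ‖rsym α c l ξ‖ ≤ (psym α c ξ)⁻¹ := by
  have h := norm_psym_mul_rsym_le (α := α) hc l ξ
  rw [norm_mul, Complex.norm_real, Real.norm_of_nonneg (psym_pos hc ξ).le] at h
  rw [← one_div, le_div_iff₀ (psym_pos hc ξ)]; linarith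

theorem norm_rsym_le' (hc : 0 < c) (l ξ : ℝ) : ‖rsym α c l ξ‖ ≤ c⁻¹ :=
  (norm_rsym_le hc l ξ).trans (by have := le_psym (α := α) (c := c) ξ; gcongr)

theorem rsym_zero (ξ : ℝ) : rsym α c 0 ξ = ((psym α c ξ)⁻¹ : ℝ) := by
  rw [rsym]; simp

theorem rsym_neg (l ξ : ℝ) : rsym α c l (-ξ) = starRingEnd ℂ (rsym α c l ξ) := by
  rw [rsym, rsym, psym_neg, map_inv₀, map_add, map_mul, Complex.conj_ofReal, Complex.conj_ofReal,
    Complex.conj_I, mul_neg, div_neg]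
  push_cast; ring_nf

theorem rsym_neg_param (l ξ : ℝ) : rsym α c (-l) ξ = starRingEnd ℂ (rsym α c l ξ) := by
  rw [rsym, rsym, map_inv₀, map_add, map_mul, Complex.conj_ofReal, Complex.conj_ofReal,
    Complex.conj_I, neg_div]
  push_cast; ring_nf

theorem memLp_rsym (hc : 0 < c) (l : ℝ) : MemLp (rsym α c l) ⊤ volume :=
  memLp_top_of_bound (measurable_rsym l).aestronglyMeasurable c⁻¹
    (Eventually.of_forall (norm_rsym_le' hc l))

/-- The bounded operators `(D^α + c - l ∂ₓ⁻¹)⁻¹`. -/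
noncomputable def resL (α : ℝ) {c : ℝ} (hc : 0 < c) (l : ℝ) : L2 →L[ℂ] L2 :=
  fmul (rsym α c l) (memLp_rsym hc l)

/-- From `Re (1 / z) = Re z / |z|²` with `Re z = psym`: the skew part enters the quadratic form only
through `|psym * rsym|²`, which is what `factor` requires. -/
theorem rsym_re (hc : 0 < c) (l ξ : ℝ) :
    (rsym α c l ξ).re = (rsym α c 0 ξ).re * ‖(psym α c ξ : ℂ) * rsym α c l ξ‖ ^ 2 := by
  have hp := (psym_pos (α := α) hc ξ).ne'
  rw [rsym_zero, Complex.ofReal_re, norm_mul, Complex.norm_real, mul_pow, Real.norm_eq_abs, sq_abs,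
    rsym, norm_inv, Complex.inv_re, inv_pow, Complex.normSq_eq_norm_sq, Complex.add_re,
    Complex.re_ofReal_mul]
  simp only [Complex.ofReal_re, Complex.I_re, mul_zero, add_zero]
  field_simp

theorem resL_family (hc : 0 < c) : IsComplexResolventFamily conjL2 (resL α hc) where
  adj l f g := inner_fmul _ _ (Eventually.of_forall fun ξ => rsym_neg_param l ξ) f g
  map_conj l f := conjL2_fmul _ (rsym_neg l) f
  factor l h hh := by
    -- This symbol defines `h' = (Y 0)⁻¹ (Y l h)`; it is bounded by `1` although `psym` is
    -- unbounded.
    have hz : MemLp (fun ξ => (psym α c ξ : ℂ) * rsym α c l ξ) ⊤ volume :=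
      memLp_top_of_bound
        ((Complex.measurable_ofReal.comp measurable_psym).mul
          (measurable_rsym l)).aestronglyMeasurable 1
        (Eventually.of_forall (norm_psym_mul_rsym_le hc l))
    refine ⟨fmul _ hz h, ?_, ?_, ?_⟩
    · rw [conjL2_fmul hz ?_, hh]
      intro ξ
      rw [psym_neg, rsym_neg, map_mul, Complex.conj_ofReal]
    · apply fourier_injective
      apply Lp.ext
      filter_upwards [fourier_fmul_coe (memLp_rsym (α := α) hc l) h,
        fourier_fmul_coe (memLp_rsym (α := α) hc 0) (fmul _ hz h), fourier_fmul_coe hz h]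
        with ξ h1 h2 h3
      rw [resL, resL, h1, h2, h3, rsym_zero]
      have : (psym α c ξ : ℂ) ≠ 0 := by exact_mod_cast (psym_pos hc ξ).ne'
      push_cast
      field_simp
    · rw [resL, resL, re_inner_fmul, re_inner_fmul]
      refine integral_congr_ae ?_
      filter_upwards [fourier_fmul_coe hz h] with ξ h1
      rw [h1, norm_mul, mul_pow, rsym_re hc l]; ring
  nonneg h := by
    rw [resL, re_inner_fmul]
    refine integral_nonneg fun ξ => ?_
    rw [rsym_zero, Complex.ofReal_re]
    have := psym_pos (α := α) hc ξ
    positivity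
  cont g := by
    rw [continuous_iff_continuousAt]
    intro l₀
    refine fmul_tendsto (fun l => memLp_rsym hc l) (memLp_rsym hc l₀) (norm_rsym_le' hc)
      (norm_rsym_le' hc l₀) (Eventually.of_forall fun ξ => ?_) g
    have : Continuous fun l => rsym α c l ξ := by
      unfold rsym
      refine Continuous.inv₀ (by fun_prop) fun l => rsym_denom_ne_zero hc l ξ
    exact this.tendsto l₀
  lim g := by
    have h0 : MemLp (fun _ : ℝ => (0 : ℂ)) ⊤ volume := memLp_top_const 0
    have h1 : fmul _ h0 g = 0 := by
      apply fourier_injective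
      apply Lp.ext
      have h2 : (𝓕 (0 : L2) : L2) = 0 := fourierL.map_zero
      rw [h2]
      filter_upwards [fourier_fmul_coe h0 g, Lp.coeFn_zero ℂ 2 (volume : Measure ℝ)] with ξ h3 h4
      rw [h3, h4]; simp
    rw [← h1]
    refine fmul_tendsto (fun l => memLp_rsym hc l) h0 (norm_rsym_le' hc)
      (fun x => by simpa using hc.le) ?_ g
    -- At `ξ = 0` the convention `l / 0 = 0` makes the symbol independent of `l`; this point is
    -- negligible.
    filter_upwards [Measure.ae_ne volume (0 : ℝ)] with ξ hξ
    have hk : 0 < |2 * Real.pi * ξ| := by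
      rw [abs_pos]; exact mul_ne_zero (by positivity) hξ
    refine squeeze_zero_norm' (a := fun l => |2 * Real.pi * ξ| / l) ?_
      (tendsto_const_nhds.div_atTop tendsto_id)
    filter_upwards [eventually_gt_atTop 0] with l hl
    have h2 := (rsym_denom_norm (α := α) (c := c) l ξ).2
    rw [abs_div, abs_of_pos hl] at h2
    rw [rsym, norm_inv, ← inv_div l |2 * Real.pi * ξ|]
    exact inv_anti₀ (by positivity) h2

end Resolvents

end FKdV

namespace FKdV

/-! ### Compactness of `(D^α + c)⁻¹ φ`. -/

section CompactResolvent

open Filter Topology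
open scoped InnerProductSpace

/-- The character `x ↦ exp (2πi x ξ)`. -/
noncomputable def character (ξ x : ℝ) : ℂ := Complex.exp (((2 * Real.pi * x * ξ : ℝ) : ℂ) * Complex.I)

theorem norm_character (ξ x : ℝ) : ‖character ξ x‖ = 1 := Complex.norm_exp_ofReal_mul_I _

theorem memLp_character (ξ : ℝ) : MemLp (character ξ) ⊤ volume := by
  have h1 : Continuous (character ξ) := by unfold character; fun_prop
  exact memLp_top_of_bound h1.aestronglyMeasurable 1
    (Eventually.of_forall fun x => (norm_character ξ x).le)

theorem continuous_character_bmul (f : L2) :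
    Continuous fun ξ => bmul (character ξ) (memLp_character ξ) f := by
  rw [continuous_iff_continuousAt]
  intro ξ₀
  refine bmul_tendsto (fun l => memLp_character l) (memLp_character ξ₀) (C := 1)
    (fun ξ x => (norm_character ξ x).le) (fun x => (norm_character ξ₀ x).le)
    (Eventually.of_forall fun x => ?_) f
  have : Continuous fun ξ => character ξ x := by unfold character; fun_prop
  exact this.tendsto ξ₀

theorem norm_character_bmul_le (ξ : ℝ) (f : L2) :
    ‖bmul (character ξ) (memLp_character ξ) f‖ ≤ ‖f‖ := by
  have h1 := norm_bmul_le (memLp_character ξ) zero_le_one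
    (Eventually.of_forall fun x => (norm_character ξ x).le)
  exact (ContinuousLinearMap.le_of_opNorm_le _ h1 f).trans (by rw [one_mul])

theorem integrable_bmul {φ : L2} (hφ : MemLp φ ⊤ volume) (u : L2) :
    Integrable (bmul φ hφ u) := by
  have h1 : Integrable fun x => φ x * u x := (Lp.memLp φ).integrable_mul (Lp.memLp u)
  exact h1.congr (bmul_coe hφ u).symm

/-- The Fourier transform of a product. -/
theorem fourier_bmul_eq_inner {φ : L2} (hφ : MemLp φ ⊤ volume) (u : L2) :
    (𝓕 (bmul φ hφ u) : L2) =ᵐ[volume]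
      fun ξ => ⟪bmul (character ξ) (memLp_character ξ) (conjL2 φ), u⟫_ℂ := by
  filter_upwards [fourier_ae_eq_of_integrable (integrable_bmul hφ u)] with ξ hξ
  rw [hξ, Real.fourier_real_eq_integral_exp_smul, MeasureTheory.L2.inner_def]
  refine integral_congr_ae ?_
  filter_upwards [bmul_coe hφ u, bmul_coe (memLp_character ξ) (conjL2 φ), conjL2_coe φ]
    with x h1 h2 h3
  rw [h1, RCLike.inner_apply, h2, h3, map_mul, Complex.conj_conj, character, ← Complex.exp_conj,
    map_mul, Complex.conj_ofReal, Complex.conj_I, smul_eq_mul]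
  have h4 : ((-2 * Real.pi * x * ξ : ℝ) : ℂ) * Complex.I
      = ((2 * Real.pi * x * ξ : ℝ) : ℂ) * -Complex.I := by push_cast; ring
  rw [h4]; ring

theorem memLp_indicator_one (R : ℝ) :
    MemLp (Set.indicator (Set.Icc (-R) R) fun _ => (1 : ℂ)) ⊤ volume :=
  memLp_top_of_bound
    ((measurable_const.indicator measurableSet_Icc).aestronglyMeasurable) 1
    (Eventually.of_forall fun x => by
      rw [Set.indicator_apply]; split_ifs <;> simp)

/-- Frequency truncations of a multiplication operator are compact. -/
theorem isCompact_truncated_bmul {φ : L2} (hφ : MemLp φ ⊤ volume) (R : ℝ) :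
    IsCompactOperator (bmul _ (memLp_indicator_one R) ∘L fourierL ∘L bmul φ hφ) := by
  set k₀ : ℝ → (L2 →L[ℂ] ℂ) := fun ξ =>
    innerSL ℂ (bmul (character ξ) (memLp_character ξ) (conjL2 φ)) with hk₀
  have hk₀c : Continuous k₀ :=
    (innerSL ℂ (E := L2)).continuous.comp (continuous_character_bmul _)
  set k₁ : ℝ → (L2 →L[ℂ] ℂ) := (Set.Icc (-R) R).indicator k₀ with hk₁
  -- The functional at frequency `ξ` has norm at most `‖conjL2 φ‖`, which is square integrable over
  -- the bounded window.
  have hk : MemLp k₁ 2 volume := by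
    have h1 : MemLp ((Set.Icc (-R) R).indicator fun _ => (‖conjL2 φ‖ : ℝ)) 2 volume :=
      memLp_indicator_const 2 measurableSet_Icc _ (Or.inr measure_Icc_lt_top.ne)
    refine h1.of_le (hk₀c.stronglyMeasurable.aestronglyMeasurable.indicator measurableSet_Icc)
      (Eventually.of_forall fun ξ => ?_)
    rw [hk₁, Set.indicator_apply, Set.indicator_apply]
    split_ifs
    · rw [hk₀, innerSL_apply_norm, norm_norm]
      exact norm_character_bmul_le ξ _
    · simp
  have h1 : bmul _ (memLp_indicator_one R) ∘L fourierL ∘L bmul φ hφ = hsOp (hk.toLp k₁) := by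
    ext1 u
    apply Lp.ext
    filter_upwards [hsOp_coe (hk.toLp k₁) u, hk.coeFn_toLp, fourier_bmul_eq_inner hφ u,
      bmul_coe (memLp_indicator_one R) (𝓕 (bmul φ hφ u))] with ξ h1 h2 h3 h4
    rw [h1, h2]
    change (bmul _ (memLp_indicator_one R) (𝓕 (bmul φ hφ u))) ξ = _
    rw [h4, h3, hk₁, Set.indicator_apply, Set.indicator_apply]
    split_ifs
    · rw [one_mul, hk₀, innerSL_apply_apply]
    · simp
  rw [h1]
  exact hsOp_isCompact _

/-- Cutting off the frequencies `|ξ| > n` changes the multiplier by at most `(psym α c n)⁻¹`, which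
tends to `0` as `α > 0`; the operator is thus a norm limit of compact ones. -/
theorem resL_mul_isCompact {α c : ℝ} (hα : 0 < α) (hc : 0 < c) {φ : L2} (hφ : MemLp φ ⊤ volume) :
    IsCompactOperator (resL α hc 0 * bmul φ hφ) := by
  set K := bmul (rsym α c 0) (memLp_rsym hc 0) with hK
  set ind : ℕ → (L2 →L[ℂ] L2) := fun n => bmul _ (memLp_indicator_one (n : ℝ)) with hind
  have hnorm : ∀ n : ℕ, ‖K ∘L ind n - K‖ ≤ (psym α c n)⁻¹ := by
    intro n
    have hp := psym_pos (α := α) hc n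
    refine ContinuousLinearMap.opNorm_le_bound _ (by positivity) fun f => ?_
    refine Lp.norm_le_mul_norm_of_ae_le_mul ?_
    have h5 : (K ∘L ind n - K) f = K (ind n f) - K f := rfl
    rw [h5]
    filter_upwards [Lp.coeFn_sub (K (ind n f)) (K f), bmul_coe (memLp_rsym (α := α) hc 0) f,
      bmul_coe (memLp_rsym (α := α) hc 0) (ind n f),
      bmul_coe (memLp_indicator_one (n : ℝ)) f] with ξ h1 h2 h3 h4
    rw [h1, Pi.sub_apply, hK, h2, h3, hind, h4, Set.indicator_apply]
    split_ifs with h6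
    · simp; positivity
    · rw [zero_mul, mul_zero, zero_sub, norm_neg, norm_mul]
      gcongr
      refine (norm_rsym_le hc 0 ξ).trans ?_
      gcongr
      have h7 : (n : ℝ) ≤ |ξ| := by
        rw [Set.mem_Icc, ← abs_le] at h6
        exact (not_le.1 h6).le
      have h8 : |2 * Real.pi * (n : ℝ)| ≤ |2 * Real.pi * ξ| := by
        rw [abs_mul, abs_mul _ ξ, abs_of_nonneg (by positivity : (0 : ℝ) ≤ n)]
        gcongr
      unfold psym
      gcongr
  have hlim : Tendsto (fun n : ℕ => K ∘L ind n) atTop (𝓝 K) := by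
    refine tendsto_iff_norm_sub_tendsto_zero.2 (squeeze_zero (fun _ => norm_nonneg _) hnorm ?_)
    refine Tendsto.inv_tendsto_atTop ?_
    have h1 : Tendsto (fun n : ℕ => |2 * Real.pi * (n : ℝ)|) atTop atTop := by
      refine tendsto_abs_atTop_atTop.comp ?_
      exact tendsto_natCast_atTop_atTop.const_mul_atTop (by positivity)
    exact tendsto_atTop_add_const_right _ _ ((tendsto_rpow_atTop hα).comp h1)
  have h1 : resL α hc 0 * bmul φ hφ = fourierInvL ∘L K ∘L fourierL ∘L bmul φ hφ := rfl
  rw [h1]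
  have h2 : IsCompactOperator (K ∘L fourierL ∘L bmul φ hφ) := by
    have h3 : Tendsto (fun n : ℕ => (K ∘L ind n) ∘L (fourierL ∘L bmul φ hφ)) atTop
        (𝓝 (K ∘L fourierL ∘L bmul φ hφ)) :=
      ((ContinuousLinearMap.precomp L2 (fourierL ∘L bmul φ hφ)).continuous.tendsto K).comp hlim
    refine isCompactOperator_of_tendsto h3 (Eventually.of_forall fun n => ?_)
    exact (isCompact_truncated_bmul hφ n).clm_comp K
  exact h2.clm_comp fourierInvL

end CompactResolvent

end FKdV

namespace FKdV

/-! ### Distributional derivative, `D^α` and `L_c` in terms of bounded multipliers. -/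

section OperatorsOnFourierSide

open Filter Topology LineDeriv

theorem smulLeft_eq_iff {w : ℝ → ℂ} (hw : w.HasTemperateGrowth) (f g : L2) :
    smulLeftCLM ℂ w (f : 𝓢'(ℝ, ℂ)) = (g : 𝓢'(ℝ, ℂ)) ↔ (fun ξ : ℝ => w ξ * f ξ) =ᵐ[volume] g := by
  have hwc : Continuous w := hw.1.continuous
  have hloc : LocallyIntegrable (fun ξ : ℝ => w ξ * f ξ) volume :=
    ((Lp.memLp f).locallyIntegrable (by norm_num)).continuous_mul hwc
  have hval : ∀ u : 𝓢(ℝ, ℂ), smulLeftCLM ℂ w (f : 𝓢'(ℝ, ℂ)) u = ∫ ξ, u ξ • (w ξ * f ξ) := by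
    intro u
    rw [smulLeftCLM_apply_apply, Lp.toTemperedDistribution_apply]
    congr 1 with ξ
    rw [SchwartzMap.smulLeftCLM_apply_apply hw]
    simp only [smul_eq_mul]
    ring
  constructor
  · intro h
    apply ae_eq_of_integral_contDiff_smul_eq hloc ((Lp.memLp g).locallyIntegrable (by norm_num))
    intro u u_smooth u_cpt
    have hu₁ : HasCompactSupport (Complex.ofRealCLM ∘ u) := u_cpt.comp_left rfl
    have hu₂ : ContDiff ℝ ∞ (Complex.ofRealCLM ∘ u) := by fun_prop
    have := congrArg (fun T : 𝓢'(ℝ, ℂ) => T (hu₁.toSchwartzMap hu₂)) h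
    simp only [hval, Lp.toTemperedDistribution_apply] at this
    simpa using this
  · intro h
    ext u
    rw [hval, Lp.toTemperedDistribution_apply]
    apply integral_congr_ae
    filter_upwards [h] with x hx
    rw [← hx]

theorem fourier_distribution_injective {S T : 𝓢'(ℝ, ℂ)} (h : 𝓕 S = 𝓕 T) : S = T := by
  rw [← fourierInv_fourier_eq (F := 𝓢'(ℝ, ℂ)) S, h, fourierInv_fourier_eq]

theorem besselPotential_eq_iff (s : ℝ) (f g : L2) :
    besselPotential ℝ ℂ s (f : 𝓢'(ℝ, ℂ)) = (g : 𝓢'(ℝ, ℂ)) ↔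
      (fun ξ : ℝ => (((1 + ‖ξ‖ ^ 2) ^ (s / 2) : ℝ) : ℂ) * (𝓕 f : L2) ξ) =ᵐ[volume] (𝓕 g : L2) := by
  rw [← smulLeft_eq_iff (by fun_prop), ← Lp.fourier_toTemperedDistribution_eq,
    ← Lp.fourier_toTemperedDistribution_eq, ← fourier_besselPotential_eq_smulLeftCLM_fourier_apply]
  exact ⟨fun h => by rw [h], fun h => fourier_distribution_injective h⟩

theorem derivCLM_eq_lineDerivOp (T : 𝓢'(ℝ, ℂ)) : derivCLM ℂ T = ∂_{(1 : ℝ)} T := by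
  ext u
  rw [derivCLM_apply_apply, TemperedDistribution.lineDerivOp_apply_apply, map_neg, map_neg]
  congr 2

theorem ddx_eq_iff (f g : L2) :
    (g : 𝓢'(ℝ, ℂ)) = ddx f ↔
      (𝓕 g : L2) =ᵐ[volume] fun ξ : ℝ => (((2 * Real.pi * ξ : ℝ) : ℂ) * Complex.I) * (𝓕 f : L2) ξ := by
  have h1 : 𝓕 (ddx f) = smulLeftCLM ℂ (fun ξ : ℝ => ((2 * Real.pi * ξ : ℝ) : ℂ) * Complex.I)
      ((𝓕 f : L2) : 𝓢'(ℝ, ℂ)) := by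
    rw [ddx, derivCLM_eq_lineDerivOp, TemperedDistribution.fourier_lineDerivOp_eq,
      Lp.fourier_toTemperedDistribution_eq]
    ext u
    rw [smul_apply, smulLeftCLM_apply_apply, smulLeftCLM_apply_apply, ← map_smul]
    congr 1
    ext x
    rw [smul_apply, SchwartzMap.smulLeftCLM_apply_apply (by fun_prop),
      SchwartzMap.smulLeftCLM_apply_apply (by fun_prop)]
    simp
    ring
  have h2 : (g : 𝓢'(ℝ, ℂ)) = ddx f ↔
      smulLeftCLM ℂ (fun ξ : ℝ => ((2 * Real.pi * ξ : ℝ) : ℂ) * Complex.I)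
        ((𝓕 f : L2) : 𝓢'(ℝ, ℂ)) = ((𝓕 g : L2) : 𝓢'(ℝ, ℂ)) := by
    rw [← h1, ← Lp.fourier_toTemperedDistribution_eq]
    exact ⟨fun h => by rw [h], fun h => (fourier_distribution_injective h).symm⟩
  rw [h2, smulLeft_eq_iff (by fun_prop)]
  exact ⟨fun h => h.symm, fun h => h.symm⟩

theorem mem_mulOp_domain {φ : L2} (hφ : MemLp φ ⊤ volume) (u : L2) : u ∈ (mulOp φ).domain :=
  (Lp.memLp (bmul φ hφ u)).ae_eq (bmul_coe hφ u)

theorem mulOp_eq_bmul {φ : L2} (hφ : MemLp φ ⊤ volume) (u : (mulOp φ).domain) :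
    mulOp φ u = bmul φ hφ u := by
  apply Lp.ext
  filter_upwards [MemLp.coeFn_toLp u.2, bmul_coe hφ u] with x h1 h2
  rw [h2]; exact h1

theorem fourier_fracD_coe {α : ℝ} (u : (fracD α).domain) :
    (𝓕 (fracD α u) : L2) =ᵐ[volume]
      fun ξ => ((|2 * Real.pi * ξ| ^ α : ℝ) : ℂ) * (𝓕 (u : L2) : L2) ξ := by
  have h1 : (𝓕 (fracD α u) : L2) = mulOp (fun ξ => ((|2 * Real.pi * ξ| ^ α : ℝ) : ℂ))
      ⟨𝓕 (u : L2), u.2⟩ := (Lp.fourierTransformₗᵢ ℝ ℂ).apply_symm_apply _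
  have h2 : MemLp (fun ξ => ((|2 * Real.pi * ξ| ^ α : ℝ) : ℂ) * (𝓕 (u : L2) : L2) ξ) 2 volume := u.2
  rw [h1]
  exact h2.coeFn_toLp

theorem coeFn_add_smul (f g : L2) (a : ℂ) :
    (f + a • g : L2) =ᵐ[volume] fun x => f x + a * g x := by
  filter_upwards [Lp.coeFn_add f (a • g), Lp.coeFn_smul a g] with x h1 h2
  rw [h1, Pi.add_apply, h2, Pi.smul_apply, smul_eq_mul]

theorem fourier_add_smul (f g : L2) (a : ℂ) : 𝓕 (f + a • g) = 𝓕 f + a • 𝓕 g :=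
  (fourierL.map_add f (a • g)).trans (by rw [map_smul]; rfl)

/-- `D^α x + c x = g` in terms of the bounded inverse of `D^α + c`. -/
theorem fracD_add_eq_iff {α c : ℝ} (hc : 0 < c) (x g : L2) :
    (∃ h : x ∈ (fracD α).domain, fracD α ⟨x, h⟩ + (c : ℂ) • x = g) ↔ x = resL α hc 0 g := by
  constructor
  · rintro ⟨h, rfl⟩
    apply fourier_injective
    apply Lp.ext
    filter_upwards [fourier_fmul_coe (memLp_rsym (α := α) hc 0) (fracD α ⟨x, h⟩ + (c : ℂ) • x),
      fourier_fracD_coe ⟨x, h⟩, coeFn_add_smul (𝓕 (fracD α ⟨x, h⟩)) (𝓕 x) (c : ℂ)] with ξ h1 h2 h3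
    rw [resL, h1, fourier_add_smul, h3, h2, rsym_zero, ← add_mul, ← mul_assoc]
    have h4 : (((psym α c ξ)⁻¹ : ℝ) : ℂ) * (((|2 * Real.pi * ξ| ^ α : ℝ) : ℂ) + (c : ℂ)) = 1 := by
      rw [← Complex.ofReal_add, ← Complex.ofReal_mul]
      change ((((psym α c ξ)⁻¹ * psym α c ξ : ℝ)) : ℂ) = 1
      rw [inv_mul_cancel₀ (psym_pos hc ξ).ne', Complex.ofReal_one]
    rw [h4, one_mul]
  · intro h
    have h1 : (𝓕 (g + (-c : ℂ) • x) : L2) =ᵐ[volume]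
        fun ξ => ((|2 * Real.pi * ξ| ^ α : ℝ) : ℂ) * (𝓕 x : L2) ξ := by
      have h2 := fourier_fmul_coe (memLp_rsym (α := α) hc 0) g
      change (𝓕 (resL α hc 0 g) : L2) =ᵐ[volume] _ at h2
      rw [← h] at h2
      rw [fourier_add_smul]
      filter_upwards [h2, coeFn_add_smul (𝓕 g) (𝓕 x) (-c : ℂ)] with ξ h2 h3
      rw [h3, h2, rsym_zero]
      have h4 : ((|2 * Real.pi * ξ| ^ α : ℝ) : ℂ) = (psym α c ξ : ℂ) - c := by
        rw [psym]; push_cast; ring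
      have h5 : (psym α c ξ : ℂ) ≠ 0 := by exact_mod_cast (psym_pos hc ξ).ne'
      rw [h4]
      push_cast
      field_simp
      ring
    have h2 : x ∈ (fracD α).domain := (Lp.memLp (𝓕 (g + (-c : ℂ) • x))).ae_eq h1
    refine ⟨h2, ?_⟩
    have h3 : fracD α ⟨x, h2⟩ = g + (-c : ℂ) • x := by
      apply fourier_injective
      apply Lp.ext
      filter_upwards [h1, fourier_fracD_coe ⟨x, h2⟩] with ξ h1 h3
      rw [h1, h3]
    rw [h3]; module

/-- The eigenspaces of `L_c` in terms of bounded operators. -/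
theorem eigenspace_linOp {α c : ℝ} (hc : 0 < c) {φ : L2} (hφ : MemLp φ ⊤ volume) (μ : ℂ) :
    eigenspace (linOp α c φ) μ = fixSpace (resL α hc 0) (bmul φ hφ) μ := by
  ext v
  rw [mem_fixSpace, ← fracD_add_eq_iff hc, eigenspace, Submodule.mem_map]
  constructor
  · rintro ⟨x, hx, rfl⟩
    refine ⟨x.2.1.1, ?_⟩
    have h1 : linOp α c φ x - μ • (x : L2) = 0 := hx
    have h2 : linOp α c φ x = fracD α ⟨x, x.2.1.1⟩ + (c : ℂ) • (x : L2) - mulOp φ ⟨x, x.2.2⟩ := rfl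
    rw [h2, mulOp_eq_bmul hφ] at h1
    have h3 := sub_eq_zero.1 h1
    change fracD α ⟨x, x.2.1.1⟩ + (c : ℂ) • (x : L2) = bmul φ hφ x + μ • (x : L2)
    rw [← h3]; abel
  · rintro ⟨h, hx⟩
    refine ⟨⟨v, ⟨⟨h, trivial⟩, mem_mulOp_domain hφ v⟩⟩, ?_, rfl⟩
    rw [LinearMap.mem_ker]
    change fracD α ⟨v, h⟩ + (c : ℂ) • v - mulOp φ ⟨v, mem_mulOp_domain hφ v⟩ - μ • v = 0
    rw [mulOp_eq_bmul hφ, hx]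
    simp

end OperatorsOnFourierSide

end FKdV

namespace FKdV

/-! ### Relations satisfied by the wave and its derivative, and the return to `∂ₓ L_c`. -/

section SolitaryWave

open Filter Topology
open scoped InnerProductSpace

variable {α c : ℝ} {φ : L2}

theorem memLp_top_of_inH {s : ℝ} (hs : 1 / 2 < s) {f : L2} (hf : InH s f) : MemLp f ⊤ volume := by
  obtain ⟨C, hC⟩ := ae_bounded_of_inH hs hf
  exact memLp_top_of_bound (Lp.memLp f).1 C hC

theorem IsPositiveSolitaryWave.conj_eq (h : IsPositiveSolitaryWave α c φ) : conjL2 φ = φ := by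
  apply Lp.ext
  filter_upwards [conjL2_coe φ, h.pos] with x h1 h2
  obtain ⟨r, -, hr⟩ := h2
  rw [h1, hr, Complex.conj_ofReal]

theorem IsPositiveSolitaryWave.ne_zero (h : IsPositiveSolitaryWave α c φ) : φ ≠ 0 := by
  rintro rfl
  have h1 : ∀ᵐ x : ℝ, False := by
    filter_upwards [h.pos, Lp.coeFn_zero ℂ 2 (volume : Measure ℝ)] with x h2 h3
    obtain ⟨r, hr, hr'⟩ := h2
    rw [h3, Pi.zero_apply] at hr'
    exact hr.ne (by exact_mod_cast hr')
  rw [eventually_false_iff_eq_bot, ae_eq_bot] at h1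
  exact NeZero.ne _ h1

/-- The equation of the solitary wave of speed `b`, inverted with another `c`. -/
theorem IsPositiveSolitaryWave.eq_resL {b : ℝ} (h : IsPositiveSolitaryWave α b φ) (hc : 0 < c)
    (hφ : MemLp φ ⊤ volume) :
    φ = resL α hc 0 ((1 / 2 : ℂ) • bmul φ hφ φ - ((b - c : ℝ) : ℂ) • φ) := by
  rw [← fracD_add_eq_iff hc]
  obtain ⟨h1, h2, h3⟩ := h.eqn
  refine ⟨h1, ?_⟩
  rw [mulOp_eq_bmul hφ] at h3
  have h4 := sub_eq_zero.1 h3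
  rw [← h4]
  push_cast
  module

theorem ae_conj_eq (hreal : conjL2 φ = φ) :
    ∀ᵐ x, φ x = starRingEnd ℂ (φ x) := by
  have := conjL2_coe φ
  rw [hreal] at this
  exact this

/-- The derivative of the wave is in the kernel of `L_c`, and solves the perturbed equations with
a right-hand side. -/
theorem kernel_eq_resL (hc : 0 < c) {g ψ : L2} (hψ : (ψ : 𝓢'(ℝ, ℂ)) = ddx φ)
    (hg : ψ = resL α hc 0 g) (l : ℝ) : ψ = resL α hc l (g - (l : ℂ) • φ) := by
  apply fourier_injective
  apply Lp.ext
  have h0 : (𝓕 ψ : L2) =ᵐ[volume] fun ξ => rsym α c 0 ξ * (𝓕 g : L2) ξ := by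
    have := fourier_fmul_coe (memLp_rsym (α := α) hc 0) g
    change (𝓕 (resL α hc 0 g) : L2) =ᵐ[volume] _ at this
    rwa [← hg] at this
  have h2 : g - (l : ℂ) • φ = g + (-l : ℂ) • φ := by module
  rw [h2]
  have h3 := coeFn_add_smul (𝓕 g) (𝓕 φ) (-l : ℂ)
  rw [← fourier_add_smul] at h3
  filter_upwards [fourier_fmul_coe (memLp_rsym (α := α) hc l) (g + (-l : ℂ) • φ), h0, h3,
    (ddx_eq_iff φ ψ).1 hψ, Measure.ae_ne volume (0 : ℝ)] with ξ h4 h5 h6 h7 hξ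
  rw [resL, h4, h6]
  have h8 : (𝓕 g : L2) ξ = psym α c ξ * (𝓕 ψ : L2) ξ := by
    have h9 : (psym α c ξ : ℂ) ≠ 0 := by exact_mod_cast (psym_pos hc ξ).ne'
    rw [h5, rsym_zero]; push_cast; field_simp
  have hne := rsym_denom_ne_zero (α := α) hc l ξ
  rw [rsym, eq_comm, inv_mul_eq_iff_eq_mul₀ hne, h8, add_mul, h7]
  -- The symbol `i l / k` of `-l ∂ₓ⁻¹` applied to `i k φ̂` gives `-l φ̂`; this is `∂ₓ⁻¹ φ' = φ`.
  have h10 : (((l / (2 * Real.pi * ξ) : ℝ) : ℂ) * Complex.I) *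
      (((2 * Real.pi * ξ : ℝ) : ℂ) * Complex.I * (𝓕 φ : L2) ξ) = -l * (𝓕 φ : L2) ξ := by
    have h11 : ((l / (2 * Real.pi * ξ) : ℝ) : ℂ) * ((2 * Real.pi * ξ : ℝ) : ℂ) = l := by
      rw [← Complex.ofReal_mul, div_mul_cancel₀]
      exact mul_ne_zero (by positivity) hξ
    linear_combination ((𝓕 φ : L2) ξ) * Complex.I ^ 2 * h11 + l * ((𝓕 φ : L2) ξ) * Complex.I_sq
  rw [h10]

/-- The symbol `i k` vanishes only at one point, so `∂ₓ` is injective on `L²`. -/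
theorem ddx_ne_zero {ψ : L2} (hφ0 : φ ≠ 0) (hψ : (ψ : 𝓢'(ℝ, ℂ)) = ddx φ) : ψ ≠ 0 := by
  rintro rfl
  apply hφ0
  apply fourier_injective
  apply Lp.ext
  have h0 : (𝓕 (0 : L2) : L2) = 0 := fourierL.map_zero
  have h1 := (ddx_eq_iff φ 0).1 hψ
  rw [h0] at h1 ⊢
  filter_upwards [h1, Lp.coeFn_zero ℂ 2 (volume : Measure ℝ), Measure.ae_ne volume (0 : ℝ)]
    with ξ h2 h3 h4
  rw [h3] at h2 ⊢
  have h5 : ((2 * Real.pi * ξ : ℝ) : ℂ) * Complex.I ≠ 0 := by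
    refine mul_ne_zero ?_ Complex.I_ne_zero
    exact_mod_cast mul_ne_zero (by positivity) h4
  exact (mul_eq_zero.1 h2.symm).resolve_left h5

theorem conj_ddx {ψ : L2} (hreal : conjL2 φ = φ) (hψ : (ψ : 𝓢'(ℝ, ℂ)) = ddx φ) :
    conjL2 ψ = ψ := by
  have h1 := (ddx_eq_iff φ ψ).1 hψ
  apply fourier_injective
  apply Lp.ext
  have h2 := fourier_conjL2_coe φ
  rw [hreal] at h2
  have h3 := (Measure.measurePreserving_neg (volume : Measure ℝ)).quasiMeasurePreserving.ae h1
  filter_upwards [fourier_conjL2_coe ψ, h1, h2, h3] with ξ h4 h5 h6 h7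
  rw [h4, h7, h5]
  conv_rhs => rw [h6]
  rw [map_mul, map_mul, Complex.conj_ofReal, Complex.conj_I]
  push_cast
  ring

/-- An eigenfunction of the bounded problem solves the eigenvalue problem for `∂ₓ L_c`. -/
theorem exists_fracD_of_resL (hc : 0 < c) {u g : L2} {l : ℝ} (hu : u = resL α hc l g) :
    ∃ (w : L2) (h : u ∈ (fracD α).domain), fracD α ⟨u, h⟩ + (c : ℂ) • u = w ∧
      (((l : ℂ) • u : L2) : 𝓢'(ℝ, ℂ)) = ddx (w - g) := by
  have hz : MemLp (fun ξ => (psym α c ξ : ℂ) * rsym α c l ξ) ⊤ volume :=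
    memLp_top_of_bound
      ((Complex.measurable_ofReal.comp measurable_psym).mul
        (measurable_rsym l)).aestronglyMeasurable 1
      (Eventually.of_forall (norm_psym_mul_rsym_le hc l))
  -- `w = (D^α + c) u`, written as a bounded multiplier of `g`; the remainder `w - g` is `l ∂ₓ⁻¹ u`.
  set w := fmul _ hz g with hw
  have hug := fourier_fmul_coe (memLp_rsym (α := α) hc l) g
  change (𝓕 (resL α hc l g) : L2) =ᵐ[volume] _ at hug
  rw [← hu] at hug
  have hwg := fourier_fmul_coe hz g
  have huw : u = resL α hc 0 w := by
    apply fourier_injective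
    apply Lp.ext
    filter_upwards [hug, hwg, fourier_fmul_coe (memLp_rsym (α := α) hc 0) w] with ξ h1 h2 h3
    rw [resL, h3, h1, hw, h2, rsym_zero]
    have h9 : (psym α c ξ : ℂ) ≠ 0 := by exact_mod_cast (psym_pos hc ξ).ne'
    push_cast; field_simp
  obtain ⟨h, hh⟩ := (fracD_add_eq_iff hc u w).2 huw
  refine ⟨w, h, hh, ?_⟩
  rw [ddx_eq_iff]
  have h2 : w - g = w + (-1 : ℂ) • g := by module
  have h3 := coeFn_add_smul (𝓕 w) (𝓕 g) (-1 : ℂ)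
  rw [← fourier_add_smul, ← h2] at h3
  have h4 : 𝓕 ((l : ℂ) • u) = (l : ℂ) • 𝓕 u := map_smul fourierL (l : ℂ) u
  rw [h4]
  filter_upwards [Lp.coeFn_smul (l : ℂ) (𝓕 u : L2), hug, hwg, h3, Measure.ae_ne volume (0 : ℝ)]
    with ξ h5 h6 h7 h8 hξ
  rw [h5, Pi.smul_apply, smul_eq_mul, h8, h6, hw, h7]
  have hne := rsym_denom_ne_zero (α := α) hc l ξ
  have h9 : (psym α c ξ : ℂ) * rsym α c l ξ
      = 1 - (((l / (2 * Real.pi * ξ) : ℝ) : ℂ) * Complex.I) * rsym α c l ξ := by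
    rw [eq_sub_iff_add_eq, ← add_mul, rsym, mul_inv_cancel₀ hne]
  have h11 : ((l / (2 * Real.pi * ξ) : ℝ) : ℂ) * ((2 * Real.pi * ξ : ℝ) : ℂ) = l := by
    rw [← Complex.ofReal_mul, div_mul_cancel₀]
    exact mul_ne_zero (by positivity) hξ
  linear_combination (-((2 * Real.pi * ξ : ℝ) : ℂ) * Complex.I * (𝓕 g : L2) ξ) * h9
    - (rsym α c l ξ * (𝓕 g : L2) ξ) * h11
    + (((2 * Real.pi * ξ : ℝ) : ℂ) * ((l / (2 * Real.pi * ξ) : ℝ) : ℂ) * rsym α c l ξ *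
      (𝓕 g : L2) ξ) * Complex.I_sq

end SolitaryWave

end FKdV

namespace FKdV

/-! ### Sobolev embedding and differentiation of the curve of waves in the speed. -/

section Curve

open Filter Topology
open scoped InnerProductSpace

/-- The weight `(1 + ξ²)^(s/2)`. -/
noncomputable def weight (s ξ : ℝ) : ℝ := (1 + ‖ξ‖ ^ 2) ^ (s / 2)

theorem weight_pos (s ξ : ℝ) : 0 < weight s ξ := Real.rpow_pos_of_pos (by positivity) _

theorem weight_neg_mul (s ξ : ℝ) : weight (-s) ξ * weight s ξ = 1 := by
  rw [weight, weight, ← Real.rpow_add (by positivity), neg_div, neg_add_cancel, Real.rpow_zero]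

theorem measurable_weight (s : ℝ) : Measurable (weight s) := by unfold weight; fun_prop

theorem weight_le_one {s : ℝ} (hs : s ≤ 0) (ξ : ℝ) : weight s ξ ≤ 1 :=
  Real.rpow_le_one_of_one_le_of_nonpos (by linarith [sq_nonneg ‖ξ‖]) (by linarith)

theorem memLp_two_weight {s : ℝ} (hs : 1 / 2 < s) : MemLp (weight (-s)) 2 volume := by
  rw [memLp_two_iff_integrable_sq (measurable_weight _).aestronglyMeasurable]
  have h1 := integrable_rpow_neg_one_add_norm_sq (E := ℝ) (μ := volume) (r := 2 * s)
    (by rw [Module.finrank_self]; push_cast; linarith)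
  refine h1.congr (Eventually.of_forall fun ξ => ?_)
  simp only [weight]
  rw [← Real.rpow_mul_natCast (by positivity)]
  congr 1
  push_cast; ring

theorem memLp_top_weight {s : ℝ} (hs : 0 ≤ s) :
    MemLp (fun ξ => (weight (-s) ξ : ℂ)) ⊤ volume := by
  refine memLp_top_of_bound
    (Complex.measurable_ofReal.comp (measurable_weight _)).aestronglyMeasurable 1
    (Eventually.of_forall fun ξ => ?_)
  rw [Complex.norm_real, Real.norm_of_nonneg (weight_pos _ _).le]
  exact weight_le_one (by linarith) ξ

/-- Functions in `H^s(ℝ)` as images of the Bessel multiplier. -/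
theorem besselPotential_eq_iff_fmul {s : ℝ} (hs : 0 ≤ s) (f g : L2) :
    besselPotential ℝ ℂ s (f : 𝓢'(ℝ, ℂ)) = (g : 𝓢'(ℝ, ℂ)) ↔ f = fmul _ (memLp_top_weight hs) g := by
  rw [besselPotential_eq_iff]
  have h3 : ∀ ξ, (weight (-s) ξ : ℂ) * (weight s ξ : ℂ) = 1 := fun ξ => by
    rw [← Complex.ofReal_mul, weight_neg_mul, Complex.ofReal_one]
  constructor
  · intro h
    apply fourier_injective
    apply Lp.ext
    filter_upwards [h, fourier_fmul_coe (memLp_top_weight hs) g] with ξ h1 h2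
    rw [h2, ← h1, ← mul_assoc]
    change _ = (weight (-s) ξ : ℂ) * (weight s ξ : ℂ) * _
    rw [h3, one_mul]
  · rintro rfl
    filter_upwards [fourier_fmul_coe (memLp_top_weight hs) g] with ξ h2
    rw [h2, ← mul_assoc]
    change (weight s ξ : ℂ) * _ * _ = _
    rw [mul_comm (weight s ξ : ℂ), h3, one_mul]

theorem integrable_fourier_fmul_weight {s : ℝ} (hs : 1 / 2 < s) (g : L2) :
    Integrable (𝓕 (fmul _ (memLp_top_weight (s := s) (by linarith)) g) : L2) := by
  have h1 : MemLp (fun ξ => (weight (-s) ξ : ℂ)) 2 volume := (memLp_two_weight hs).ofReal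
  have h2 : Integrable fun ξ => (weight (-s) ξ : ℂ) * (𝓕 g : L2) ξ :=
    h1.integrable_mul (Lp.memLp (𝓕 g : L2))
  exact h2.congr (fourier_fmul_coe _ g).symm

/-- The Sobolev embedding `H^s(ℝ) ⊆ L^∞(ℝ)`, `s > 1/2`. -/
theorem exists_ae_norm_fmul_weight_le {s : ℝ} (hs : 1 / 2 < s) : ∃ K : ℝ, 0 ≤ K ∧ ∀ g : L2,
    ∀ᵐ x, ‖fmul _ (memLp_top_weight (s := s) (by linarith)) g x‖ ≤ K * ‖g‖ := by
  refine ⟨(∫ ξ, weight (-s) ξ ^ (2 : ℝ)) ^ (1 / 2 : ℝ),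
    Real.rpow_nonneg (integral_nonneg fun ξ => Real.rpow_nonneg (weight_pos _ _).le _) _,
    fun g => ?_⟩
  set f := fmul _ (memLp_top_weight (s := s) (by linarith)) g with hf
  have h1 : Integrable (𝓕 f : L2) := integrable_fourier_fmul_weight hs g
  have h2 := fourierInv_ae_eq_of_integrable h1
  rw [fourierInv_fourier_eq] at h2
  have h3 : ∫ ξ, ‖(𝓕 f : L2) ξ‖ ≤ (∫ ξ, weight (-s) ξ ^ (2 : ℝ)) ^ (1 / 2 : ℝ) * ‖g‖ := by
    have h4 : ∫ ξ, ‖(𝓕 f : L2) ξ‖ = ∫ ξ, weight (-s) ξ * ‖(𝓕 g : L2) ξ‖ := by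
      refine integral_congr_ae ?_
      filter_upwards [fourier_fmul_coe (memLp_top_weight (s := s) (by linarith)) g] with ξ hξ
      rw [hf, hξ, norm_mul, Complex.norm_real, Real.norm_of_nonneg (weight_pos _ _).le]
    rw [h4]
    have h5 := integral_mul_le_Lp_mul_Lq_of_nonneg (μ := (volume : Measure ℝ))
      (f := weight (-s)) (g := fun ξ => ‖(𝓕 g : L2) ξ‖) Real.HolderConjugate.two_two
      (Eventually.of_forall fun ξ => (weight_pos _ _).le)
      (Eventually.of_forall fun ξ => norm_nonneg _)
      (by simpa using memLp_two_weight hs) (by simpa using (Lp.memLp (𝓕 g : L2)).norm)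
    refine h5.trans (le_of_eq ?_)
    congr 1
    have h6 : ‖(𝓕 g : L2)‖ = ‖g‖ := (Lp.fourierTransformₗᵢ ℝ ℂ).norm_map g
    have h7 := norm_sq_eq_integral (𝓕 g : L2)
    simp only [Real.rpow_two]
    rw [← h7, h6, ← Real.sqrt_eq_rpow, Real.sqrt_sq (norm_nonneg _)]
  filter_upwards [h2] with x hx
  rw [hx, Real.fourierInv_eq]
  refine (norm_integral_le_integral_norm _).trans (le_trans (le_of_eq ?_) h3)
  congr 1 with ξ
  simp

theorem bmul_sub_eq {f g : L2} (hf : MemLp f ⊤ volume) (hg : MemLp g ⊤ volume)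
    (hfg : MemLp (f - g : L2) ⊤ volume) : bmul f hf - bmul g hg = bmul (f - g : L2) hfg := by
  ext1 u
  apply Lp.ext
  rw [sub_apply]
  filter_upwards [bmul_coe hf u, bmul_coe hg u, bmul_coe hfg u, Lp.coeFn_sub f g,
    Lp.coeFn_sub (bmul f hf u) (bmul g hg u)] with x h1 h2 h3 h4 h5
  rw [h5, Pi.sub_apply, h1, h2, h3, h4, Pi.sub_apply, sub_mul]

theorem ofReal_smul_eq (r : ℝ) (f : L2) : (r : ℂ) • f = r • f := by
  apply Lp.ext
  filter_upwards [Lp.coeFn_smul (r : ℂ) f, Lp.coeFn_smul r f] with x h1 h2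
  rw [h1, h2, Pi.smul_apply, Pi.smul_apply, Complex.coe_smul]

theorem bmul_comm {f g : L2} (hf : MemLp f ⊤ volume) (hg : MemLp g ⊤ volume) :
    bmul f hf g = bmul g hg f := by
  apply Lp.ext
  filter_upwards [bmul_coe hf g, bmul_coe hg f] with x h1 h2
  rw [h1, h2, mul_comm]

/-- The derivative of a curve of solitary waves with respect to the speed. -/
theorem exists_curve_derivative {α : ℝ} (hα : 0 < α) {I : Set ℝ} (hI : I.OrdConnected)
    (hI' : I.Nontrivial) {φ : ℝ → L2} (hcurve : IsC1CurveInH (α + 1) I φ)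
    (hφ : ∀ c ∈ I, IsPositiveSolitaryWave α c (φ c)) {c : ℝ} (hc : c ∈ I) (hc0 : 0 < c)
    (hφc : MemLp (φ c) ⊤ volume) :
    ∃ χ : L2, conjL2 χ = χ ∧ χ = resL α hc0 0 (bmul (φ c) hφc χ - φ c) ∧
      derivWithin (fun b => ‖φ b‖ ^ 2) I c = 2 * (⟪χ, φ c⟫_ℂ).re := by
  obtain ⟨g, hg, hgC⟩ := hcurve
  have hs : 0 ≤ α + 1 := by linarith
  have htop : ∀ b ∈ I, MemLp (φ b) ⊤ volume := fun b hb =>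
    memLp_top_of_inH (by linarith) (hφ b hb).regular
  set B := fmul _ (memLp_top_weight hs) with hB
  have hgB : ∀ b ∈ I, φ b = B (g b) := fun b hb => (besselPotential_eq_iff_fmul hs _ _).1 (hg b hb)
  have hgd := (hgC.differentiableOn one_ne_zero c hc).hasDerivWithinAt
  set g' := derivWithin g I c
  have hφd : HasDerivWithinAt φ (B g') I c := by
    have h1 := ((B.restrictScalars ℝ).hasFDerivAt).comp_hasDerivWithinAt c hgd
    exact h1.congr hgB (hgB c hc)
  set χ := B g' with hχ
  have hslope := hasDerivWithinAt_iff_tendsto_slope.1 hφd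
  have huniq : UniqueDiffWithinAt ℝ I c := uniqueDiffWithinAt_convex hI.convex
    (hI.convex.nontrivial_iff_nonempty_interior.1 hI') (subset_closure hc)
  have : (𝓝[I \ {c}] c).NeBot := by
    rw [← accPt_principal_iff_nhdsWithin]
    exact huniq.accPt
  have hIev : ∀ᶠ b in 𝓝[I \ {c}] c, b ∈ I ∧ b ≠ c := self_mem_nhdsWithin
  classical
  -- Multiplication by `φ b`. The default `0` concerns only `b` with `φ b` unbounded, hence no point
  -- of `I`.
  set M : ℝ → L2 →L[ℂ] L2 := fun b => if h : MemLp (φ b) ⊤ volume then bmul _ h else 0 with hM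
  have hMb : ∀ b (h : MemLp (φ b) ⊤ volume), M b = bmul _ h := fun b h => dif_pos h
  -- Convergence in `H^{α+1}` implies uniform convergence, hence operator norm convergence of the
  -- multiplications.
  have hMt : Tendsto M (𝓝[I \ {c}] c) (𝓝 (M c)) := by
    obtain ⟨K, hK, hK'⟩ := exists_ae_norm_fmul_weight_le (s := α + 1) (by linarith)
    have h1 : Tendsto (fun b => K * ‖g b - g c‖) (𝓝[I \ {c}] c) (𝓝 0) := by
      have h2 : Tendsto g (𝓝[I \ {c}] c) (𝓝 (g c)) :=
        hgd.continuousWithinAt.mono_left (nhdsWithin_mono _ Set.sdiff_subset)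
      have h3 := ((h2.sub_const (g c)).norm).const_mul K
      simpa using h3
    rw [tendsto_iff_norm_sub_tendsto_zero]
    refine squeeze_zero' (Eventually.of_forall fun _ => norm_nonneg _) ?_ h1
    filter_upwards [hIev] with b hb
    have h4 : ∀ᵐ x, ‖(φ b - φ c : L2) x‖ ≤ K * ‖g b - g c‖ := by
      rw [hgB b hb.1, hgB c hc, ← map_sub]
      exact hK' _
    have h5 : MemLp (φ b - φ c : L2) ⊤ volume :=
      memLp_top_of_bound (Lp.memLp _).1 _ h4
    rw [hMb b (htop b hb.1), hMb c hφc, bmul_sub_eq _ _ h5]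
    exact norm_bmul_le h5 (by positivity) h4
  have hφt : Tendsto φ (𝓝[I \ {c}] c) (𝓝 (φ c)) :=
    hφd.continuousWithinAt.mono_left (nhdsWithin_mono _ Set.sdiff_subset)
  -- Both wave equations are inverted with the same `D^α + c`, the change of speed going to the
  -- right-hand side, and `φ_b² - φ_c² = (φ_b + φ_c) (φ_b - φ_c)`. Only bounded operators remain, so
  -- the limit can be taken in `L²`.
  have heq : ∀ᶠ b in 𝓝[I \ {c}] c, slope φ c b = resL α hc0 0
      ((1 / 2 : ℂ) • (M b (slope φ c b) + M c (slope φ c b)) - φ b) := by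
    filter_upwards [hIev] with b hb
    have h1 := (hφ b hb.1).eq_resL hc0 (htop b hb.1)
    have h2 := (hφ c hc).eq_resL hc0 hφc
    rw [← hMb] at h1 h2
    have h3 : M b (φ c) = M c (φ b) := by
      rw [hMb b (htop b hb.1), hMb c hφc]; exact bmul_comm _ _
    have h4 : φ b - φ c = resL α hc0 0 ((1 / 2 : ℂ) • (M b (φ b - φ c) + M c (φ b - φ c))
        - ((b - c : ℝ) : ℂ) • φ b) := by
      rw [map_sub (M b), map_sub (M c), h3]
      conv_lhs => rw [h1, h2]
      rw [← map_sub]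
      congr 1
      push_cast
      module
    have h5 : ((b - c : ℝ) : ℂ) ≠ 0 := by exact_mod_cast sub_ne_zero.2 hb.2
    have h6 : slope φ c b = (((b - c : ℝ) : ℂ)⁻¹) • (φ b - φ c) := by
      rw [slope_def_module, ← Complex.ofReal_inv, ofReal_smul_eq]
    rw [h6, map_smul, map_smul]
    conv_lhs => rw [h4]
    rw [← map_smul]
    congr 1
    rw [smul_sub, smul_smul _ _ (φ b), inv_mul_cancel₀ h5]
    module
  have hlim : Tendsto (fun b => resL α hc0 0
      ((1 / 2 : ℂ) • (M b (slope φ c b) + M c (slope φ c b)) - φ b)) (𝓝[I \ {c}] c)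
      (𝓝 (resL α hc0 0 ((1 / 2 : ℂ) • (M c χ + M c χ) - φ c))) := by
    have h1 : Tendsto (fun b => M b (slope φ c b)) (𝓝[I \ {c}] c) (𝓝 (M c χ)) :=
      isBoundedBilinearMap_apply.continuous.continuousAt.tendsto.comp (hMt.prodMk_nhds hslope)
    have h2 : Tendsto (fun b => M c (slope φ c b)) (𝓝[I \ {c}] c) (𝓝 (M c χ)) :=
      ((M c).continuous.tendsto _).comp hslope
    exact ((resL α hc0 0).continuous.tendsto _).comp (((h1.add h2).const_smul _).sub hφt)
  have hχeq := tendsto_nhds_unique (hslope.congr' heq) hlim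
  have hreal : ∀ b ∈ I, conjL2 (φ b) = φ b := fun b hb => (hφ b hb).conj_eq
  refine ⟨χ, ?_, ?_, ?_⟩
  · have h1 : Tendsto (fun b => conjL2 (slope φ c b)) (𝓝[I \ {c}] c) (𝓝 (conjL2 χ)) :=
      (conjL2_isConjugation.continuous.tendsto _).comp hslope
    refine tendsto_nhds_unique (h1.congr' ?_) hslope
    filter_upwards [hIev] with b hb
    rw [slope_def_module, ← ofReal_smul_eq, LinearMap.map_smulₛₗ, Complex.conj_ofReal, map_sub,
      hreal b hb.1, hreal c hc]
  · rw [hMb c hφc] at hχeq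
    conv_lhs => rw [hχeq]
    congr 1
    module
  · have h1 := (hφd.norm_sq).derivWithin huniq
    rw [h1]
    congr 1
    rw [MeasureTheory.L2.inner_def, MeasureTheory.L2.inner_def]
    rw [← RCLike.re_eq_complex_re, ← integral_re (MeasureTheory.L2.integrable_inner _ _)]
    refine integral_congr_ae (Eventually.of_forall fun x => ?_)
    simp only [RCLike.re_eq_complex_re, RCLike.inner_apply, Complex.inner]
    simp
    ring

end Curve

end FKdV

namespace FKdV

/-! ### Products in `H^s` and bootstrap regularity. -/

section Regularity

open Filter Topology
open scoped InnerProductSpace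

/-- Young's inequality `‖f * g‖₂ ≤ ‖f‖₁ ‖g‖₂`. -/
theorem lintegral_lconvolution_sq_le {f g : ℝ → ℝ≥0∞} (hf : Measurable f) (hg : Measurable g) :
    ∫⁻ x, (f ⋆ₗ[volume] g) x ^ 2 ≤ (∫⁻ x, f x) ^ 2 * ∫⁻ x, g x ^ 2 := by
  -- Cauchy–Schwarz for the measure `f dy`, by splitting `f = f^(1/2) f^(1/2)`.
  have hcs : ∀ x, (f ⋆ₗ[volume] g) x ^ 2 ≤ (∫⁻ y, f y) * ∫⁻ y, f y * g (-y + x) ^ 2 := by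
    intro x
    rw [lconvolution_def]
    have h1 := ENNReal.lintegral_mul_le_Lp_mul_Lq (volume : Measure ℝ)
      Real.HolderConjugate.two_two (f := fun y => f y ^ (1 / 2 : ℝ))
      (g := fun y => f y ^ (1 / 2 : ℝ) * g (-y + x)) (by fun_prop) (by fun_prop)
    have h2 : ∀ a : ℝ≥0∞, (a ^ (1 / 2 : ℝ)) ^ (2 : ℝ) = a := fun a => by
      rw [← ENNReal.rpow_mul]; norm_num
    have h3 : ∀ a : ℝ≥0∞, a ^ (1 / 2 : ℝ) * a ^ (1 / 2 : ℝ) = a := fun a => by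
      rw [← sq, ← ENNReal.rpow_two, h2]
    have h4 : ∀ a : ℝ≥0∞, (a ^ (1 / 2 : ℝ)) ^ 2 = a := fun a => by
      rw [← ENNReal.rpow_two, h2]
    simp only [Pi.mul_apply, ← mul_assoc, h3, ENNReal.mul_rpow_of_nonneg _ _ zero_le_two, h2] at h1
    refine (pow_le_pow_left' h1 2).trans (le_of_eq ?_)
    rw [mul_pow, h4, h4]
    simp only [ENNReal.rpow_two]
  calc ∫⁻ x, (f ⋆ₗ[volume] g) x ^ 2
      ≤ ∫⁻ x, (∫⁻ y, f y) * ∫⁻ y, f y * g (-y + x) ^ 2 := lintegral_mono hcs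
    _ = (∫⁻ y, f y) * ∫⁻ x, ∫⁻ y, f y * g (-y + x) ^ 2 := by
        rw [lintegral_const_mul]
        exact Measurable.lintegral_prod_right' (f := fun p : ℝ × ℝ => f p.2 * g (-p.2 + p.1) ^ 2)
          (by fun_prop)
    _ = (∫⁻ y, f y) * ∫⁻ y, f y * ∫⁻ x, g x ^ 2 := by
        congr 1
        rw [lintegral_lintegral_swap (by fun_prop)]
        congr 1 with y
        rw [lintegral_const_mul _ (by fun_prop),
          lintegral_add_left_eq_self (μ := volume) (fun x => g x ^ 2) (-y)]
    _ = (∫⁻ x, f x) ^ 2 * ∫⁻ x, g x ^ 2 := by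
        rw [lintegral_mul_const _ hf, sq, mul_assoc]

theorem weight_add_le {s : ℝ} (hs : 0 ≤ s) (ξ η : ℝ) :
    weight s (ξ + η) ≤ 4 ^ (s / 2) * (weight s ξ + weight s η) := by
  have h1 : 1 + ‖ξ + η‖ ^ 2 ≤ 4 * max (1 + ‖ξ‖ ^ 2) (1 + ‖η‖ ^ 2) := by
    simp only [Real.norm_eq_abs, sq_abs]
    have := le_max_left (1 + ξ ^ 2) (1 + η ^ 2)
    have := le_max_right (1 + ξ ^ 2) (1 + η ^ 2)
    nlinarith [sq_nonneg (ξ - η)]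
  calc weight s (ξ + η) ≤ (4 * max (1 + ‖ξ‖ ^ 2) (1 + ‖η‖ ^ 2)) ^ (s / 2) :=
        Real.rpow_le_rpow (by positivity) h1 (by positivity)
    _ = 4 ^ (s / 2) * (max (1 + ‖ξ‖ ^ 2) (1 + ‖η‖ ^ 2)) ^ (s / 2) :=
        Real.mul_rpow (by norm_num) (by positivity)
    _ ≤ _ := by
        gcongr
        rcases max_choice (1 + ‖ξ‖ ^ 2) (1 + ‖η‖ ^ 2) with h | h <;> rw [h]
        · exact le_add_of_nonneg_right (weight_pos s η).le
        · exact le_add_of_nonneg_left (weight_pos s ξ).le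

/-- Modulation becomes translation under the Fourier transform. -/
theorem fourier_character_bmul (ξ : ℝ) (f : L2) :
    (𝓕 (bmul (character ξ) (memLp_character ξ) f) : L2) =ᵐ[volume]
      fun η => (𝓕 f : L2) (η - ξ) := by
  set T : L2 → L2 := fun f => Lp.compMeasurePreserving (fun x : ℝ => x - ξ)
    (measurePreserving_sub_right volume ξ) f with hT
  have hTc : Continuous T :=
    (Lp.isometry_compMeasurePreserving (measurePreserving_sub_right volume ξ)).continuous
  have key : 𝓕 (bmul (character ξ) (memLp_character ξ) f) = T (𝓕 f) := by
    have hcl : IsClosed {f : L2 | 𝓕 (bmul (character ξ) (memLp_character ξ) f) = T (𝓕 f)} :=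
      isClosed_eq (fourierL.continuous.comp (ContinuousLinearMap.continuous _))
        (hTc.comp fourierL.continuous)
    have hd := SchwartzMap.denseRange_toLpCLM (F := ℂ) (E := ℝ) (μ := volume)
      (p := 2) (by norm_num)
    refine hd.induction_on f hcl fun g => ?_
    change 𝓕 (bmul (character ξ) (memLp_character ξ) (g.toLp 2)) = T (𝓕 (g.toLp 2))
    have h1 : bmul (character ξ) (memLp_character ξ) (g.toLp 2) =ᵐ[volume]
        fun x => character ξ x * g x := by
      filter_upwards [bmul_coe (memLp_character ξ) (g.toLp 2), g.coeFn_toLp 2] with x h1 h2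
      rw [h1, h2]
    have h2 : Integrable (g.toLp 2 : L2) := g.integrable.congr (g.coeFn_toLp 2 volume).symm
    have h3 : Integrable (bmul (character ξ) (memLp_character ξ) (g.toLp 2)) := by
      refine h2.congr' (Lp.memLp _).1 ?_ |>.congr (ae_eq_refl _)
      filter_upwards [bmul_coe (memLp_character ξ) (g.toLp 2)] with x h1
      rw [h1, norm_mul, norm_character, one_mul]
    apply Lp.ext
    have h4 := (measurePreserving_sub_right (volume : Measure ℝ) ξ).quasiMeasurePreserving.ae
      (fourier_ae_eq_of_integrable h2)
    filter_upwards [fourier_ae_eq_of_integrable h3, h4,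
      Lp.coeFn_compMeasurePreserving (𝓕 (g.toLp 2) : L2)
        (measurePreserving_sub_right (volume : Measure ℝ) ξ)] with η h5 h6 h7
    rw [h5, hT, h7, Function.comp_apply, h6, Real.fourier_real_eq_integral_exp_smul,
      Real.fourier_real_eq_integral_exp_smul]
    refine integral_congr_ae ?_
    filter_upwards [h1, g.coeFn_toLp 2] with x h8 h9
    rw [h8, h9, character, smul_eq_mul, smul_eq_mul, ← mul_assoc, ← Complex.exp_add]
    congr 2
    push_cast; ring
  rw [key]
  exact Lp.coeFn_compMeasurePreserving _ _

/-- The Fourier transform of a product is dominated by the convolution of the transforms. -/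
theorem enorm_fourier_bmul_le {φ : L2} (hφ : MemLp φ ⊤ volume) (u : L2) :
    ∀ᵐ ξ, ‖(𝓕 (bmul φ hφ u) : L2) ξ‖ₑ ≤
      ((fun η => ‖(𝓕 u : L2) η‖ₑ) ⋆ₗ[volume] fun η => ‖(𝓕 φ : L2) η‖ₑ) ξ := by
  filter_upwards [fourier_bmul_eq_inner hφ u] with ξ hξ
  have h1 : ⟪bmul (character ξ) (memLp_character ξ) (conjL2 φ), u⟫_ℂ =
      ⟪(𝓕 (bmul (character ξ) (memLp_character ξ) (conjL2 φ)) : L2), 𝓕 u⟫_ℂ :=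
    ((Lp.fourierTransformₗᵢ ℝ ℂ).inner_map_map _ _).symm
  rw [hξ, h1, MeasureTheory.L2.inner_def, lconvolution_def]
  refine (enorm_integral_le_lintegral_enorm _).trans (le_of_eq ?_)
  refine lintegral_congr_ae ?_
  have h2 := (measurePreserving_sub_right (volume : Measure ℝ) ξ).quasiMeasurePreserving.ae
      (fourier_conjL2_coe φ)
  filter_upwards [fourier_character_bmul ξ (conjL2 φ), h2] with η h3 h4
  rw [RCLike.inner_apply, h3, h4, Complex.conj_conj, enorm_mul, neg_sub, neg_add_eq_sub]

theorem inH_iff_lintegral (s : ℝ) (f : L2) :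
    InH s f ↔ ∫⁻ ξ, (ENNReal.ofReal (weight s ξ) * ‖(𝓕 f : L2) ξ‖ₑ) ^ 2 < ⊤ := by
  rw [inH_iff_memLp, MemLp, eLpNorm_lt_top_iff_lintegral_rpow_enorm_lt_top (by norm_num)
    (by norm_num)]
  have h1 : AEStronglyMeasurable (fun ξ : ℝ => ((weight s ξ : ℝ) : ℂ) * (𝓕 f : L2) ξ) volume :=
    (Complex.measurable_ofReal.comp (measurable_weight s)).aestronglyMeasurable.mul (Lp.memLp _).1
  have h2 : ∀ ξ, ‖((weight s ξ : ℝ) : ℂ) * (𝓕 f : L2) ξ‖ₑ =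
      ENNReal.ofReal (weight s ξ) * ‖(𝓕 f : L2) ξ‖ₑ := fun ξ => by
    rw [enorm_mul, ← ofReal_norm, Complex.norm_real,
      Real.norm_of_nonneg (weight_pos _ _).le]
  rw [and_iff_right (by exact h1)]
  change ∫⁻ ξ, ‖((weight s ξ : ℝ) : ℂ) * (𝓕 f : L2) ξ‖ₑ ^ (ENNReal.toReal 2) < ⊤ ↔ _
  simp only [h2, ENNReal.toReal_ofNat, ENNReal.rpow_two]

theorem inH_mono {s t : ℝ} (h : s ≤ t) {f : L2} (hf : InH t f) : InH s f := by
  rw [inH_iff_lintegral] at hf ⊢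
  refine (lintegral_mono fun ξ => ?_).trans_lt hf
  gcongr
  exact Real.rpow_le_rpow_of_exponent_le (by linarith [sq_nonneg ‖ξ‖]) (by linarith)

theorem inH_zero (f : L2) : InH 0 f := by
  rw [inH_iff_memLp]
  simpa using Lp.memLp (𝓕 f : L2)

theorem measurable_enorm_fourier (f : L2) : Measurable fun ξ => ‖(𝓕 f : L2) ξ‖ₑ :=
  (Lp.stronglyMeasurable (𝓕 f : L2)).enorm

theorem measurable_ofReal_weight (s : ℝ) : Measurable fun ξ => ENNReal.ofReal (weight s ξ) :=
  (measurable_weight s).ennreal_ofReal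

/-- The weighted Fourier transform is integrable for functions of higher regularity. -/
theorem lintegral_weight_lt_top {s t : ℝ} (h : s + 1 / 2 < t) {f : L2} (hf : InH t f) :
    ∫⁻ ξ, ENNReal.ofReal (weight s ξ) * ‖(𝓕 f : L2) ξ‖ₑ < ⊤ := by
  rw [inH_iff_memLp] at hf
  have h1 : MemLp (fun ξ => (weight (-(t - s)) ξ : ℂ)) 2 volume :=
    (memLp_two_weight (by linarith)).ofReal
  have h2 := (h1.integrable_mul hf).2
  rw [hasFiniteIntegral_iff_enorm] at h2
  refine lt_of_eq_of_lt (lintegral_congr fun ξ => ?_) h2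
  rw [Pi.mul_apply, ← mul_assoc, ← Complex.ofReal_mul, enorm_mul]
  congr 1
  have h3 : weight (-(t - s)) ξ * (1 + ‖ξ‖ ^ 2) ^ (t / 2) = weight s ξ := by
    rw [weight, weight, ← Real.rpow_add (by positivity)]
    congr 1; ring
  rw [h3, ← ofReal_norm, Complex.norm_real, Real.norm_of_nonneg (weight_pos _ _).le]

/-- A fractional Leibniz rule: by `weight_add_le`, the weight at `ξ = η + (ξ - η)` falls, up to a
constant, on one of the two factors of the convolution. -/
theorem inH_bmul_of_lconvolution {s : ℝ} (hs : 0 ≤ s) {φ : L2} (hφ : MemLp φ ⊤ volume) {u : L2}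
    (h1 : ∫⁻ ξ, ((fun η => ENNReal.ofReal (weight s η) * ‖(𝓕 u : L2) η‖ₑ) ⋆ₗ[volume]
      fun η => ‖(𝓕 φ : L2) η‖ₑ) ξ ^ 2 < ⊤)
    (h2 : ∫⁻ ξ, ((fun η => ‖(𝓕 u : L2) η‖ₑ) ⋆ₗ[volume]
      fun η => ENNReal.ofReal (weight s η) * ‖(𝓕 φ : L2) η‖ₑ) ξ ^ 2 < ⊤) :
    InH s (bmul φ hφ u) := by
  rw [inH_iff_lintegral]
  set a := fun η => ‖(𝓕 u : L2) η‖ₑ with ha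
  set b := fun η => ‖(𝓕 φ : L2) η‖ₑ with hb
  set a' := fun η => ENNReal.ofReal (weight s η) * ‖(𝓕 u : L2) η‖ₑ with ha'
  set b' := fun η => ENNReal.ofReal (weight s η) * ‖(𝓕 φ : L2) η‖ₑ with hb'
  have hma : Measurable a := measurable_enorm_fourier u
  have hmb : Measurable b := measurable_enorm_fourier φ
  have hma' : Measurable a' := (measurable_ofReal_weight s).mul hma
  have hmb' : Measurable b' := (measurable_ofReal_weight s).mul hmb
  set C := ENNReal.ofReal (4 ^ (s / 2))
  have key : ∀ ξ, ENNReal.ofReal (weight s ξ) * (a ⋆ₗ[volume] b) ξ ≤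
      C * ((a' ⋆ₗ[volume] b) ξ + (a ⋆ₗ[volume] b') ξ) := by
    intro ξ
    rw [lconvolution_def, lconvolution_def, lconvolution_def, ← lintegral_add_left (by fun_prop),
      ← lintegral_const_mul _ (by fun_prop), ← lintegral_const_mul _ (by fun_prop)]
    refine lintegral_mono fun η => ?_
    have h3 : ENNReal.ofReal (weight s ξ) ≤
        C * (ENNReal.ofReal (weight s η) + ENNReal.ofReal (weight s (-η + ξ))) := by
      rw [← ENNReal.ofReal_add (weight_pos _ _).le (weight_pos _ _).le,
        ← ENNReal.ofReal_mul (by positivity)]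
      refine ENNReal.ofReal_le_ofReal ?_
      have := weight_add_le hs η (-η + ξ)
      rwa [add_neg_cancel_left] at this
    calc _ ≤ C * (ENNReal.ofReal (weight s η) + ENNReal.ofReal (weight s (-η + ξ))) *
          (a η * b (-η + ξ)) := by gcongr
      _ = _ := by simp only [ha, hb, ha', hb']; ring
  calc ∫⁻ ξ, (ENNReal.ofReal (weight s ξ) * ‖(𝓕 (bmul φ hφ u) : L2) ξ‖ₑ) ^ 2
      ≤ ∫⁻ ξ, (C ^ 2 * 2) * ((a' ⋆ₗ[volume] b) ξ ^ 2 + (a ⋆ₗ[volume] b') ξ ^ 2) := by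
        refine lintegral_mono_ae ?_
        filter_upwards [enorm_fourier_bmul_le hφ u] with ξ hξ
        calc _ ≤ (C * ((a' ⋆ₗ[volume] b) ξ + (a ⋆ₗ[volume] b') ξ)) ^ 2 := by
              exact pow_le_pow_left' ((mul_le_mul_right hξ _).trans (key ξ)) 2
          _ ≤ _ := by
              rw [mul_pow, mul_assoc]
              gcongr
              have h3 := ENNReal.rpow_add_le_mul_rpow_add_rpow ((a' ⋆ₗ[volume] b) ξ)
                ((a ⋆ₗ[volume] b') ξ) (p := 2) one_le_two
              norm_num at h3
              exact h3
    _ = (C ^ 2 * 2) * ((∫⁻ ξ, (a' ⋆ₗ[volume] b) ξ ^ 2) + ∫⁻ ξ, (a ⋆ₗ[volume] b') ξ ^ 2) := by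
        have h5 : Measurable (a' ⋆ₗ[volume] b) := by fun_prop
        have h6 : Measurable (a ⋆ₗ[volume] b') := by fun_prop
        rw [lintegral_const_mul _ (by fun_prop), lintegral_add_left (by fun_prop)]
    _ < ⊤ := ENNReal.mul_lt_top (ENNReal.mul_lt_top (ENNReal.pow_lt_top ENNReal.ofReal_lt_top)
        (by norm_num)) (ENNReal.add_lt_top.2 ⟨h1, h2⟩)

theorem lintegral_enorm_sq_lt_top (f : L2) : ∫⁻ ξ, ‖(𝓕 f : L2) ξ‖ₑ ^ 2 < ⊤ := by
  have h1 := (inH_iff_lintegral 0 f).1 (inH_zero f)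
  simpa [weight] using h1

theorem lintegral_enorm_lt_top {t : ℝ} (h : 1 / 2 < t) {f : L2} (hf : InH t f) :
    ∫⁻ ξ, ‖(𝓕 f : L2) ξ‖ₑ < ⊤ := by
  have h1 := lintegral_weight_lt_top (s := 0) (by linarith) hf
  simpa [weight] using h1

theorem lintegral_lconvolution_sq_lt_top {f g : ℝ → ℝ≥0∞} (hf : Measurable f) (hg : Measurable g)
    (h1 : ∫⁻ x, f x < ⊤) (h2 : ∫⁻ x, g x ^ 2 < ⊤) : ∫⁻ x, (f ⋆ₗ[volume] g) x ^ 2 < ⊤ :=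
  (lintegral_lconvolution_sq_le hf hg).trans_lt (ENNReal.mul_lt_top (ENNReal.pow_lt_top h1) h2)

theorem inH_bmul_self {s : ℝ} (hs : 1 / 2 < s) {φ : L2} (hφ : MemLp φ ⊤ volume) (h : InH s φ) :
    InH s (bmul φ hφ φ) := by
  have h1 := lintegral_lconvolution_sq_lt_top (measurable_enorm_fourier φ)
    ((measurable_ofReal_weight s).mul (measurable_enorm_fourier φ)) (lintegral_enorm_lt_top hs h)
    ((inH_iff_lintegral s φ).1 h)
  refine inH_bmul_of_lconvolution (by linarith) hφ ?_ h1
  rwa [lconvolution_comm]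

/-- Here `u` may be merely in `L²`; both `L¹` norms in Young's inequality are taken on the smoother
factor `φ`. -/
theorem inH_bmul {s t : ℝ} (hs : 0 ≤ s) (hst : s + 1 / 2 < t) {φ u : L2} (hφ : MemLp φ ⊤ volume)
    (h : InH t φ) (hu : InH s u) : InH s (bmul φ hφ u) := by
  refine inH_bmul_of_lconvolution hs hφ ?_ ?_
  · rw [lconvolution_comm]
    exact lintegral_lconvolution_sq_lt_top (measurable_enorm_fourier φ)
      ((measurable_ofReal_weight s).mul (measurable_enorm_fourier u))
      (lintegral_enorm_lt_top (by linarith) h) ((inH_iff_lintegral s u).1 hu)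
  · rw [lconvolution_comm]
    exact lintegral_lconvolution_sq_lt_top
      ((measurable_ofReal_weight s).mul (measurable_enorm_fourier φ)) (measurable_enorm_fourier u)
      (lintegral_weight_lt_top hst h) (lintegral_enorm_sq_lt_top u)

theorem exists_weight_le_psym {α c : ℝ} (hα0 : 0 ≤ α) (hα1 : α ≤ 1) (hc : 0 < c) :
    ∃ K : ℝ, 0 ≤ K ∧ ∀ ξ, weight α ξ ≤ K * psym α c ξ := by
  refine ⟨1 + c⁻¹, by positivity, fun ξ => ?_⟩
  have h1 : weight α ξ ≤ 1 + |2 * Real.pi * ξ| ^ α := by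
    have h2 : weight α ξ ≤ (1 + |2 * Real.pi * ξ|) ^ α := by
      have h3 : (1 + |2 * Real.pi * ξ|) ^ α = ((1 + |2 * Real.pi * ξ|) ^ 2) ^ (α / 2) := by
        rw [← Real.rpow_natCast, ← Real.rpow_mul (by positivity)]
        congr 1; push_cast; ring
      rw [h3]
      refine Real.rpow_le_rpow (by positivity) ?_ (by positivity)
      have h4 : |ξ| ≤ |2 * Real.pi * ξ| := by
        rw [abs_mul, abs_of_pos (by positivity : 0 < 2 * Real.pi)]
        nlinarith [Real.pi_gt_three, abs_nonneg ξ]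
      rw [Real.norm_eq_abs]
      nlinarith [abs_nonneg ξ, abs_nonneg (2 * Real.pi * ξ)]
    -- Subadditivity of `x ↦ x ^ α`, which uses `α ≤ 1`.
    refine h2.trans ((Real.rpow_add_le_add_rpow zero_le_one (abs_nonneg _) hα0 hα1).trans ?_)
    rw [Real.one_rpow]
  have h5 : 0 ≤ |2 * Real.pi * ξ| ^ α := by positivity
  refine h1.trans ?_
  rw [psym]
  have h6 : c⁻¹ * c = 1 := inv_mul_cancel₀ hc.ne'
  have h7 : 0 ≤ c⁻¹ * |2 * Real.pi * ξ| ^ α := by positivity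
  nlinarith

/-- The bounded inverse gains `α` derivatives. -/
theorem inH_resL {α c : ℝ} (hα0 : 0 ≤ α) (hα1 : α ≤ 1) (hc : 0 < c) (l s : ℝ) {g : L2}
    (hg : InH s g) : InH (s + α) (resL α hc l g) := by
  obtain ⟨K, hK, hK'⟩ := exists_weight_le_psym hα0 hα1 hc
  rw [inH_iff_lintegral] at hg ⊢
  have h0 : ∫⁻ ξ, ENNReal.ofReal K ^ 2 * (ENNReal.ofReal (weight s ξ) * ‖(𝓕 g : L2) ξ‖ₑ) ^ 2 < ⊤ := by
    rw [lintegral_const_mul' _ _ (ENNReal.pow_ne_top ENNReal.ofReal_ne_top)]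
    exact ENNReal.mul_lt_top (ENNReal.pow_lt_top ENNReal.ofReal_lt_top) hg
  refine (lintegral_mono_ae ?_).trans_lt h0
  filter_upwards [fourier_fmul_coe (memLp_rsym (α := α) hc l) g] with ξ h1
  rw [resL, h1, enorm_mul, ← mul_pow, ← mul_assoc, ← mul_assoc]
  refine pow_le_pow_left' (mul_le_mul_left ?_ _) 2
  rw [← ofReal_norm, ← ENNReal.ofReal_mul (weight_pos _ _).le, ← ENNReal.ofReal_mul hK]
  refine ENNReal.ofReal_le_ofReal ?_
  have h2 : weight (s + α) ξ = weight s ξ * weight α ξ := by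
    rw [weight, weight, weight, ← Real.rpow_add (by positivity)]
    congr 1; ring
  have h3 := psym_pos (α := α) hc ξ
  have h4 := weight_pos s ξ
  have h5 := weight_pos α ξ
  calc weight (s + α) ξ * ‖rsym α c l ξ‖ ≤ (weight s ξ * (K * psym α c ξ)) * (psym α c ξ)⁻¹ := by
        rw [h2]
        gcongr
        · exact hK' ξ
        · exact norm_rsym_le hc l ξ
    _ = K * weight s ξ := by field_simp

theorem inH_add_smul {s : ℝ} {f g : L2} (hf : InH s f) (hg : InH s g) (a : ℂ) :
    InH s (f + a • g) := by
  rw [inH_iff_memLp] at hf hg ⊢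
  refine (hf.add (hg.const_mul a)).ae_eq ?_
  rw [fourier_add_smul]
  filter_upwards [coeFn_add_smul (𝓕 f) (𝓕 g) a] with ξ h
  rw [Pi.add_apply, h]
  ring

/-- Solitary waves are smooth. -/
theorem IsPositiveSolitaryWave.inH {α c : ℝ} {φ : L2} (h : IsPositiveSolitaryWave α c φ)
    (hα0 : 0 < α) (hα1 : α ≤ 1) (hc : 0 < c) (s : ℝ) : InH s φ := by
  have hφ : MemLp φ ⊤ volume := memLp_top_of_inH (by linarith) h.regular
  have h1 := h.eq_resL hc hφ
  rw [sub_self, Complex.ofReal_zero, zero_smul, sub_zero] at h1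
  have h2 : ∀ k : ℕ, InH (α + 1 + k * α) φ := by
    intro k
    induction k with
    | zero => simpa using h.regular
    | succ k ih =>
      have h3 := inH_bmul_self (by nlinarith [(Nat.cast_nonneg k : (0 : ℝ) ≤ k)]) hφ ih
      have h4 : InH (α + 1 + k * α) ((1 / 2 : ℂ) • bmul φ hφ φ) := by
        -- Half of the product, written as `f - f / 2`.
        have := inH_add_smul h3 h3 (-1 / 2)
        convert this using 1
        module
      have h5 := inH_resL hα0.le hα1 hc 0 _ h4
      rw [← h1] at h5
      convert h5 using 1
      push_cast; ring
  obtain ⟨k, hk⟩ := exists_nat_ge ((s - α - 1) / α)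
  refine inH_mono ?_ (h2 k)
  rw [div_le_iff₀ hα0] at hk
  linarith

/-- Fixed points of the bounded problem are smooth. -/
theorem inH_of_eq_resL {α c l : ℝ} (hα0 : 0 < α) (hα1 : α ≤ 1) (hc : 0 < c) {φ u : L2}
    (hφ : MemLp φ ⊤ volume) (hreg : ∀ s, InH s φ) (hu : u = resL α hc l (bmul φ hφ u)) (s : ℝ) :
    InH s u := by
  have h2 : ∀ k : ℕ, InH (k * α) u := by
    intro k
    induction k with
    | zero => simpa using inH_zero u
    | succ k ih =>
      -- Any exponent above `k * α + 1 / 2` serves, as `φ` lies in every `H^t`.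
      have h3 := inH_bmul (t := k * α + 1) (by positivity) (by linarith) hφ (hreg _) ih
      have h5 := inH_resL hα0.le hα1 hc l _ h3
      rw [← hu] at h5
      convert h5 using 1
      push_cast; ring
  obtain ⟨k, hk⟩ := exists_nat_ge (s / α)
  refine inH_mono ?_ (h2 k)
  rwa [div_le_iff₀ hα0] at hk

end Regularity

end FKdV

namespace FKdV

/-! ### From fixed points of `Y l ∘ φ` to growing modes. -/

section GrowingMode

open scoped InnerProductSpace

/-- Eigenfunctions of `∂ₓ L_c` are growing modes of the linearized equation. -/
theorem solvesLinearized_of_eq_resL {α c l : ℝ} (hc : 0 < c) {φ u : L2} (hφ : MemLp φ ⊤ volume)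
    (hu : u = resL α hc l (bmul φ hφ u)) :
    SolvesLinearized α c φ fun t => ((Real.exp (l * t) : ℝ) : ℂ) • u := by
  obtain ⟨w, h, hw, hl⟩ := exists_fracD_of_resL hc hu
  intro t
  set e : ℂ := ((Real.exp (l * t) : ℝ) : ℂ) with he
  refine ⟨(fracD α).domain.smul_mem e h, mem_mulOp_domain hφ _, e • (l : ℂ) • u, ?_, ?_⟩
  · have h1 : HasDerivAt (fun t : ℝ => Real.exp (l * t)) (Real.exp (l * t) * l) t := by
      simpa using ((hasDerivAt_id t).const_mul l).exp
    have h2 := h1.smul_const u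
    simp only [← ofReal_smul_eq] at h2
    rw [Complex.ofReal_mul, ← smul_smul] at h2
    exact h2
  · have h1 : fracD α ⟨e • u, (fracD α).domain.smul_mem e h⟩ = e • fracD α ⟨u, h⟩ :=
      (fracD α).map_smul e ⟨u, h⟩
    set T := Lp.toTemperedDistributionCLM ℂ (volume : Measure ℝ) 2
    have h2 : ∀ f : L2, (f : 𝓢'(ℝ, ℂ)) = T f := fun _ => rfl
    have h3 : ∀ f : L2, ddx f = derivCLM ℂ (T f) := fun _ => rfl
    rw [mulOp_eq_bmul hφ, h1]
    simp only [← he, h2, h3, ← hw, map_smul, map_add, map_sub] at hl ⊢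
    clear_value e
    rw [hl]
    module

end GrowingMode

end FKdV

/-! ### Assembly of the proof. -/

theorem mainTheorem2
    (α : ℝ) (hα : α ∈ Set.Ioo (1 / 3 : ℝ) (1 / 2))
    (I : Set ℝ) (hI : I.OrdConnected) (hI' : I.Nontrivial) (hIpos : I ⊆ Set.Ioi 0)
    (φ : ℝ → FKdV.L2)
    (hcurve : FKdV.IsC1CurveInH (α + 1) I φ)
    (hφ : ∀ c ∈ I, FKdV.IsPositiveSolitaryWave α c (φ c))
    (c : ℝ) (hc : c ∈ I)
    (hker : ∃ ψ : FKdV.L2, (ψ : 𝓢'(ℝ, ℂ)) = FKdV.ddx (φ c) ∧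
      FKdV.eigenspace (FKdV.linOp α c (φ c)) 0 = Submodule.span ℂ {ψ})
    (n : ℕ) (hn : FKdV.morseIndex (FKdV.linOp α c (φ c)) = (n : ℕ∞))
    (hcases : (Even n ∧ 0 < derivWithin (fun b => ‖φ b‖ ^ 2) I c) ∨
      (Odd n ∧ derivWithin (fun b => ‖φ b‖ ^ 2) I c < 0)) :
    ∃ (lam : ℝ) (u : FKdV.L2), 0 < lam ∧ u ≠ 0 ∧
      (∀ᵐ x : ℝ, (u x).im = 0) ∧
      (∀ s : ℝ, 0 ≤ s → FKdV.InH s u) ∧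
      FKdV.SolvesLinearized α c (φ c) (fun t => ((Real.exp (lam * t) : ℝ) : ℂ) • u) := by
  obtain ⟨hα1, hα2⟩ := hα
  have hα0 : 0 < α := by linarith
  have hc0 : 0 < c := hIpos hc
  have hwave := hφ c hc
  have htop : MemLp (φ c) ⊤ volume := FKdV.memLp_top_of_inH (by linarith) hwave.regular
  obtain ⟨ψ, hψ, hψker⟩ := hker
  obtain ⟨χ, hχJ, hχ, hχd⟩ :=
    FKdV.exists_curve_derivative hα0 hI hI' hcurve hφ hc hc0 htop
  rw [FKdV.eigenspace_linOp hc0 htop] at hψker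
  have hψ0 : ψ = FKdV.resL α hc0 0 (FKdV.bmul (φ c) htop ψ) := by
    have h1 : ψ ∈ FKdV.fixSpace (FKdV.resL α hc0 0) (FKdV.bmul (φ c) htop) 0 := by
      rw [hψker]; exact Submodule.mem_span_singleton_self ψ
    rw [FKdV.mem_fixSpace, zero_smul, add_zero] at h1
    exact h1
  have hreal := FKdV.ae_conj_eq hwave.conj_eq
  have hrank : Module.rank ℂ (⨆ m : Set.Iio (0 : ℝ), FKdV.fixSpace (FKdV.resL α hc0 0)
      (FKdV.bmul (φ c) htop) ((m : ℝ) : ℂ) : Submodule ℂ FKdV.L2) = n := by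
    rw [FKdV.morseIndex, iSup_congr fun m : Set.Iio (0 : ℝ) =>
      FKdV.eigenspace_linOp (α := α) hc0 htop ((m : ℝ) : ℂ)] at hn
    exact Cardinal.toENat_eq_natCast.1 hn
  -- By `hχd` the derivative of `‖φ b‖ ^ 2` is twice this real part, so both cases amount to the
  -- same sign condition.
  have hsign : 0 < (-1) ^ n * (inner ℂ χ (φ c)).re := by
    rw [hχd] at hcases
    rcases hcases with ⟨h1, h2⟩ | ⟨h1, h2⟩
    · rw [h1.neg_one_pow]; linarith
    · rw [h1.neg_one_pow]; linarith
  obtain ⟨l, hl, u, hu0, huJ, hu⟩ := FKdV.exists_real_kernel_of_parity FKdV.conjL2_isConjugation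
    (FKdV.resL_family hc0) (FKdV.conjL2_bmul htop htop hreal) (FKdV.inner_bmul htop htop hreal)
    (FKdV.resL_mul_isCompact hα0 hc0 htop) hrank (FKdV.ddx_ne_zero hwave.ne_zero hψ)
    (FKdV.conj_ddx hwave.conj_eq hψ) hψker hwave.conj_eq hχJ
    (FKdV.kernel_eq_resL hc0 hψ hψ0) hχ hsign
  refine ⟨l, u, hl, hu0, ?_, ?_, FKdV.solvesLinearized_of_eq_resL hc0 htop hu⟩
  · have h1 := FKdV.conjL2_coe u
    rw [huJ] at h1
    filter_upwards [h1] with x hx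
    exact Complex.conj_eq_iff_im.1 hx.symm
  · intro s _
    exact FKdV.inH_of_eq_resL hα0 (by linarith) hc0 htop
      (hwave.inH hα0 (by linarith) hc0) hu s
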